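/- For a finite set $P\subset[0,1]^d$ let $\mathrm{disp}(P)$ be the supremum of the volumes of all boxes $I_1\times\dots\times I_d$, with intervals $I_\ell\subset[0,1]$, that do not intersect $P$. For $m,k\ge 1$ let $\mathcal C_{m,k}$ be the following system of subsets of $\{0,\dots,2^m-2\}^k$. For $s,q\in\{1,\dots,2^m-1\}^k$ call $(s,q)$ admissible if there is a box $I_1\times\dots\times I_k\subset[0,1]^k$ of volume $>2^{-m}$ with $\frac{s_\ell}{2^m}<|I_\ell|\le\frac{s_\ell+1}{2^m}$ and $\inf I_\ell\in[\frac{q_\ell-1}{2^m},\frac{q_\ell}{2^m})$ for all $\ell$. Then $\mathcal C_{m,k}$ consists of the sets of all $x\in\{0,\dots,2^m-2\}^k$ with $\frac{x_\ell+1}{2^m}\in[\frac{q_\ell}{2^m},\frac{q_\ell+s_\ell-1}{2^m}]$ for all $\ell$, where $(s,q)$ is admissible. **Theorem.** There are absolute constants $C,c<\infty$ and a single deterministic algorithm (a program for a random access machine with integer and real registers, with unit cost for addition, subtraction and comparison of integers or of reals and for halving of reals) such that for every $\varepsilon\in(0,\frac14]$ there is $K_\varepsilon<\infty$ such that for all integers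 $d\ge2$ the algorithm, on input $(\varepsilon,d)$, halts after at most $K_\varepsilon d^c$ steps and outputs a finite set $P\subset[0,1]^d$ with $\mathrm{disp}(P)\le\varepsilon$ and $$\#P\le C\left(\frac{1+\log_2(\varepsilon^{-1})}{\varepsilon}\right)^6\log(d^*),\qquad d^*:=\max(d,2/\varepsilon).$$ Moreover $P$ has the following form. Let $m$ be the integer with $2^{-m}\le\varepsilon<2^{-m+1}$, $D:=\max(d,\lfloor2/\varepsilon\rfloor)$, $A_m:=\min(m2^m,D)$ and $b:=2^m-1$. Then $P$ consists of the first $d$ coordinates of the points $2^{-m}(\tau\circ a+(1,\dots,1))\in[0,1]^D$, $\tau\in T$, $a\in A$, where * $A$ is a $(D,A_m,A_m^2)$-splitter, that is, a set of maps $a:\{1,\dots,D\}\to\{1,\dots,A_m^2\}$ such that for every $S\subset\{1,\dots,D\}$ with $\#S=A_m$ some $a\in A$ splits $S$ as evenly as possible (equivalently, is injective on $S$), and $\#A\le C A_m^4\log D$; * $T\subset\{0,\dots,b-1\}^{A_m^2}$ solves the $A_m$-restriction problem for $\mathcal C_{m,A_m}$, that is, for all $S\subset\{1,\dots,A_m^2\}$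 with $\#S=A_m$ and all $Q\in\mathcal C_{m,A_m}$ there is $\tau\in T$ with $\tau|_S\in Q$; its size is at most $\left\lceil \frac{b^{A_m}}{c_0}\log\bigl((A_m^2)^{A_m}2^{2mA_m}\bigr)\right\rceil$, where $c_0:=\min\{\#Q:Q\in\mathcal C_{m,A_m}\}$; * $T$ is found by exhaustive search over an $A_m$-wise independent space $\Omega\subset\{0,\dots,b-1\}^{A_m^2}$ (under the uniform distribution on $\Omega$, any $A_m$ coordinates are jointly uniform): its elements are chosen one after the other, each satisfying, among all elements of $\Omega$, the largest number of the restrictions $(S,Q)$ not yet satisfied by the earlier ones. -/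

import Mathlib

open MeasureTheory

noncomputable section

/-! ## Boxes and dispersion -/

/-- The side sets of an axis-parallel box `I 0 × ⋯ × I (d-1)` in the unit cube: each `I l` is an
interval (open, closed, half-open, possibly degenerate or empty) contained in `[0,1]`. -/
def IsBoxSides {d : ℕ} (I : Fin d → Set ℝ) : Prop :=
  ∀ l, (I l).OrdConnected ∧ I l ⊆ Set.Icc 0 1

/-- The dispersion of `P`: the supremum of the volumes of the boxes that do not meet `P`. -/
def dispersion {d : ℕ} (P : Set (Fin d → ℝ)) : ENNReal :=
  ⨆ (I : Fin d → Set ℝ) (_ : IsBoxSides I) (_ : Disjoint (Set.univ.pi I) P),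
    volume (Set.univ.pi I)

/-! ## Splitters -/

/-- `H` is an `(n,k,l)`-splitter: every `k`-subset `S` of the domain is split by some `h ∈ H` into
`l` parts `h⁻¹(j) ∩ S` whose sizes are as similar as possible, i.e. differ by at most one. -/
def IsSplitter {n l : ℕ} (k : ℕ) (H : Finset (Fin n → Fin l)) : Prop :=
  ∀ S : Finset (Fin n), S.card = k → ∃ h ∈ H, ∀ i j : Fin l,
    (S.filter fun v => h v = i).card ≤ (S.filter fun v => h v = j).card + 1

/-! ## Restriction problems -/

/-- `T` satisfies the `k`-restriction problem for `𝒞`: for every `k`-subset of the coordinates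
(enumerated increasingly by `e`) and every `C ∈ 𝒞`, some `x ∈ T` restricts to an element of `C`. -/
def SolvesRestrictions {b k n : ℕ} (𝒞 : Set (Set (Fin k → Fin b)))
    (T : Set (Fin n → Fin b)) : Prop :=
  ∀ e : Fin k ↪o Fin n, ∀ C ∈ 𝒞, ∃ x ∈ T, (fun i => x (e i)) ∈ C

/-- The smallest cardinality of a member of `𝒞`. -/
def minCard {b k : ℕ} (𝒞 : Set (Set (Fin k → Fin b))) : ℕ :=
  sInf (Set.ncard '' 𝒞)

/-- `Ω` with the uniform distribution is a `k`-wise independent space of `n` random variables, each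
uniform on `b` values: any `k` of the coordinates are jointly uniform on the `b ^ k` patterns. -/
def IsKWiseIndependent {b n : ℕ} (k : ℕ) (Ω : Finset (Fin n → Fin b)) : Prop :=
  Ω.Nonempty ∧ ∀ (e : Fin k ↪o Fin n) (v : Fin k → Fin b),
    (Ω.filter fun x => (fun i => x (e i)) = v).card * b ^ k = Ω.card

/-- The number of restrictions (pairs of a `k`-subset of the coordinates and a `C ∈ 𝒞`) which are
violated by all members of `T` and satisfied by `x`. -/
def gain {b k n : ℕ} (𝒞 : Set (Set (Fin k → Fin b))) (T : List (Fin n → Fin b))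
    (x : Fin n → Fin b) : ℕ :=
  Set.ncard {q : (Fin k ↪o Fin n) × Set (Fin k → Fin b) |
    q.2 ∈ 𝒞 ∧ (∀ y ∈ T, (fun i => y (q.1 i)) ∉ q.2) ∧ (fun i => x (q.1 i)) ∈ q.2}

/-- `T` is produced by repeated exhaustive search through `Ω`: each vector of the list is one that
satisfies, among all members of `Ω`, the largest number of the restrictions still outstanding. -/
def FoundBySearch {b k n : ℕ} (𝒞 : Set (Set (Fin k → Fin b))) (Ω : Finset (Fin n → Fin b))
    (T : List (Fin n → Fin b)) : Prop :=
  ∀ (i : ℕ) (hi : i < T.length),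
    T[i] ∈ Ω ∧ ∀ x ∈ Ω, gain 𝒞 (T.take i) x ≤ gain 𝒞 (T.take i) T[i]

/-! ## The restrictions coming from large boxes -/

/-- The pairs `(s, p)`, `s ∈ {1,…,2^m-1}^k` and `p ∈ {1/2^m,…,(2^m-1)/2^m}^k` (here `p` is given by
its numerators), for which there is a box of volume larger than `2^(-m)` whose `l`-th side has
length in `(s_l/2^m, (s_l+1)/2^m]` and left end point in `[p_l - 1/2^m, p_l)`. -/
def IsBoxIndex (m : ℕ) {k : ℕ} (s p : Fin k → ℕ) : Prop :=
  (∀ l, s l ∈ Set.Icc 1 (2 ^ m - 1) ∧ p l ∈ Set.Icc 1 (2 ^ m - 1)) ∧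
  ∃ I : Fin k → Set ℝ, IsBoxSides I ∧ 1 / 2 ^ m < volume.real (Set.univ.pi I) ∧
    ∀ l, (s l : ℝ) / 2 ^ m < volume.real (I l) ∧ volume.real (I l) ≤ ((s l : ℝ) + 1) / 2 ^ m ∧
      sInf (I l) ∈ Set.Ico ((p l : ℝ) / 2 ^ m - 1 / 2 ^ m) ((p l : ℝ) / 2 ^ m)

/-- The common part `∏ [p_l, p_l + (s_l - 1)/2^m]` of the boxes belonging to `(s, p)`. -/
def coreBox (m : ℕ) {k : ℕ} (s p : Fin k → ℕ) : Set (Fin k → ℝ) :=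
  Set.univ.pi fun l =>
    Set.Icc ((p l : ℝ) / 2 ^ m) ((p l : ℝ) / 2 ^ m + ((s l : ℝ) - 1) / 2 ^ m)

/-- A vector over `{0,…,2^m-2}` as a point of the grid `{1/2^m,…,(2^m-1)/2^m}^k`: increase all
coordinates by one, then divide them by `2^m`. -/
def gridPoint (m : ℕ) {k : ℕ} (x : Fin k → Fin (2 ^ m - 1)) : Fin k → ℝ :=
  fun l => (((x l : ℕ) : ℝ) + 1) / 2 ^ m

/-- The system of restriction sets `2^m (B ∩ grid) - 1`, `B` ranging over the core boxes in the `k`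
active coordinates. -/
def boxRestrictions (m k : ℕ) : Set (Set (Fin k → Fin (2 ^ m - 1))) :=
  {C | ∃ s p : Fin k → ℕ, IsBoxIndex m s p ∧ C = {x | gridPoint m x ∈ coreBox m s p}}

/-! ## The construction -/

/-- The dimension in which the construction is carried out; superfluous coordinates are deleted at
the end. -/
def workDim (ε : ℝ) (d : ℕ) : ℕ := max d ⌊2 / ε⌋₊

theorem le_workDim (ε : ℝ) (d : ℕ) : d ≤ workDim ε d := le_max_left _ _

/-- The bound `A_m` on the number of active coordinates in dimension `D`. -/
def activeBound (m D : ℕ) : ℕ := min (m * 2 ^ m) D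

/-- `P` arises by composing a `(D, k, k²)`-splitter `A` with at most `C k⁴ log D` elements and a
solution `T` of the box restrictions in dimension `k²`, where `D = workDim ε d` and
`k = activeBound m D`. The solution is found by exhaustive search through a `k`-wise independent
space and its size is at most `⌈b^k / c · log (n^k M)⌉`, with `b = 2^m - 1`, `n = k²`,
`M = 2^(2mk)` and `c` the minimal size of a restriction set. -/
def IsComposedPointSet (C ε : ℝ) (d m : ℕ) (P : Finset (Fin d → ℝ)) : Prop :=
  let D := workDim ε d
  let k := activeBound m D
  ∃ (A : Finset (Fin D → Fin (k ^ 2))) (Ω : Finset (Fin (k ^ 2) → Fin (2 ^ m - 1)))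
    (T : List (Fin (k ^ 2) → Fin (2 ^ m - 1))),
    IsSplitter k A ∧
    (A.card : ℝ) ≤ C * (k : ℝ) ^ 4 * Real.log D ∧
    IsKWiseIndependent k Ω ∧
    FoundBySearch (boxRestrictions m k) Ω T ∧
    SolvesRestrictions (boxRestrictions m k) {τ | τ ∈ T} ∧
    T.length ≤ ⌈((2 ^ m - 1 : ℕ) : ℝ) ^ k / (minCard (boxRestrictions m k) : ℝ) *
      Real.log (((k ^ 2 : ℕ) : ℝ) ^ k * 2 ^ (2 * m * k))⌉₊ ∧
    (P : Set (Fin d → ℝ)) = {y | ∃ τ ∈ T, ∃ a ∈ A,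
      y = fun j => gridPoint m (fun i => τ (a i)) (Fin.castLE (le_workDim ε d) j)}

/-! ## The machine model

A random access machine, programmed in a structured language, with natural number and real number
variables and arrays. Evaluating an expression or executing a command costs one step per operation.
Natural numbers can be added, subtracted (truncated at zero) and compared; reals can be added,
subtracted, halved and compared, and `1` is the only real constant. There is no multiplication, so
in `t` steps only numbers with `O(t)` more bits than the input can be formed. -/

/-- A memory state. -/
structure MachineState where
  natVar : ℕ → ℕ
  natArr : ℕ → ℕ → ℕ
  realVar : ℕ → ℝ
  realArr : ℕ → ℕ → ℝ

/-- Natural number expressions; `get a i` reads cell `i` of the array number `a`. -/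
inductive NatExp
  | const (c : ℕ)
  | var (x : ℕ)
  | get (a : ℕ) (i : NatExp)
  | add (e f : NatExp)
  | sub (e f : NatExp)

namespace NatExp

def eval (σ : MachineState) : NatExp → ℕ
  | const c => c
  | var x => σ.natVar x
  | get a i => σ.natArr a (i.eval σ)
  | add e f => e.eval σ + f.eval σ
  | sub e f => e.eval σ - f.eval σ

def cost : NatExp → ℕ
  | const _ => 1
  | var _ => 1
  | get _ i => i.cost + 1
  | add e f => e.cost + f.cost + 1
  | sub e f => e.cost + f.cost + 1

end NatExp

/-- Real number expressions. -/
inductive RealExp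
  | one
  | var (x : ℕ)
  | get (a : ℕ) (i : NatExp)
  | add (e f : RealExp)
  | sub (e f : RealExp)
  | half (e : RealExp)

namespace RealExp

def eval (σ : MachineState) : RealExp → ℝ
  | one => 1
  | var x => σ.realVar x
  | get a i => σ.realArr a (i.eval σ)
  | add e f => e.eval σ + f.eval σ
  | sub e f => e.eval σ - f.eval σ
  | half e => e.eval σ / 2

def cost : RealExp → ℕ
  | one => 1
  | var _ => 1
  | get _ i => i.cost + 1
  | add e f => e.cost + f.cost + 1
  | sub e f => e.cost + f.cost + 1
  | half e => e.cost + 1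

end RealExp

/-- Tests: strict comparison of two natural numbers or of two reals. -/
inductive MachineTest
  | natLt (e f : NatExp)
  | realLt (e f : RealExp)

namespace MachineTest

def Holds (σ : MachineState) : MachineTest → Prop
  | natLt e f => e.eval σ < f.eval σ
  | realLt e f => e.eval σ < f.eval σ

def cost : MachineTest → ℕ
  | natLt e f => e.cost + f.cost + 1
  | realLt e f => e.cost + f.cost + 1

end MachineTest

/-- Programs; `putNat a i e` and `putReal a i e` write the value of `e` to cell `i` of the array
number `a`. -/
inductive MachineProgram
  | skip
  | setNat (x : ℕ) (e : NatExp)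
  | putNat (a : ℕ) (i e : NatExp)
  | setReal (x : ℕ) (e : RealExp)
  | putReal (a : ℕ) (i : NatExp) (e : RealExp)
  | seq (p q : MachineProgram)
  | ite (b : MachineTest) (p q : MachineProgram)
  | loop (b : MachineTest) (p : MachineProgram)

namespace MachineProgram

/-- `Runs p σ t σ'`: started in the state `σ`, the program `p` halts after `t` steps in the state
`σ'`. The program `loop b p` repeats `p` as long as `b` holds. -/
inductive Runs : MachineProgram → MachineState → ℕ → MachineState → Prop
  | skip (σ) : Runs skip σ 1 σ
  | setNat (x e) (σ : MachineState) :
      Runs (setNat x e) σ (e.cost + 1)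
        { σ with natVar := Function.update σ.natVar x (e.eval σ) }
  | putNat (a i e) (σ : MachineState) :
      Runs (putNat a i e) σ (i.cost + e.cost + 1)
        { σ with natArr :=
            Function.update σ.natArr a (Function.update (σ.natArr a) (i.eval σ) (e.eval σ)) }
  | setReal (x e) (σ : MachineState) :
      Runs (setReal x e) σ (e.cost + 1)
        { σ with realVar := Function.update σ.realVar x (e.eval σ) }
  | putReal (a i e) (σ : MachineState) :
      Runs (putReal a i e) σ (i.cost + e.cost + 1)
        { σ with realArr :=
            Function.update σ.realArr a (Function.update (σ.realArr a) (i.eval σ) (e.eval σ)) }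
  | seq {p q σ σ₁ σ₂ t₁ t₂} :
      Runs p σ t₁ σ₁ → Runs q σ₁ t₂ σ₂ → Runs (seq p q) σ (t₁ + t₂) σ₂
  | iteTrue {b p q σ σ₁ t} :
      b.Holds σ → Runs p σ t σ₁ → Runs (ite b p q) σ (b.cost + t) σ₁
  | iteFalse {b p q σ σ₁ t} :
      ¬ b.Holds σ → Runs q σ t σ₁ → Runs (ite b p q) σ (b.cost + t) σ₁
  | loopTrue {b p σ σ₁ σ₂ t₁ t₂} :
      b.Holds σ → Runs p σ t₁ σ₁ → Runs (loop b p) σ₁ t₂ σ₂ →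
      Runs (loop b p) σ (b.cost + t₁ + t₂) σ₂
  | loopFalse {b p σ} : ¬ b.Holds σ → Runs (loop b p) σ b.cost σ

end MachineProgram

namespace MachineState

/-- The input `(ε, d)`: `d` is in the natural number variable `0` and `ε` in the real variable `0`;
all other memory is zero. -/
def input (ε : ℝ) (d : ℕ) : MachineState where
  natVar := Function.update (fun _ => 0) 0 d
  natArr := fun _ _ => 0
  realVar := Function.update (fun _ => 0) 0 ε
  realArr := fun _ _ => 0

/-- The state holds the point set `P` as its output: the natural number variable `0` contains the
number of rows, and the rows, written one after the other into the real array `0`, list `P`. -/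
def Outputs (σ : MachineState) {d : ℕ} (P : Finset (Fin d → ℝ)) : Prop :=
  (P : Set (Fin d → ℝ)) =
    Set.range fun (i : Fin (σ.natVar 0)) (j : Fin d) => σ.realArr 0 ((i : ℕ) * d + (j : ℕ))

end MachineState

end

/-!
The points come from two greedy constructions, and both fit on the machine.

*Why the dispersion is small.* A box in `[0,1]^D` of volume larger than `2 ^ (-m)` has at most
`k = min (m 2 ^ m) D` sides of length at most `1 - 2 ^ (-m)`, the active ones (`one_sub_pow_le`).
Some map `a` of the splitter is injective on the active coordinates, and some vector `τ` of the
solution of the box restrictions lies in the discretized box there. In an inactive coordinate any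
grid value lies in the box, so the point composed of `τ` and `a` does (`exists_gridPoint_mem`).

*The splitter.* A table with `D` columns is coloured with `q = k ^ 2` colours, cell by cell, each
cell receiving the colour that adds least to the total weight of the pairs of columns, where a pair
weighs `2` to the number of rows in which it got equal colours. One row multiplies
the total weight by at most `1 + 1 / q`
(`mul_totalWeight_succ_le`), so after `4 q log₂ D` rows no pair has collided often. If no row
were injective on a `k`-set, then some of its at most `q / 2` pairs would have collided in a
proportion `2 / q` of the rows, which is too often (`exists_injOn_greedyColor`). This costs
polynomial time in `D`, by updating the weights of all pairs of columns.

*The restriction problem.* The space of all vectors is `k`-wise independent. By averaging, the best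
vector satisfies a proportion `c / b ^ k` of the outstanding restrictions, hence their number decays
exponentially and the search is over within the required number of steps
(`length_le_of_foundBySearch`). An elementary inequality in each coordinate bounds `b ^ k / c`
by `4 ^ m` (`pow_le_ncard_of_mem_boxRestrictions`).

*The program.* The outcome of the search depends on `m` and `k` only, and `k ≤ m 2 ^ m`: for a fixed
`ε` there are finitely many searches, and their cost goes into the constant. So it suffices that the
search, on numerical codes of vectors and restrictions, is a primitive recursive function
(`primrec_search`), because every primitive recursive function is computed by a program whose time
is a function of the arguments (`computes_of_primrec'`). Only the splitter and the output have to be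
programmed with care for the dependence on `d` (`splitterCell`, `writeOutput`). All programs are
verified by Hoare-style rules for `RunsIn`, which bounds the running time and lets the values of the
variables that are not assigned be carried along (`Frame`). The numerical constants in the time
bounds are generous.
-/

open MeasureTheory

noncomputable section

/-! ### A program logic for the machine -/

namespace MachineState

/-- The state after writing `v` into the natural number variable `x`. -/
def setN (σ : MachineState) (x v : ℕ) : MachineState :=
  { σ with natVar := Function.update σ.natVar x v }

/-- The state after writing `v` into cell `i` of the natural number array `a`. -/
def putN (σ : MachineState) (a i v : ℕ) : MachineState :=
  { σ with natArr := Function.update σ.natArr a (Function.update (σ.natArr a) i v) }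

/-- The state after writing `v` into the real variable `x`. -/
def setR (σ : MachineState) (x : ℕ) (v : ℝ) : MachineState :=
  { σ with realVar := Function.update σ.realVar x v }

/-- The state after writing `v` into cell `i` of the real array `a`. -/
def putR (σ : MachineState) (a i : ℕ) (v : ℝ) : MachineState :=
  { σ with realArr := Function.update σ.realArr a (Function.update (σ.realArr a) i v) }

section simps
variable (σ : MachineState) (x a i v : ℕ) (r : ℝ)

@[simp] theorem setN_natVar : (σ.setN x v).natVar = Function.update σ.natVar x v := rfl
@[simp] theorem setN_natArr : (σ.setN x v).natArr = σ.natArr := rfl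
@[simp] theorem setN_realVar : (σ.setN x v).realVar = σ.realVar := rfl
@[simp] theorem setN_realArr : (σ.setN x v).realArr = σ.realArr := rfl
@[simp] theorem putN_natVar : (σ.putN a i v).natVar = σ.natVar := rfl
@[simp] theorem putN_natArr : (σ.putN a i v).natArr =
    Function.update σ.natArr a (Function.update (σ.natArr a) i v) := rfl
@[simp] theorem putN_realVar : (σ.putN a i v).realVar = σ.realVar := rfl
@[simp] theorem putN_realArr : (σ.putN a i v).realArr = σ.realArr := rfl
@[simp] theorem setR_natVar : (σ.setR x r).natVar = σ.natVar := rfl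
@[simp] theorem setR_natArr : (σ.setR x r).natArr = σ.natArr := rfl
@[simp] theorem setR_realVar : (σ.setR x r).realVar = Function.update σ.realVar x r := rfl
@[simp] theorem setR_realArr : (σ.setR x r).realArr = σ.realArr := rfl
@[simp] theorem putR_natVar : (σ.putR a i r).natVar = σ.natVar := rfl
@[simp] theorem putR_natArr : (σ.putR a i r).natArr = σ.natArr := rfl
@[simp] theorem putR_realVar : (σ.putR a i r).realVar = σ.realVar := rfl
@[simp] theorem putR_realArr : (σ.putR a i r).realArr =
    Function.update σ.realArr a (Function.update (σ.realArr a) i r) := rfl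

end simps

end MachineState

namespace MachineProgram

/-- `p` contains an assignment to the natural number variable `y`. -/
def WritesNatVar : MachineProgram → ℕ → Prop
  | setNat x _, y => y = x
  | seq p q, y => p.WritesNatVar y ∨ q.WritesNatVar y
  | ite _ p q, y => p.WritesNatVar y ∨ q.WritesNatVar y
  | loop _ p, y => p.WritesNatVar y
  | _, _ => False

/-- `p` contains an assignment to a cell of the natural number array `y`. -/
def WritesNatArr : MachineProgram → ℕ → Prop
  | putNat a _ _, y => y = a
  | seq p q, y => p.WritesNatArr y ∨ q.WritesNatArr y
  | ite _ p q, y => p.WritesNatArr y ∨ q.WritesNatArr y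
  | loop _ p, y => p.WritesNatArr y
  | _, _ => False

/-- `p` contains an assignment to the real variable `y`. -/
def WritesRealVar : MachineProgram → ℕ → Prop
  | setReal x _, y => y = x
  | seq p q, y => p.WritesRealVar y ∨ q.WritesRealVar y
  | ite _ p q, y => p.WritesRealVar y ∨ q.WritesRealVar y
  | loop _ p, y => p.WritesRealVar y
  | _, _ => False

/-- `p` contains an assignment to a cell of the real array `y`. -/
def WritesRealArr : MachineProgram → ℕ → Prop
  | putReal a _ _, y => y = a
  | seq p q, y => p.WritesRealArr y ∨ q.WritesRealArr y
  | ite _ p q, y => p.WritesRealArr y ∨ q.WritesRealArr y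
  | loop _ p, y => p.WritesRealArr y
  | _, _ => False

/-- The states `σ` and `σ'` agree on all the memory that `p` never writes. -/
structure Frame (p : MachineProgram) (σ σ' : MachineState) : Prop where
  natVar : ∀ x, ¬ p.WritesNatVar x → σ'.natVar x = σ.natVar x
  natArr : ∀ x, ¬ p.WritesNatArr x → σ'.natArr x = σ.natArr x
  realVar : ∀ x, ¬ p.WritesRealVar x → σ'.realVar x = σ.realVar x
  realArr : ∀ x, ¬ p.WritesRealArr x → σ'.realArr x = σ.realArr x

theorem Frame.refl (p : MachineProgram) (σ : MachineState) : Frame p σ σ :=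
  ⟨fun _ _ => rfl, fun _ _ => rfl, fun _ _ => rfl, fun _ _ => rfl⟩

theorem Frame.trans {p : MachineProgram} {σ σ₁ σ₂ : MachineState} (h : Frame p σ σ₁)
    (h' : Frame p σ₁ σ₂) : Frame p σ σ₂ :=
  ⟨fun x hx => (h'.natVar x hx).trans (h.natVar x hx),
    fun x hx => (h'.natArr x hx).trans (h.natArr x hx),
    fun x hx => (h'.realVar x hx).trans (h.realVar x hx),
    fun x hx => (h'.realArr x hx).trans (h.realArr x hx)⟩

theorem Frame.weaken {p q : MachineProgram} {σ σ' : MachineState} (h : Frame p σ σ')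
    (h₁ : ∀ x, p.WritesNatVar x → q.WritesNatVar x)
    (h₂ : ∀ x, p.WritesNatArr x → q.WritesNatArr x)
    (h₃ : ∀ x, p.WritesRealVar x → q.WritesRealVar x)
    (h₄ : ∀ x, p.WritesRealArr x → q.WritesRealArr x) : Frame q σ σ' :=
  ⟨fun x hx => h.natVar x (mt (h₁ x) hx), fun x hx => h.natArr x (mt (h₂ x) hx),
    fun x hx => h.realVar x (mt (h₃ x) hx), fun x hx => h.realArr x (mt (h₄ x) hx)⟩

theorem Runs.frame {p : MachineProgram} {σ σ' : MachineState} {t : ℕ} (h : Runs p σ t σ') :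
    Frame p σ σ' := by
  induction h with
  | skip σ => exact Frame.refl _ _
  | setNat x e σ =>
    exact ⟨fun y hy => Function.update_of_ne hy _ _, fun _ _ => rfl, fun _ _ => rfl, fun _ _ => rfl⟩
  | putNat a i e σ =>
    exact ⟨fun _ _ => rfl, fun y hy => Function.update_of_ne hy _ _, fun _ _ => rfl, fun _ _ => rfl⟩
  | setReal x e σ =>
    exact ⟨fun _ _ => rfl, fun _ _ => rfl, fun y hy => Function.update_of_ne hy _ _, fun _ _ => rfl⟩
  | putReal a i e σ =>
    exact ⟨fun _ _ => rfl, fun _ _ => rfl, fun _ _ => rfl, fun y hy => Function.update_of_ne hy _ _⟩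
  | seq _ _ h₁ h₂ =>
    exact (h₁.weaken (fun _ => Or.inl) (fun _ => Or.inl) (fun _ => Or.inl) (fun _ => Or.inl)).trans
      (h₂.weaken (fun _ => Or.inr) (fun _ => Or.inr) (fun _ => Or.inr) (fun _ => Or.inr))
  | iteTrue _ _ h =>
    exact h.weaken (fun _ => Or.inl) (fun _ => Or.inl) (fun _ => Or.inl) (fun _ => Or.inl)
  | iteFalse _ _ h =>
    exact h.weaken (fun _ => Or.inr) (fun _ => Or.inr) (fun _ => Or.inr) (fun _ => Or.inr)
  | loopTrue _ _ _ h₁ h₂ =>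
    exact Frame.trans
      (h₁.weaken (fun _ h => h) (fun _ h => h) (fun _ h => h) (fun _ h => h)) h₂
  | loopFalse _ => exact Frame.refl _ _

/-- Started in `σ`, the program `p` halts after at most `B` steps, in a state satisfying `Q`. -/
def RunsIn (p : MachineProgram) (σ : MachineState) (B : ℕ) (Q : MachineState → Prop) : Prop :=
  ∃ t σ', t ≤ B ∧ Runs p σ t σ' ∧ Q σ'

section rules
variable {p q : MachineProgram} {σ : MachineState} {B B₁ B₂ : ℕ} {Q Q' : MachineState → Prop}

theorem RunsIn.mono (h : RunsIn p σ B₁ Q) (hB : B₁ ≤ B₂) : RunsIn p σ B₂ Q := by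
  obtain ⟨t, σ', ht, hr, hq⟩ := h
  exact ⟨t, σ', ht.trans hB, hr, hq⟩

theorem RunsIn.imp (h : RunsIn p σ B Q) (hQ : ∀ σ', Frame p σ σ' → Q σ' → Q' σ') :
    RunsIn p σ B Q' := by
  obtain ⟨t, σ', ht, hr, hq⟩ := h
  exact ⟨t, σ', ht, hr, hQ σ' hr.frame hq⟩

theorem RunsIn.skip (h : Q σ) : RunsIn skip σ 1 Q := ⟨_, _, le_rfl, .skip σ, h⟩

theorem RunsIn.setNat {x : ℕ} {e : NatExp} (h : Q (σ.setN x (e.eval σ))) :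
    RunsIn (setNat x e) σ (e.cost + 1) Q := ⟨_, _, le_rfl, .setNat x e σ, h⟩

theorem RunsIn.putNat {a : ℕ} {i e : NatExp} (h : Q (σ.putN a (i.eval σ) (e.eval σ))) :
    RunsIn (putNat a i e) σ (i.cost + e.cost + 1) Q := ⟨_, _, le_rfl, .putNat a i e σ, h⟩

theorem RunsIn.setReal {x : ℕ} {e : RealExp} (h : Q (σ.setR x (e.eval σ))) :
    RunsIn (setReal x e) σ (e.cost + 1) Q := ⟨_, _, le_rfl, .setReal x e σ, h⟩

theorem RunsIn.putReal {a : ℕ} {i : NatExp} {e : RealExp}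
    (h : Q (σ.putR a (i.eval σ) (e.eval σ))) :
    RunsIn (putReal a i e) σ (i.cost + e.cost + 1) Q := ⟨_, _, le_rfl, .putReal a i e σ, h⟩

theorem RunsIn.seq (h : RunsIn p σ B₁ fun σ' => Frame p σ σ' → RunsIn q σ' B₂ Q) :
    RunsIn (seq p q) σ (B₁ + B₂) Q := by
  obtain ⟨t, σ', ht, hr, hq⟩ := h
  obtain ⟨t', σ'', ht', hr', hq'⟩ := hq hr.frame
  exact ⟨_, _, Nat.add_le_add ht ht', .seq hr hr', hq'⟩

theorem RunsIn.ite {b : MachineTest} (h₁ : b.Holds σ → RunsIn p σ B Q)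
    (h₂ : ¬ b.Holds σ → RunsIn q σ B Q) : RunsIn (ite b p q) σ (b.cost + B) Q := by
  by_cases hb : b.Holds σ
  · obtain ⟨t, σ', ht, hr, hq⟩ := h₁ hb
    exact ⟨_, _, Nat.add_le_add_left ht _, .iteTrue hb hr, hq⟩
  · obtain ⟨t, σ', ht, hr, hq⟩ := h₂ hb
    exact ⟨_, _, Nat.add_le_add_left ht _, .iteFalse hb hr, hq⟩

/-- The rule for loops: `Inv j` holds after `j` rounds, and the test holds exactly in the first
`N` rounds. -/
theorem RunsIn.loop {b : MachineTest} (Inv : ℕ → MachineState → Prop) (N : ℕ) (h0 : Inv 0 σ)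
    (hb : ∀ j σ', Frame p σ σ' → Inv j σ' → (b.Holds σ' ↔ j < N))
    (body : ∀ j < N, ∀ σ', Frame p σ σ' → Inv j σ' → RunsIn p σ' B (Inv (j + 1))) :
    RunsIn (loop b p) σ (N * (B + b.cost) + b.cost) (Inv N) := by
  suffices H : ∀ i j σ', i + j = N → Frame p σ σ' → Inv j σ' →
      RunsIn (MachineProgram.loop b p) σ' (i * (B + b.cost) + b.cost) (Inv N) from
    H N 0 σ (by simp) (Frame.refl _ _) h0
  intro i
  induction i with
  | zero =>
    intro j σ' hij hf hI
    obtain rfl : j = N := by omega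
    exact ⟨b.cost, σ', by simp, .loopFalse (by rw [hb j σ' hf hI]; omega), hI⟩
  | succ i ih =>
    intro j σ' hij hf hI
    obtain ⟨t, σ₁, ht, hr, hI₁⟩ := body j (by omega) σ' hf hI
    obtain ⟨t', σ₂, ht', hr', hI₂⟩ := ih (j + 1) σ₁ (by omega) (hf.trans hr.frame) hI₁
    refine ⟨_, _, ?_, .loopTrue ((hb j σ' hf hI).2 (by omega)) hr hr', hI₂⟩
    rw [Nat.succ_mul]
    omega

end rules

/-- `for i = 0, …, n - 1 do p`, where `i` and `n` are variables not written by `p`. -/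
def forLoop (i n : ℕ) (p : MachineProgram) : MachineProgram :=
  seq (setNat i (.const 0))
    (loop (.natLt (.var i) (.var n)) (seq p (setNat i (.add (.var i) (.const 1)))))

/-- The rule for counting loops: `Inv j` holds when the body is entered for the `j`-th time. -/
theorem RunsIn.forLoop {i n B : ℕ} {p : MachineProgram} {σ : MachineState}
    (Inv : ℕ → MachineState → Prop) {N : ℕ} (hN : σ.natVar n = N)
    (hi : ¬ p.WritesNatVar i) (hn : ¬ p.WritesNatVar n) (hin : n ≠ i) (h0 : Inv 0 (σ.setN i 0))
    (body : ∀ j < N, ∀ σ', Frame (forLoop i n p) σ σ' → σ'.natVar i = j → Inv j σ' →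
      RunsIn p σ' B fun σ'' => Inv (j + 1) (σ''.setN i (j + 1))) :
    RunsIn (forLoop i n p) σ (N * (B + 7) + 5) (Inv N) := by
  subst hN
  have hcost : σ.natVar n * (B + 7) + 5 =
      ((NatExp.const 0).cost + 1) + (σ.natVar n * ((B + 4) + 3) + 3) := by
    simp [NatExp.cost]; ring
  rw [hcost]
  refine RunsIn.seq (RunsIn.setNat fun _ => ?_)
  simp only [NatExp.eval]
  refine RunsIn.imp (RunsIn.loop (σ := σ.setN i 0) (B := B + 4)
    (b := .natLt (.var i) (.var n)) (fun j σ' => σ'.natVar i = j ∧ Inv j σ')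
    (σ.natVar n) ?_ ?_ ?_) ?_
  · simpa using h0
  · rintro j σ' hf ⟨hj, -⟩
    have : σ'.natVar n = σ.natVar n := by
      rw [hf.natVar n (by simp [WritesNatVar, hn, hin])]
      simp [hin]
    simp [MachineTest.Holds, NatExp.eval, hj, this]
  · rintro j hj σ' hf ⟨hij, hI⟩
    have hF : Frame (MachineProgram.forLoop i n p) σ σ' := by
      refine ⟨fun x hx => ?_, fun x hx => ?_, fun x hx => ?_, fun x hx => ?_⟩ <;>
        simp only [MachineProgram.forLoop, WritesNatVar, WritesNatArr, WritesRealVar,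
          WritesRealArr, or_false, false_or, not_or] at hx
      · rw [hf.natVar x (by simp [WritesNatVar, hx])]
        simp [hx.1]
      · rw [hf.natArr x (by simp [WritesNatArr, hx])]; rfl
      · rw [hf.realVar x (by simp [WritesRealVar, hx])]; rfl
      · rw [hf.realArr x (by simp [WritesRealArr, hx])]; rfl
    refine RunsIn.seq ((body j hj σ' hF hij hI).imp fun σ'' hf' hI' _ => ?_)
    have hi' : σ''.natVar i = j := by rw [hf'.natVar i hi, hij]
    refine RunsIn.setNat ?_
    simp only [NatExp.eval, hi']
    exact ⟨by simp, hI'⟩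
  · exact fun _ _ h => h.2

/-! ### Primitive recursive functions are computed by programs -/

/-- `p` writes nothing but natural number variables with number at least `o`. -/
structure WritesFrom (p : MachineProgram) (o : ℕ) : Prop where
  natVar : ∀ x, p.WritesNatVar x → o ≤ x
  natArr : ∀ x, ¬ p.WritesNatArr x
  realVar : ∀ x, ¬ p.WritesRealVar x
  realArr : ∀ x, ¬ p.WritesRealArr x

theorem WritesFrom.mono {p : MachineProgram} {o o' : ℕ} (h : WritesFrom p o') (ho : o ≤ o') :
    WritesFrom p o := ⟨fun x hx => ho.trans (h.natVar x hx), h.natArr, h.realVar, h.realArr⟩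

theorem WritesFrom.seq {p q : MachineProgram} {o : ℕ} (hp : WritesFrom p o)
    (hq : WritesFrom q o) : WritesFrom (seq p q) o :=
  ⟨fun x hx => hx.elim (hp.natVar x) (hq.natVar x),
    fun x hx => hx.elim (hp.natArr x) (hq.natArr x),
    fun x hx => hx.elim (hp.realVar x) (hq.realVar x),
    fun x hx => hx.elim (hp.realArr x) (hq.realArr x)⟩

theorem WritesFrom.setNat {x o : ℕ} {e : NatExp} (h : o ≤ x) :
    WritesFrom (MachineProgram.setNat x e) o :=
  ⟨fun y hy => by simp only [WritesNatVar] at hy; omega, fun _ h => h, fun _ h => h, fun _ h => h⟩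

theorem WritesFrom.forLoop {p : MachineProgram} {i n o : ℕ} (h : WritesFrom p o) (hi : o ≤ i) :
    WritesFrom (forLoop i n p) o := by
  have h' := (WritesFrom.setNat (e := .const 0) hi).seq
    (h.seq (WritesFrom.setNat (e := .add (.var i) (.const 1)) hi))
  exact ⟨h'.natVar, h'.natArr, h'.realVar, h'.realArr⟩

theorem WritesFrom.not_natVar {p : MachineProgram} {o x : ℕ} (h : WritesFrom p o) (hx : x < o) :
    ¬ p.WritesNatVar x := fun hw => absurd (h.natVar x hw) (by omega)

/-- Programs for `f`: for all choices of variables `a i` for the arguments and of a variable `o`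
for the result, the arguments having smaller numbers, there is a program which computes `f`, uses
no variables below `o`, and whose running time is bounded in terms of the arguments. -/
def Computes {n : ℕ} (f : List.Vector ℕ n → ℕ) : Prop :=
  ∃ B : List.Vector ℕ n → ℕ, ∀ (a : Fin n → ℕ) (o : ℕ), (∀ i, a i < o) →
    ∃ p : MachineProgram, WritesFrom p o ∧
      ∀ σ : MachineState, RunsIn p σ (B (.ofFn fun i => σ.natVar (a i)))
        fun σ' => σ'.natVar o = f (.ofFn fun i => σ.natVar (a i))

/-- Programs for several functions of the same arguments, run one after the other: the result
variables increase, so no program disturbs the earlier results. -/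
theorem exists_program_tuple {m : ℕ} (n : ℕ) (g : Fin n → List.Vector ℕ m → ℕ)
    (B : Fin n → List.Vector ℕ m → ℕ)
    (hg : ∀ j, ∀ (a : Fin m → ℕ) (o : ℕ), (∀ i, a i < o) →
      ∃ p : MachineProgram, WritesFrom p o ∧
        ∀ σ : MachineState, RunsIn p σ (B j (.ofFn fun i => σ.natVar (a i)))
          fun σ' => σ'.natVar o = g j (.ofFn fun i => σ.natVar (a i)))
    (a : Fin m → ℕ) (o : ℕ) (ha : ∀ i, a i < o) :
    ∃ p : MachineProgram, WritesFrom p o ∧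
      ∀ σ : MachineState, RunsIn p σ (1 + ∑ j, B j (.ofFn fun i => σ.natVar (a i)))
        fun σ' => ∀ j : Fin n, σ'.natVar (o + j) = g j (.ofFn fun i => σ.natVar (a i)) := by
  induction n with
  | zero =>
    exact ⟨.skip, ⟨fun _ h => h.elim, fun _ h => h, fun _ h => h, fun _ h => h⟩,
      fun σ => (RunsIn.skip (fun j => j.elim0)).mono (by simp)⟩
  | succ n ih =>
    obtain ⟨p, hp, hr⟩ := ih (fun j => g j.castSucc) (fun j => B j.castSucc)
      (fun j => hg j.castSucc)
    obtain ⟨p', hp', hr'⟩ := hg (Fin.last n) a (o + n) (fun i => (ha i).trans_le (by omega))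
    refine ⟨.seq p p', hp.seq (hp'.mono (by omega)), fun σ => ?_⟩
    rw [Fin.sum_univ_castSucc, ← add_assoc]
    refine RunsIn.seq ((hr σ).imp fun σ₁ hf h₁ _ => ?_)
    have hv : ∀ i, σ₁.natVar (a i) = σ.natVar (a i) :=
      fun i => hf.natVar _ (hp.not_natVar (ha i))
    have := hr' σ₁
    simp only [hv] at this
    refine this.imp fun σ₂ hf₂ h₂ j => ?_
    refine Fin.lastCases ?_ (fun j => ?_) j
    · exact h₂
    · rw [← h₁ j]
      exact hf₂.natVar _ (hp'.not_natVar (by simp))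

/-- Composition is sequencing and primitive recursion is a counting loop. The time of a loop depends
on its arguments alone, as the intermediate values of the recursion do. -/
theorem computes_of_primrec' {n : ℕ} {f : List.Vector ℕ n → ℕ} (hf : Nat.Primrec' f) :
    Computes f := by
  induction hf with
  | zero =>
    exact ⟨fun _ => 2, fun a o _ => ⟨.setNat o (.const 0), .setNat le_rfl, fun σ =>
      RunsIn.setNat (by simp [NatExp.eval])⟩⟩
  | succ =>
    exact ⟨fun _ => 4, fun a o _ => ⟨.setNat o (.add (.var (a 0)) (.const 1)), .setNat le_rfl,
      fun σ => RunsIn.setNat (by simp [NatExp.eval])⟩⟩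
  | get i =>
    exact ⟨fun _ => 2, fun a o _ => ⟨.setNat o (.var (a i)), .setNat le_rfl,
      fun σ => RunsIn.setNat (by simp [NatExp.eval])⟩⟩
  | @comp m n f g _ _ hf hg =>
    choose Bg hg using hg
    obtain ⟨Bf, hf⟩ := hf
    refine ⟨fun v => (1 + ∑ j, Bg j v) + (Bf (.ofFn fun j => g j v) + 2), fun a o ha => ?_⟩
    obtain ⟨p, hp, hr⟩ := exists_program_tuple n g Bg hg a o ha
    obtain ⟨p', hp', hr'⟩ := hf (fun j => o + j) (o + n) (fun j => by omega)
    refine ⟨.seq p (.seq p' (.setNat o (.var (o + n)))),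
      hp.seq ((hp'.mono (by omega)).seq (.setNat le_rfl)), fun σ => ?_⟩
    refine RunsIn.seq ((hr σ).imp fun σ₁ _ h₁ _ => ?_)
    have := hr' σ₁
    simp only [h₁] at this
    refine RunsIn.seq (this.imp fun σ₂ _ h₂ _ => RunsIn.setNat ?_)
    simpa [NatExp.eval] using h₂
  | @prec n f g _ _ hf hg =>
    obtain ⟨Bf, hf⟩ := hf
    obtain ⟨Bg, hg⟩ := hg
    -- `step v y` is the value of the recursion after `y` rounds
    let step : List.Vector ℕ (n + 1) → ℕ → ℕ := fun v y =>
      Nat.rec (f v.tail) (fun y IH => g (y ::ᵥ IH ::ᵥ v.tail)) y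
    refine ⟨fun v => Bf v.tail + (v.head * (((Finset.range v.head).sup fun y =>
      Bg (y ::ᵥ step v y ::ᵥ v.tail)) + 2 + 7) + 5), fun a o ha => ?_⟩
    obtain ⟨p, hp, hr⟩ := hf (fun i => a i.succ) o (fun i => ha _)
    obtain ⟨p', hp', hr'⟩ := hg (Fin.cons (o + 1) (Fin.cons o fun i => a i.succ)) (o + 2) (by
      intro i
      refine Fin.cases (by simp) (fun i => ?_) i
      refine Fin.cases (by simp) (fun i => ?_) i
      have := ha i.succ
      simp only [Fin.cons_succ]
      omega)
    refine ⟨.seq p (MachineProgram.forLoop (o + 1) (a 0) (.seq p' (.setNat o (.var (o + 2))))),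
      hp.seq (((hp'.mono (by omega)).seq (.setNat le_rfl)).forLoop (by omega)), fun σ => ?_⟩
    have ha0 := ha 0
    set v : List.Vector ℕ (n + 1) := .ofFn fun i => σ.natVar (a i) with hv
    have hhead : v.head = σ.natVar (a 0) := by simp [hv]
    have htail : (List.Vector.ofFn fun i => σ.natVar (a i.succ)) = (v.tail : List.Vector ℕ n) := by
      simp [hv]
    have hr1 := hr σ
    rw [htail] at hr1
    refine RunsIn.seq (hr1.imp fun σ₁ hf₁ h₁ _ => ?_)
    have hσ₁ : ∀ x < o, σ₁.natVar x = σ.natVar x := fun x hx =>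
      hf₁.natVar _ (hp.not_natVar hx)
    rw [hhead, ← hσ₁ _ ha0]
    have hw : ∀ x < o, ¬ (MachineProgram.seq p' (.setNat o (.var (o + 2)))).WritesNatVar x :=
      fun x hx => ((hp'.mono (by omega)).seq (.setNat le_rfl) : WritesFrom _ o).not_natVar hx
    refine RunsIn.imp (RunsIn.forLoop (fun j τ => τ.natVar o = step v j) rfl ?_ ?_ ?_ ?_ ?_)
      fun τ _ h => by rw [h, hσ₁ _ ha0, ← hhead]
    · simp only [WritesNatVar, not_or]
      exact ⟨hp'.not_natVar (by omega), by omega⟩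
    · exact hw _ ha0
    · omega
    · simpa [step] using h₁
    · intro j hj τ hτ hτj hI
      have hτ' : ∀ x < o, τ.natVar x = σ.natVar x := fun x hx => by
        rw [hτ.natVar x, hσ₁ x hx]
        simp only [MachineProgram.forLoop, WritesNatVar]
        have := hw x hx
        simp only [WritesNatVar] at this
        rintro (h | h | h)
        · omega
        · exact this h
        · omega
      have hargs : (List.Vector.ofFn fun i : Fin (n + 2) =>
          τ.natVar ((Fin.cons (o + 1) (Fin.cons o fun i => a i.succ) : Fin (n + 2) → ℕ) i)) =
          j ::ᵥ step v j ::ᵥ v.tail := by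
        rw [← htail]
        simp [List.Vector.ofFn, hτj, hI, hτ' _ (ha _)]
      have := hr' τ
      rw [hargs] at this
      refine RunsIn.seq (B₁ := _) (B₂ := 2) (((this.mono ?_).imp fun τ₁ _ h₂ _ =>
        RunsIn.setNat ?_))
      · exact Finset.le_sup (f := fun y => Bg (y ::ᵥ step v y ::ᵥ v.tail))
          (Finset.mem_range.2 hj)
      · simp only [NatExp.eval, MachineState.setN_natVar]
        rw [Function.update_of_ne (by omega), Function.update_self, h₂]

theorem exists_program₁ {f : ℕ → ℕ} (hf : Primrec f) {a o : ℕ} (ha : a < o) :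
    ∃ (B : ℕ → ℕ) (p : MachineProgram), WritesFrom p o ∧ ∀ σ : MachineState,
      RunsIn p σ (B (σ.natVar a)) fun σ' => σ'.natVar o = f (σ.natVar a) := by
  obtain ⟨B, h⟩ := computes_of_primrec' (Nat.Primrec'.of_prim
    (f := fun v : List.Vector ℕ 1 => f (v.get 0))
    (hf.comp (Primrec.vector_get.comp Primrec.id (Primrec.const 0))))
  obtain ⟨p, hp, hr⟩ := h (fun _ => a) o (fun _ => ha)
  exact ⟨fun x => B (.ofFn fun _ => x), p, hp, fun σ => by simpa using hr σ⟩

theorem exists_program₂ {f : ℕ → ℕ → ℕ} (hf : Primrec₂ f) {a b o : ℕ} (ha : a < o) (hb : b < o) :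
    ∃ (B : ℕ → ℕ → ℕ) (p : MachineProgram), WritesFrom p o ∧ ∀ σ : MachineState,
      RunsIn p σ (B (σ.natVar a) (σ.natVar b)) fun σ' =>
        σ'.natVar o = f (σ.natVar a) (σ.natVar b) := by
  obtain ⟨B, h⟩ := computes_of_primrec' (Nat.Primrec'.of_prim
    (f := fun v : List.Vector ℕ 2 => f (v.get 0) (v.get 1))
    (hf.comp (Primrec.vector_get.comp Primrec.id (Primrec.const 0))
      (Primrec.vector_get.comp Primrec.id (Primrec.const 1))))
  obtain ⟨p, hp, hr⟩ := h ![a, b] o (by intro i; fin_cases i <;> simpa)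
  refine ⟨fun x y => B (.ofFn ![x, y]), p, hp, fun σ => ?_⟩
  have he : (fun i => σ.natVar (![a, b] i)) = ![σ.natVar a, σ.natVar b] := by
    funext i; fin_cases i <;> rfl
  have := hr σ
  rw [he] at this
  simpa using this

theorem exists_program₄ {f : ℕ → ℕ → ℕ → ℕ → ℕ}
    (hf : Primrec fun z : ℕ × ℕ × ℕ × ℕ => f z.1 z.2.1 z.2.2.1 z.2.2.2) {a b c d o : ℕ}
    (ha : a < o) (hb : b < o) (hc : c < o) (hd : d < o) :
    ∃ (B : ℕ → ℕ → ℕ → ℕ → ℕ) (p : MachineProgram), WritesFrom p o ∧ ∀ σ : MachineState,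
      RunsIn p σ (B (σ.natVar a) (σ.natVar b) (σ.natVar c) (σ.natVar d)) fun σ' =>
        σ'.natVar o = f (σ.natVar a) (σ.natVar b) (σ.natVar c) (σ.natVar d) := by
  have hget : ∀ i : Fin 4, Primrec fun v : List.Vector ℕ 4 => v.get i := fun i =>
    Primrec.vector_get.comp Primrec.id (Primrec.const i)
  obtain ⟨B, h⟩ := computes_of_primrec' (Nat.Primrec'.of_prim
    (f := fun v : List.Vector ℕ 4 => f (v.get 0) (v.get 1) (v.get 2) (v.get 3))
    (hf.comp ((hget 0).pair ((hget 1).pair ((hget 2).pair (hget 3))))))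
  obtain ⟨p, hp, hr⟩ := h ![a, b, c, d] o (by intro i; fin_cases i <;> simpa)
  refine ⟨fun x y z w => B (.ofFn ![x, y, z, w]), p, hp, fun σ => ?_⟩
  have he : (fun i => σ.natVar (![a, b, c, d] i)) =
      ![σ.natVar a, σ.natVar b, σ.natVar c, σ.natVar d] := by
    funext i; fin_cases i <;> rfl
  have := hr σ
  rw [he] at this
  simpa using this

end MachineProgram

/-! ### The box restrictions -/

/-- The arithmetic form of `IsBoxIndex`, see `isBoxIndex_iff`. -/
def AdmissibleIndex (m : ℕ) {k : ℕ} (s p : Fin k → ℕ) : Prop :=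
  (∀ l, 1 ≤ s l ∧ 1 ≤ p l ∧ s l + p l ≤ 2 ^ m) ∧ (2 ^ m) ^ k < 2 ^ m * ∏ l, (s l + 1)

theorem IsBoxSides.volume_pi {d : ℕ} (I : Fin d → Set ℝ) :
    volume.real (Set.univ.pi I) = ∏ l, volume.real (I l) := by
  simp [Measure.real, volume_pi_pi, ENNReal.toReal_prod]

theorem volume_real_le_one_sub_sInf {I : Set ℝ} (h : I ⊆ Set.Icc 0 1) :
    volume.real I ≤ 1 - sInf I := by
  have hb : BddBelow I := ⟨0, fun x hx => (h hx).1⟩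
  have hs : sInf I ≤ 1 := by
    rcases I.eq_empty_or_nonempty with rfl | ⟨x, hx⟩
    · simp
    · exact (csInf_le hb hx).trans (h hx).2
  have : I ⊆ Set.Icc (sInf I) 1 := fun x hx => ⟨csInf_le hb hx, (h hx).2⟩
  calc volume.real I ≤ volume.real (Set.Icc (sInf I) 1) := measureReal_mono this (by simp)
    _ = 1 - sInf I := by rw [Real.volume_real_Icc_of_le hs]

/-- The largest box belonging to `(s, p)` is `∏ [(p_l - 1) / 2 ^ m, (p_l + s_l) / 2 ^ m]`, so the
existence of a box of volume larger than `2 ^ (-m)` is a condition on `∏ (s_l + 1)`. -/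
theorem isBoxIndex_iff {m k : ℕ} {s p : Fin k → ℕ} :
    IsBoxIndex m s p ↔ AdmissibleIndex m s p := by
  have hM : (0 : ℝ) < 2 ^ m := by positivity
  have hprod : (∏ l, ((s l : ℝ) + 1) / 2 ^ m) = (∏ l, ((s l : ℝ) + 1)) / (2 ^ m) ^ k := by
    simp [Finset.prod_div_distrib]
  have hkey : 1 / (2 : ℝ) ^ m < ∏ l, ((s l : ℝ) + 1) / 2 ^ m ↔
      (2 ^ m) ^ k < 2 ^ m * ∏ l, (s l + 1) := by
    rw [hprod, div_lt_div_iff₀ hM (by positivity), one_mul, mul_comm]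
    exact_mod_cast Iff.rfl
  constructor
  · rintro ⟨hsp, I, hI, hvol, hl⟩
    refine ⟨fun l => ⟨(hsp l).1.1, (hsp l).2.1, ?_⟩, ?_⟩
    · have h1 := volume_real_le_one_sub_sInf (hI l).2
      have h2 := (hl l).1
      have h3 := (hl l).2.2.1
      have h4 : (s l : ℝ) / 2 ^ m < 1 - ((p l : ℝ) / 2 ^ m - 1 / 2 ^ m) := by linarith
      have h5 : (s l : ℝ) + p l < 2 ^ m + 1 := by
        have : (s l : ℝ) / 2 ^ m + (p l : ℝ) / 2 ^ m - 1 / 2 ^ m < 1 := by linarith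
        rw [← add_div, ← sub_div, div_lt_one hM] at this
        linarith
      have : s l + p l < 2 ^ m + 1 := by exact_mod_cast h5
      omega
    · rw [← hkey]
      refine hvol.trans_le ?_
      rw [IsBoxSides.volume_pi]
      exact Finset.prod_le_prod (fun l _ => measureReal_nonneg) fun l _ => (hl l).2.1
  · rintro ⟨hsp, hvol⟩
    refine ⟨fun l => ?_, fun l => Set.Icc (((p l : ℝ) - 1) / 2 ^ m) (((p l : ℝ) + s l) / 2 ^ m),
      fun l => ⟨Set.ordConnected_Icc, ?_⟩, ?_, fun l => ?_⟩
    · have := hsp l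
      simp only [Set.mem_Icc]
      omega
    · have h1 : (1 : ℝ) ≤ p l := by exact_mod_cast (hsp l).2.1
      have h2 : (s l : ℝ) + p l ≤ 2 ^ m := by exact_mod_cast (hsp l).2.2
      refine Set.Icc_subset_Icc (div_nonneg (by linarith) hM.le) ?_
      rw [div_le_one hM]
      linarith
    · rw [IsBoxSides.volume_pi]
      refine (hkey.2 hvol).trans_eq (Finset.prod_congr rfl fun l _ => ?_)
      rw [Real.volume_real_Icc_of_le (by gcongr; linarith [(s l).cast_nonneg (α := ℝ)])]
      ring
    · have hle : ((p l : ℝ) - 1) / 2 ^ m ≤ ((p l : ℝ) + s l) / 2 ^ m := by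
        gcongr; linarith [(s l).cast_nonneg (α := ℝ)]
      rw [Real.volume_real_Icc_of_le hle, csInf_Icc hle]
      refine ⟨?_, le_of_eq (by ring), le_of_eq (by ring), ?_⟩
      · rw [← sub_div]; gcongr; linarith
      · gcongr; linarith

/-- The grid vectors in the core box of `(s, p)`. -/
def coreVectors (m : ℕ) {k : ℕ} (s p : Fin k → ℕ) : Set (Fin k → Fin (2 ^ m - 1)) :=
  {x | ∀ l, p l ≤ (x l : ℕ) + 1 ∧ (x l : ℕ) + 2 ≤ p l + s l}

theorem gridPoint_mem_coreBox {m k : ℕ} {s p : Fin k → ℕ} {x : Fin k → Fin (2 ^ m - 1)} :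
    gridPoint m x ∈ coreBox m s p ↔ x ∈ coreVectors m s p := by
  have hM : (0 : ℝ) < 2 ^ m := by positivity
  simp only [coreBox, Set.mem_univ_pi, gridPoint, coreVectors, Set.mem_ofPred_eq, Set.mem_Icc]
  refine forall_congr' fun l => and_congr ?_ ?_
  · rw [div_le_div_iff_of_pos_right hM]
    exact_mod_cast Iff.rfl
  · rw [← add_div, div_le_div_iff_of_pos_right hM]
    constructor <;> intro h
    · have : ((x l : ℕ) : ℝ) + 2 ≤ p l + s l := by linarith
      exact_mod_cast this
    · have : ((x l : ℕ) : ℝ) + 2 ≤ p l + s l := by exact_mod_cast h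
      linarith

theorem mem_boxRestrictions {m k : ℕ} {C : Set (Fin k → Fin (2 ^ m - 1))} :
    C ∈ boxRestrictions m k ↔
      ∃ s p : Fin k → ℕ, AdmissibleIndex m s p ∧ C = coreVectors m s p := by
  simp only [boxRestrictions, Set.mem_ofPred_eq, isBoxIndex_iff, gridPoint_mem_coreBox]
  rfl

theorem AdmissibleIndex.ncard_coreVectors {m k : ℕ} {s p : Fin k → ℕ}
    (h : AdmissibleIndex m s p) : (coreVectors m s p).ncard = ∏ l, s l := by
  have hlt : ∀ l, p l - 1 < 2 ^ m - 1 ∧ p l + s l - 2 < 2 ^ m - 1 := fun l => by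
    have := h.1 l; omega
  have : coreVectors m s p =
      (Fintype.piFinset fun l => Finset.Icc (⟨p l - 1, (hlt l).1⟩ : Fin (2 ^ m - 1))
        ⟨p l + s l - 2, (hlt l).2⟩ : Finset (Fin k → Fin (2 ^ m - 1))) := by
    ext x
    simp only [coreVectors, Set.mem_ofPred_eq, Finset.mem_coe, Fintype.mem_piFinset,
      Finset.mem_Icc, Fin.le_def]
    refine forall_congr' fun l => ?_
    have := h.1 l
    omega
  rw [this, Set.ncard_coe_finset, Fintype.card_piFinset]
  refine Finset.prod_congr rfl fun l _ => ?_
  rw [Fin.card_Icc]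
  have := h.1 l
  simp only
  omega

/-- Distinct admissible index pairs have distinct core boxes. -/
theorem AdmissibleIndex.coreVectors_injective {m k : ℕ} {s p s' p' : Fin k → ℕ}
    (h : AdmissibleIndex m s p) (h' : AdmissibleIndex m s' p')
    (he : coreVectors m s p = coreVectors m s' p') : s = s' ∧ p = p' := by
  have key : ∀ {s p s' p' : Fin k → ℕ}, AdmissibleIndex m s p →
      coreVectors m s p ⊆ coreVectors m s' p' → ∀ l, p' l ≤ p l ∧ p l + s l ≤ p' l + s' l := by
    intro s p s' p' h hs l
    have h1 := hs (show (fun l => (⟨p l - 1, by have := h.1 l; omega⟩ : Fin (2 ^ m - 1))) ∈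
      coreVectors m s p from fun l => by have := h.1 l; simp only; omega) l
    have h2 := hs (show (fun l => (⟨p l + s l - 2, by have := h.1 l; omega⟩ : Fin (2 ^ m - 1))) ∈
      coreVectors m s p from fun l => by have := h.1 l; simp only; omega) l
    have := h.1 l
    simp only at h1 h2
    omega
  have h1 := key h he.le
  have h2 := key h' he.ge
  constructor <;> funext l <;> have := h1 l <;> have := h2 l <;> omega

theorem boxRestrictions_nonempty {m : ℕ} (hm : 1 ≤ m) (k : ℕ) :
    (boxRestrictions m k).Nonempty := by
  have hM : 2 ≤ 2 ^ m := by
    calc 2 = 2 ^ 1 := rfl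
      _ ≤ 2 ^ m := Nat.pow_le_pow_right (by norm_num) hm
  refine ⟨_, mem_boxRestrictions.2 ⟨fun _ => 2 ^ m - 1, fun _ => 1, ⟨fun l => ?_, ?_⟩, rfl⟩⟩
  · simp only
    omega
  · simp only
    rw [Nat.sub_add_cancel (by omega), Finset.prod_const, Finset.card_univ, Fintype.card_fin]
    exact lt_mul_of_one_lt_left (by positivity) (by omega)

theorem nonempty_of_mem_boxRestrictions {m k : ℕ} {C : Set (Fin k → Fin (2 ^ m - 1))}
    (hC : C ∈ boxRestrictions m k) : C.Nonempty := by
  obtain ⟨s, p, h, rfl⟩ := mem_boxRestrictions.1 hC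
  refine ⟨fun l => ⟨p l - 1, by have := h.1 l; omega⟩, fun l => ?_⟩
  have := h.1 l
  simp only
  omega

/-- The number of all vectors is at most `2 ^ (2m)` times the size of any restriction set: with
`u = s_l + 1`, this is `(2 ^ m - 1) / (u - 1) ≤ (2 ^ m / u) ^ 2` in each coordinate, and the product
of the numbers `2 ^ m / u` is less than `2 ^ m`. -/
theorem pow_le_ncard_of_mem_boxRestrictions {m k : ℕ} {C : Set (Fin k → Fin (2 ^ m - 1))}
    (hC : C ∈ boxRestrictions m k) : (2 ^ m - 1) ^ k ≤ (2 ^ m) ^ 2 * C.ncard := by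
  obtain ⟨s, p, h, rfl⟩ := mem_boxRestrictions.1 hC
  rw [h.ncard_coreVectors]
  set M := 2 ^ m
  have hM : 0 < M := by positivity
  have h1 : ∀ l, (s l + 1) ^ 2 * (M - 1) ≤ M ^ 2 * s l := by
    intro l
    have hl := h.1 l
    obtain ⟨c, hc⟩ : ∃ c, M = s l + 1 + c := ⟨M - (s l + 1), by omega⟩
    obtain ⟨r, hr⟩ : ∃ r, s l = r + 1 := ⟨s l - 1, by omega⟩
    rw [hc, hr, show r + 1 + 1 + c - 1 = r + 1 + c by omega]
    nlinarith [Nat.zero_le (c * r), Nat.zero_le (c * r * r), Nat.zero_le (c * c * r),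
      Nat.zero_le (c * c), Nat.zero_le c]
  have h2 : (∏ l, (s l + 1)) ^ 2 * (M - 1) ^ k ≤ (M ^ k) ^ 2 * ∏ l, s l := by
    calc (∏ l, (s l + 1)) ^ 2 * (M - 1) ^ k = ∏ l, ((s l + 1) ^ 2 * (M - 1)) := by
          rw [Finset.prod_mul_distrib, Finset.prod_pow]; simp
      _ ≤ ∏ l, (M ^ 2 * s l) := Finset.prod_le_prod' fun l _ => h1 l
      _ = (M ^ k) ^ 2 * ∏ l, s l := by
          rw [Finset.prod_mul_distrib]; simp [← pow_mul, mul_comm]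
  have h3 : (M ^ k) ^ 2 ≤ M ^ 2 * (∏ l, (s l + 1)) ^ 2 := by
    rw [← mul_pow]
    exact Nat.pow_le_pow_left h.2.le 2
  have hpos : 0 < (∏ l, (s l + 1)) ^ 2 := by positivity
  refine Nat.le_of_mul_le_mul_left (h2.trans ?_) hpos
  calc (M ^ k) ^ 2 * ∏ l, s l ≤ M ^ 2 * (∏ l, (s l + 1)) ^ 2 * ∏ l, s l := by gcongr
    _ = _ := by ring

theorem ncard_boxRestrictions_le (m k : ℕ) :
    (boxRestrictions m k).ncard ≤ (2 ^ m - 1) ^ k * (2 ^ m - 1) ^ k := by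
  have : boxRestrictions m k ⊆ ((Fintype.piFinset fun _ => Finset.Icc 1 (2 ^ m - 1)) ×ˢ
      (Fintype.piFinset fun _ => Finset.Icc 1 (2 ^ m - 1)) :
        Finset ((Fin k → ℕ) × (Fin k → ℕ))).image fun q => coreVectors m q.1 q.2 := by
    intro C hC
    obtain ⟨s, p, h, rfl⟩ := mem_boxRestrictions.1 hC
    simp only [Finset.coe_image, Set.mem_image, Finset.mem_coe, Finset.mem_product,
      Fintype.mem_piFinset, Finset.mem_Icc]
    exact ⟨(s, p), ⟨fun l => by have := h.1 l; simp only; omega,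
      fun l => by have := h.1 l; simp only; omega⟩, rfl⟩
  refine (Set.ncard_le_ncard this (Finset.finite_toSet _)).trans ?_
  rw [Set.ncard_coe_finset]
  refine Finset.card_image_le.trans ?_
  simp [Fintype.card_piFinset]

theorem minCard_boxRestrictions {m : ℕ} (hm : 1 ≤ m) (k : ℕ) :
    0 < minCard (boxRestrictions m k) ∧
      (2 ^ m - 1) ^ k ≤ (2 ^ m) ^ 2 * minCard (boxRestrictions m k) := by
  obtain ⟨C, hC, hCm⟩ := Nat.sInf_mem ((boxRestrictions_nonempty hm k).image Set.ncard)
  rw [minCard, ← hCm]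
  exact ⟨(Set.ncard_pos).2 (nonempty_of_mem_boxRestrictions hC),
    pow_le_ncard_of_mem_boxRestrictions hC⟩

/-! ### Dispersion of composed point sets -/

theorem IsSplitter.exists_injOn {n k l : ℕ} {H : Finset (Fin n → Fin l)} (h : IsSplitter k H)
    (hkl : k ≤ l) {S : Finset (Fin n)} (hS : S.card = k) : ∃ a ∈ H, Set.InjOn a S := by
  obtain ⟨a, ha, hb⟩ := h S hS
  refine ⟨a, ha, fun x hx y hy hxy => ?_⟩
  by_contra hne
  have h2 : 2 ≤ (S.filter fun v => a v = a x).card := by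
    rw [← Finset.card_pair hne]
    refine Finset.card_le_card fun z hz => ?_
    simp only [Finset.mem_insert, Finset.mem_singleton] at hz
    rcases hz with rfl | rfl
    · simpa using hx
    · simpa [hxy] using hy
  have h1 : ∀ j, 1 ≤ (S.filter fun v => a v = j).card := fun j => by
    have := hb (a x) j; omega
  have hsum : S.card = ∑ j, (S.filter fun v => a v = j).card :=
    Finset.card_eq_sum_card_fiberwise fun _ _ => Finset.mem_univ _
  have : ∑ j : Fin l, 1 < ∑ j, (S.filter fun v => a v = j).card :=
    Finset.sum_lt_sum (fun j _ => h1 j) ⟨a x, Finset.mem_univ _, h2⟩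
  simp at this
  omega

theorem mem_of_between {I : Set ℝ} (h : I.OrdConnected) (h01 : I ⊆ Set.Icc 0 1) {y : ℝ}
    (h1 : sInf I < y) (h2 : y < sInf I + volume.real I) : y ∈ I := by
  have hne : I.Nonempty := by
    by_contra h0
    rw [Set.not_nonempty_iff_eq_empty] at h0
    subst h0
    simp at h1 h2
    linarith
  have hb : BddBelow I := ⟨0, fun x hx => (h01 hx).1⟩
  have ha : BddAbove I := ⟨1, fun x hx => (h01 hx).2⟩
  have hv : volume.real I ≤ sSup I - sInf I := by
    rw [← Real.volume_real_Icc_of_le (Real.sInf_le_sSup I hb ha)]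
    exact measureReal_mono (fun x hx => ⟨csInf_le hb hx, le_csSup ha hx⟩) (by simp)
  obtain ⟨x, hx, hxy⟩ := exists_lt_of_csInf_lt hne h1
  obtain ⟨z, hz, hyz⟩ := exists_lt_of_lt_csSup hne (show y < sSup I by linarith)
  exact h.out hx hz ⟨hxy.le, hyz.le⟩

/-- `(1 - 2 ^ (-m)) ^ (m 2 ^ m) ≤ 2 ^ (-m)`: at most `m 2 ^ m` sides of a box of volume larger than
`2 ^ (-m)` have length at most `1 - 2 ^ (-m)`. -/
theorem one_sub_pow_le {m n : ℕ} (h : m * 2 ^ m ≤ n) :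
    (1 - 1 / 2 ^ m : ℝ) ^ n ≤ 1 / 2 ^ m := by
  have hM : (1 : ℝ) ≤ 2 ^ m := one_le_pow₀ (by norm_num)
  have h0 : (0 : ℝ) ≤ 1 - 1 / 2 ^ m := by
    rw [sub_nonneg, div_le_one (by positivity)]; exact hM
  have h1 : (1 - 1 / 2 ^ m : ℝ) ^ (2 ^ m) ≤ 1 / 2 := by
    have := Real.one_sub_div_pow_le_exp_neg (n := 2 ^ m) (t := 1) (by exact_mod_cast hM)
    push_cast at this
    refine this.trans ?_
    rw [Real.exp_neg, one_div]
    have := Real.add_one_le_exp (1 : ℝ)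
    gcongr
    linarith
  calc (1 - 1 / 2 ^ m : ℝ) ^ n ≤ (1 - 1 / 2 ^ m : ℝ) ^ (m * 2 ^ m) :=
        pow_le_pow_of_le_one h0 (by rw [sub_le_self_iff]; positivity) h
    _ = ((1 - 1 / 2 ^ m : ℝ) ^ (2 ^ m)) ^ m := by rw [mul_comm, pow_mul]
    _ ≤ (1 / 2) ^ m := by gcongr
    _ = 1 / 2 ^ m := by rw [one_div_pow]

/-- If a box in `[0,1]^D` has volume larger than `2 ^ (-m)`, it contains one of the points that
arise by composing the vectors of a solution of the box restrictions with the maps of a splitter. -/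
theorem exists_gridPoint_mem {m D k l : ℕ} (hk : k = activeBound m D) (hkl : k ≤ l)
    {A : Finset (Fin D → Fin l)} (hA : IsSplitter k A)
    {T : Set (Fin l → Fin (2 ^ m - 1))} (hT : SolvesRestrictions (boxRestrictions m k) T)
    {I : Fin D → Set ℝ} (hI : IsBoxSides I) (hvol : 1 / 2 ^ m < volume.real (Set.univ.pi I)) :
    ∃ τ ∈ T, ∃ a ∈ A, gridPoint m (fun i => τ (a i)) ∈ Set.univ.pi I := by
  have hM : (0 : ℝ) < 2 ^ m := by positivity
  rw [IsBoxSides.volume_pi] at hvol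
  set v : Fin D → ℝ := fun l => volume.real (I l) with hv
  have hv0 : ∀ l, 0 ≤ v l := fun l => measureReal_nonneg
  have hinf0 : ∀ l, 0 ≤ sInf (I l) := fun l => Real.sInf_nonneg fun x hx => ((hI l).2 hx).1
  have hvinf : ∀ l, v l ≤ 1 - sInf (I l) := fun l => volume_real_le_one_sub_sInf (hI l).2
  have hv1 : ∀ l, v l ≤ 1 := fun l => by have := hinf0 l; have := hvinf l; linarith
  have hprod : ∀ S : Finset (Fin D), 1 / 2 ^ m < ∏ l ∈ S, v l := fun S =>
    hvol.trans_le (Finset.prod_le_prod_of_subset_of_le_one (Finset.subset_univ S)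
      (fun l _ => hv0 l) fun l _ _ => hv1 l)
  have hvM : ∀ l, 1 / 2 ^ m < v l := fun l => by simpa using hprod {l}
  -- the active coordinates
  let act : Finset (Fin D) := Finset.univ.filter fun l => v l ≤ 1 - 1 / 2 ^ m
  have hact : act.card ≤ k := by
    rw [hk, activeBound, le_min_iff]
    refine ⟨?_, by simpa using Finset.card_le_univ act⟩
    by_contra! hlt
    have h1 : ∏ l ∈ act, v l ≤ (1 - 1 / 2 ^ m) ^ act.card := by
      refine (Finset.prod_le_prod (fun l _ => hv0 l) fun l hl =>
        (Finset.mem_filter.1 hl).2).trans ?_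
      rw [Finset.prod_const]
    exact absurd (hprod act) (not_lt.2 (h1.trans (one_sub_pow_le hlt.le)))
  have hkD : k ≤ (Finset.univ : Finset (Fin D)).card := by
    simp [hk, activeBound]
  obtain ⟨S, hactS, -, hS⟩ := Finset.exists_subsuperset_card_eq (Finset.subset_univ act) hact hkD
  obtain ⟨a, haA, ha⟩ := hA.exists_injOn hkl hS
  -- the discretized box
  let s : Fin D → ℕ := fun l => ⌈2 ^ m * v l⌉₊ - 1
  let p : Fin D → ℕ := fun l => ⌊2 ^ m * sInf (I l)⌋₊ + 1
  have hs : ∀ l, (s l : ℝ) < 2 ^ m * v l ∧ 2 ^ m * v l ≤ s l + 1 ∧ 1 ≤ s l := by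
    intro l
    have h1 : 1 < 2 ^ m * v l := by
      have := hvM l
      rw [div_lt_iff₀ hM] at this
      linarith
    have h2 : 2 ≤ ⌈2 ^ m * v l⌉₊ := Nat.lt_ceil.2 (by exact_mod_cast h1)
    have h3 : ((s l : ℕ) : ℝ) + 1 = ⌈2 ^ m * v l⌉₊ := by
      have : s l + 1 = ⌈2 ^ m * v l⌉₊ := by simp only [s]; omega
      exact_mod_cast this
    refine ⟨?_, ?_, by simp only [s]; omega⟩
    · have := Nat.ceil_lt_add_one (show 0 ≤ 2 ^ m * v l by linarith)
      linarith
    · rw [h3]; exact Nat.le_ceil _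
  have hp : ∀ l, (p l : ℝ) - 1 ≤ 2 ^ m * sInf (I l) ∧ 2 ^ m * sInf (I l) < p l ∧ 1 ≤ p l := by
    intro l
    refine ⟨?_, ?_, by simp [p]⟩
    · simp only [p]
      push_cast
      simpa using Nat.floor_le (mul_nonneg hM.le (hinf0 l))
    · simp only [p]
      push_cast
      exact Nat.lt_floor_add_one _
  have hsp : ∀ l, s l + p l ≤ 2 ^ m := by
    intro l
    have h1 := hs l
    have h2 := hp l
    have h3 : 2 ^ m * v l ≤ 2 ^ m * (1 - sInf (I l)) := by gcongr; exact hvinf l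
    have : (s l : ℝ) + p l < 2 ^ m + 1 := by linarith
    have : s l + p l < 2 ^ m + 1 := by exact_mod_cast this
    omega
  -- grid points of the core lie in the box
  have hcore : ∀ l, ∀ y : ℕ, p l ≤ y + 1 → y + 2 ≤ p l + s l →
      (((y : ℕ) : ℝ) + 1) / 2 ^ m ∈ I l := by
    intro l y h1 h2
    have h3 := hs l
    have h4 := hp l
    have h1' : (p l : ℝ) ≤ y + 1 := by exact_mod_cast h1
    have h2' : (y : ℝ) + 2 ≤ p l + s l := by exact_mod_cast h2
    refine mem_of_between (hI l).1 (hI l).2 ?_ ?_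
    · rw [lt_div_iff₀ hM]; linarith
    · rw [div_lt_iff₀ hM]
      change _ < (sInf (I l) + v l) * 2 ^ m
      linarith
  -- the enumeration of the image of the active coordinates
  have hcard : (S.image a).card = k := by rw [Finset.card_image_of_injOn ha, hS]
  let e : Fin k ↪o Fin l := (S.image a).orderEmbOfFin hcard
  have hg : ∀ i, ∃ x ∈ S, a x = e i := fun i =>
    Finset.mem_image.1 (Finset.orderEmbOfFin_mem (S.image a) hcard i)
  choose g hgS hge using hg
  have hginj : Function.Injective g := fun i j hij => by
    apply e.injective
    rw [← hge, ← hge, hij]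
  have hgimg : Finset.univ.image g = S := by
    refine Finset.eq_of_subset_of_card_le (fun x hx => ?_) ?_
    · obtain ⟨i, -, rfl⟩ := Finset.mem_image.1 hx
      exact hgS i
    · rw [Finset.card_image_of_injective _ hginj, hS]; simp
  have hadm : AdmissibleIndex m (fun i => s (g i)) (fun i => p (g i)) := by
    refine ⟨fun i => ⟨(hs _).2.2, (hp _).2.2, hsp _⟩, ?_⟩
    have h1 : 1 / (2 : ℝ) ^ m < ∏ i, v (g i) := by
      have := hprod S
      rw [← hgimg, Finset.prod_image (fun i _ j _ h => hginj h)] at this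
      exact this
    have h2 : ((2 : ℝ) ^ m) ^ k * ∏ i, v (g i) ≤ ∏ i, ((s (g i) : ℝ) + 1) := by
      calc ((2 : ℝ) ^ m) ^ k * ∏ i, v (g i) = ∏ i, (2 ^ m * v (g i)) := by
            rw [Finset.prod_mul_distrib]; simp
        _ ≤ _ := Finset.prod_le_prod (fun i _ => mul_nonneg hM.le (hv0 _)) fun i _ => (hs _).2.1
    have h3 : ((2 : ℝ) ^ m) ^ k < 2 ^ m * ∏ i, ((s (g i) : ℝ) + 1) := by
      calc ((2 : ℝ) ^ m) ^ k = 2 ^ m * (((2 : ℝ) ^ m) ^ k * (1 / 2 ^ m)) := by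
            field_simp
        _ < 2 ^ m * (((2 : ℝ) ^ m) ^ k * ∏ i, v (g i)) := by gcongr
        _ ≤ _ := by gcongr
    exact_mod_cast h3
  obtain ⟨τ, hτ, hτC⟩ := hT e _ (mem_boxRestrictions.2 ⟨_, _, hadm, rfl⟩)
  refine ⟨τ, hτ, a, haA, fun l _ => ?_⟩
  by_cases hl : l ∈ S
  · rw [← hgimg] at hl
    obtain ⟨i, -, rfl⟩ := Finset.mem_image.1 hl
    have := hτC i
    simp only [← hge i] at this
    exact hcore _ _ this.1 this.2
  · -- an inactive side meets all slabs of the grid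
    have hnot : ¬ v l ≤ 1 - 1 / 2 ^ m := fun h =>
      hl (hactS (Finset.mem_filter.2 ⟨Finset.mem_univ _, h⟩))
    have h1 : 2 ^ m - 1 ≤ s l := by
      have h2 : (2 : ℝ) ^ m - 1 < 2 ^ m * v l := by
        calc (2 : ℝ) ^ m - 1 = 2 ^ m * (1 - 1 / 2 ^ m) := by field_simp
          _ < _ := by gcongr; exact not_le.1 hnot
      have h3 : (2 : ℝ) ^ m < s l + 2 := by have := hs l; linarith
      have : 2 ^ m < s l + 2 := by exact_mod_cast h3
      omega
    have h2 := hsp l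
    have h3 := (hp l).2.2
    have h4 := (τ (a l)).isLt
    exact hcore l _ (by omega) (by omega)

theorem dispersion_le {m d D k l : ℕ} (hd : d ≤ D) (hk : k = activeBound m D) (hkl : k ≤ l)
    {A : Finset (Fin D → Fin l)} (hA : IsSplitter k A)
    {T : Set (Fin l → Fin (2 ^ m - 1))} (hT : SolvesRestrictions (boxRestrictions m k) T)
    {ε : ℝ} (hε : 1 / 2 ^ m ≤ ε) :
    dispersion {y : Fin d → ℝ | ∃ τ ∈ T, ∃ a ∈ A,
      y = fun j => gridPoint m (fun i => τ (a i)) (Fin.castLE hd j)} ≤ ENNReal.ofReal ε := by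
  refine iSup_le fun I => iSup_le fun hI => iSup_le fun hdisj => ?_
  by_contra! hlt
  obtain ⟨r, rfl⟩ := Nat.exists_eq_add_of_le hd
  have hfin : volume (Set.univ.pi I) ≠ ⊤ := by
    rw [volume_pi_pi]
    refine ENNReal.prod_ne_top fun l _ => ?_
    exact ((measure_mono (hI l).2).trans_lt (by simp)).ne
  have hvol : 1 / 2 ^ m < volume.real (Set.univ.pi I) := by
    refine hε.trans_lt ?_
    by_contra! hle
    exact absurd hlt (not_lt.2 (by
      rw [← ENNReal.ofReal_toReal hfin]; exact ENNReal.ofReal_le_ofReal hle))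
  -- extend the box by full sides in the superfluous coordinates
  let J : Fin (d + r) → Set ℝ := Fin.append I fun _ => Set.Icc 0 1
  have hJ : IsBoxSides J := by
    intro l
    refine Fin.addCases (fun i => ?_) (fun i => ?_) l
    · simpa [J] using hI i
    · simpa [J] using Set.ordConnected_Icc
  have hJvol : 1 / 2 ^ m < volume.real (Set.univ.pi J) := by
    rw [IsBoxSides.volume_pi, Fin.prod_univ_add]
    simpa [J, IsBoxSides.volume_pi] using hvol
  obtain ⟨τ, hτ, a, ha, hmem⟩ := exists_gridPoint_mem hk hkl hA hT hJ hJvol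
  refine Set.disjoint_left.1 hdisj (show (fun j => gridPoint m (fun i => τ (a i))
    (Fin.castLE hd j)) ∈ Set.univ.pi I from fun j _ => ?_) ⟨τ, hτ, a, ha, rfl⟩
  have := hmem (Fin.castAdd r j) (Set.mem_univ _)
  simp only [J, Fin.append_left] at this
  exact this

/-! ### Exhaustive search -/

section search
variable {b k n : ℕ}

instance : Finite (Fin k ↪o Fin n) := DFunLike.finite _

/-- The restrictions violated by all members of `T`. -/
def outstanding (𝒞 : Set (Set (Fin k → Fin b))) (T : List (Fin n → Fin b)) :
    Set ((Fin k ↪o Fin n) × Set (Fin k → Fin b)) :=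
  {q | q.2 ∈ 𝒞 ∧ ∀ y ∈ T, (fun i => y (q.1 i)) ∉ q.2}

theorem solvesRestrictions_iff_outstanding {𝒞 : Set (Set (Fin k → Fin b))}
    {T : List (Fin n → Fin b)} :
    SolvesRestrictions 𝒞 {τ | τ ∈ T} ↔ outstanding 𝒞 T = ∅ := by
  rw [Set.eq_empty_iff_forall_notMem]
  constructor
  · rintro h ⟨e, C⟩ ⟨hC, hT⟩
    obtain ⟨x, hx, hxC⟩ := h e C hC
    exact hT x hx hxC
  · intro h e C hC
    by_contra! h'
    exact h (e, C) ⟨hC, fun y hy => h' y hy⟩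

theorem gain_eq (𝒞 : Set (Set (Fin k → Fin b))) (T : List (Fin n → Fin b)) (x : Fin n → Fin b) :
    gain 𝒞 T x = (outstanding 𝒞 T ∩ {q | (fun i => x (q.1 i)) ∈ q.2}).ncard := by
  rw [gain]
  congr 1
  ext q
  simp [outstanding, and_assoc]

theorem outstanding_append (𝒞 : Set (Set (Fin k → Fin b))) (T : List (Fin n → Fin b))
    (x : Fin n → Fin b) :
    (outstanding 𝒞 (T ++ [x])).ncard + gain 𝒞 T x = (outstanding 𝒞 T).ncard := by
  rw [gain_eq, ← Set.ncard_inter_add_ncard_sdiff_eq_ncard (outstanding 𝒞 T)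
    {q | (fun i => x (q.1 i)) ∈ q.2} (Set.toFinite _), add_comm]
  congr 2
  ext q
  simp [outstanding, and_assoc, or_imp, forall_and]

theorem IsKWiseIndependent.card_filter_mem {Ω : Finset (Fin n → Fin b)}
    (h : IsKWiseIndependent k Ω) (e : Fin k ↪o Fin n) (C : Finset (Fin k → Fin b)) :
    (Ω.filter fun x => (fun i => x (e i)) ∈ C).card * b ^ k = C.card * Ω.card := by
  have : (Ω.filter fun x => (fun i => x (e i)) ∈ C).card =
      ∑ v ∈ C, (Ω.filter fun x => (fun i => x (e i)) = v).card := by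
    refine (Finset.card_eq_sum_card_fiberwise (f := fun x : Fin n → Fin b => fun i => x (e i))
      (t := C) fun x hx => (Finset.mem_filter.1 (Finset.mem_coe.1 hx)).2).trans ?_
    refine Finset.sum_congr rfl fun v hv => ?_
    congr 1
    ext x
    simp only [Finset.mem_filter]
    constructor
    · rintro ⟨⟨h1, -⟩, h2⟩; exact ⟨h1, h2⟩
    · rintro ⟨h1, h2⟩; exact ⟨⟨h1, h2 ▸ hv⟩, h2⟩
  rw [this, Finset.sum_mul, Finset.sum_congr rfl fun v _ => h.2 e v]
  simp

/-- A member of a `k`-wise independent space picked at random satisfies an outstanding restriction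
with probability at least `minCard 𝒞 / b ^ k`, hence some member satisfies this proportion. -/
theorem IsKWiseIndependent.minCard_mul_ncard_le {Ω : Finset (Fin n → Fin b)}
    (h : IsKWiseIndependent k Ω) (𝒞 : Set (Set (Fin k → Fin b))) (T : List (Fin n → Fin b))
    {g : ℕ} (hg : ∀ x ∈ Ω, gain 𝒞 T x ≤ g) :
    minCard 𝒞 * (outstanding 𝒞 T).ncard ≤ g * b ^ k := by
  classical
  set U := (Set.toFinite (outstanding 𝒞 T)).toFinset with hU
  have hgain : ∀ x, gain 𝒞 T x = (U.filter fun q => (fun i => x (q.1 i)) ∈ q.2).card := by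
    intro x
    rw [gain_eq, ← Set.ncard_coe_finset]
    congr 1
    ext q
    simp [hU]
  have hq : ∀ q ∈ U, minCard 𝒞 * Ω.card ≤
      (Ω.filter fun x => (fun i => x (q.1 i)) ∈ q.2).card * b ^ k := by
    intro q hq
    have hq' : q.2 ∈ 𝒞 := ((Set.Finite.mem_toFinset _).1 hq).1
    have := h.card_filter_mem q.1 (Set.toFinite q.2).toFinset
    simp only [Set.Finite.mem_toFinset] at this
    rw [this, ← Set.ncard_eq_toFinset_card]
    exact Nat.mul_le_mul_right _ (Nat.sInf_le ⟨_, hq', rfl⟩)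
  have hsum : ∑ x ∈ Ω, gain 𝒞 T x =
      ∑ q ∈ U, (Ω.filter fun x => (fun i => x (q.1 i)) ∈ q.2).card := by
    simp only [hgain]
    exact Finset.sum_card_bipartiteAbove_eq_sum_card_bipartiteBelow
      (r := fun (x : Fin n → Fin b) (q : (Fin k ↪o Fin n) × Set (Fin k → Fin b)) =>
        (fun i => x (q.1 i)) ∈ q.2)
  have hpos : 0 < Ω.card := h.1.card_pos
  refine Nat.le_of_mul_le_mul_left ?_ hpos
  calc Ω.card * (minCard 𝒞 * (outstanding 𝒞 T).ncard)
      = ∑ q ∈ U, minCard 𝒞 * Ω.card := by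
        rw [Finset.sum_const, smul_eq_mul, Set.ncard_eq_toFinset_card (outstanding 𝒞 T)]
        ring
    _ ≤ ∑ q ∈ U, (Ω.filter fun x => (fun i => x (q.1 i)) ∈ q.2).card * b ^ k :=
        Finset.sum_le_sum hq
    _ = (∑ x ∈ Ω, gain 𝒞 T x) * b ^ k := by rw [hsum, Finset.sum_mul]
    _ ≤ (Ω.card * g) * b ^ k := by
        gcongr
        simpa using Finset.sum_le_card_nsmul Ω _ g hg
    _ = Ω.card * (g * b ^ k) := by ring

/-- Every vector found by exhaustive search satisfies at least the proportion
`p = minCard 𝒞 / b ^ k` of the outstanding restrictions. So fewer than `N exp (-p j)` of them remain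
after `j` steps, and the search ends after at most `⌈log N / p⌉` steps. -/
theorem length_le_of_foundBySearch {𝒞 : Set (Set (Fin k → Fin b))}
    {Ω : Finset (Fin n → Fin b)} (hΩ : IsKWiseIndependent k Ω) {T : List (Fin n → Fin b)}
    (hT : FoundBySearch 𝒞 Ω T) (hout : ∀ i < T.length, (outstanding 𝒞 (T.take i)).Nonempty)
    (hb : 0 < b) (hc : 0 < minCard 𝒞) {N : ℝ}
    (hN : ((outstanding 𝒞 ([] : List (Fin n → Fin b))).ncard : ℝ) < N) :
    T.length ≤ ⌈(b : ℝ) ^ k / (minCard 𝒞 : ℝ) * Real.log N⌉₊ := by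
  set p : ℝ := (minCard 𝒞 : ℝ) / (b : ℝ) ^ k with hp
  have hbk : (0 : ℝ) < (b : ℝ) ^ k := by positivity
  have hc' : (0 : ℝ) < minCard 𝒞 := by exact_mod_cast hc
  have hp0 : 0 < p := by positivity
  have hdecay : ∀ i ≤ T.length, ((outstanding 𝒞 (T.take i)).ncard : ℝ) ≤
      (outstanding 𝒞 ([] : List (Fin n → Fin b))).ncard * Real.exp (-(p * i)) := by
    intro i
    induction i with
    | zero => simp
    | succ i ih =>
      intro hi
      have hstep := outstanding_append 𝒞 (T.take i) T[i]
      rw [List.take_append_getElem hi] at hstep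
      have hgain := hΩ.minCard_mul_ncard_le 𝒞 (T.take i) (hT i hi).2
      have hgain' : p * (outstanding 𝒞 (T.take i)).ncard ≤ gain 𝒞 (T.take i) T[i] := by
        rw [hp, div_mul_eq_mul_div, div_le_iff₀ hbk]
        exact_mod_cast hgain
      have hstep' : ((outstanding 𝒞 (T.take (i + 1))).ncard : ℝ) + gain 𝒞 (T.take i) T[i] =
          (outstanding 𝒞 (T.take i)).ncard := by exact_mod_cast hstep
      have hexp : 1 - p ≤ Real.exp (-p) := by linarith [Real.add_one_le_exp (-p)]
      calc ((outstanding 𝒞 (T.take (i + 1))).ncard : ℝ)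
          ≤ (1 - p) * (outstanding 𝒞 (T.take i)).ncard := by linarith
        _ ≤ Real.exp (-p) * (outstanding 𝒞 (T.take i)).ncard := by gcongr
        _ ≤ Real.exp (-p) * ((outstanding 𝒞 ([] : List (Fin n → Fin b))).ncard *
              Real.exp (-(p * i))) := by gcongr; exact ih (by omega)
        _ = _ := by
          rw [mul_left_comm, ← Real.exp_add]
          congr 2
          push_cast
          ring
  rcases Nat.eq_zero_or_pos T.length with h0 | hpos
  · omega
  obtain ⟨j, hj⟩ : ∃ j, T.length = j + 1 := ⟨T.length - 1, by omega⟩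
  have h1 : (1 : ℝ) ≤ (outstanding 𝒞 (T.take j)).ncard := by
    exact_mod_cast (Set.ncard_pos (Set.toFinite _)).2 (hout j (by omega))
  have h2 : Real.exp (p * j) < N := by
    have h3 := h1.trans (hdecay j (by omega))
    rw [Real.exp_neg, ← div_eq_mul_inv, one_le_div (Real.exp_pos _)] at h3
    exact h3.trans_lt hN
  have h3 : p * j < Real.log N := by
    rw [Real.lt_log_iff_exp_lt ((Real.exp_pos _).trans h2)]
    exact h2
  rw [hj, Nat.succ_le_iff, Nat.lt_ceil]
  rw [show (b : ℝ) ^ k / (minCard 𝒞 : ℝ) * Real.log N = Real.log N / p by rw [hp]; field_simp,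
    lt_div_iff₀ hp0]
  linarith

/-- The space of all vectors is `k`-wise independent. -/
theorem isKWiseIndependent_univ (hb : 0 < b) :
    IsKWiseIndependent k (Finset.univ : Finset (Fin n → Fin b)) := by
  classical
  have : NeZero b := ⟨hb.ne'⟩
  refine ⟨Finset.univ_nonempty, fun e v => ?_⟩
  have hkn : k ≤ n := by simpa using Fintype.card_le_of_embedding e.toEmbedding
  have : (Finset.univ.filter fun x : Fin n → Fin b => (fun i => x (e i)) = v) =
      Fintype.piFinset fun j => if h : ∃ i, e i = j then {v h.choose} else Finset.univ := by
    ext x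
    simp only [Finset.mem_filter, Finset.mem_univ, true_and, Fintype.mem_piFinset]
    constructor
    · rintro rfl j
      split_ifs with h
      · simp [h.choose_spec]
      · simp
    · intro h
      funext i
      have h' := h (e i)
      have hex : ∃ i', e i' = e i := ⟨i, rfl⟩
      rw [dif_pos hex, Finset.mem_singleton] at h'
      rw [h', e.injective hex.choose_spec]
  rw [this, Fintype.card_piFinset]
  have hprod : ∀ j, (if h : ∃ i, e i = j then ({v h.choose} : Finset (Fin b))
      else Finset.univ).card = if ∃ i, e i = j then 1 else b := by
    intro j
    split_ifs <;> simp
  simp only [hprod]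
  rw [Finset.prod_ite, Finset.prod_const_one, one_mul, Finset.prod_const, ← pow_add]
  have himg : (Finset.univ.filter fun j => ∃ i, e i = j) = Finset.univ.image e := by
    ext j; simp
  have h1 : (Finset.univ.filter fun j => ∃ i, e i = j).card = k := by
    rw [himg, Finset.card_image_of_injective _ e.injective]; simp
  have h2 := Finset.card_filter_add_card_filter_not (s := (Finset.univ : Finset (Fin n)))
    (fun j => ∃ i, e i = j)
  rw [h1, Finset.card_univ, Fintype.card_fin] at h2
  rw [show (Finset.univ.filter fun j => ¬ ∃ i, e i = j).card + k = n by omega]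
  simp

end search

theorem ncard_outstanding_lt {m k n : ℕ} (hk : 0 < k) (hn : 0 < n) :
    ((outstanding (boxRestrictions m k) ([] : List (Fin n → Fin (2 ^ m - 1)))).ncard : ℝ) <
      (n : ℝ) ^ k * 2 ^ (2 * m * k) := by
  have h1 : outstanding (boxRestrictions m k) ([] : List (Fin n → Fin (2 ^ m - 1))) =
      Set.univ ×ˢ boxRestrictions m k := by
    ext q; simp [outstanding]
  have h2 : Nat.card (Fin k ↪o Fin n) ≤ n ^ k := by
    have := Nat.card_le_card_of_injective (fun (e : Fin k ↪o Fin n) => (e : Fin k → Fin n))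
      DFunLike.coe_injective
    simpa using this
  have h3 : (outstanding (boxRestrictions m k) ([] : List (Fin n → Fin (2 ^ m - 1)))).ncard <
      n ^ k * 2 ^ (2 * m * k) := by
    rw [h1, Set.ncard_prod, Set.ncard_univ]
    have hlt : (2 ^ m - 1) ^ k * (2 ^ m - 1) ^ k < 2 ^ (2 * m * k) := by
      rw [← mul_pow, show 2 * m * k = (m + m) * k by ring, pow_mul, pow_add]
      have : 0 < 2 ^ m := by positivity
      refine Nat.pow_lt_pow_left (Nat.mul_lt_mul'' ?_ ?_) hk.ne' <;> omega
    calc _ ≤ n ^ k * ((2 ^ m - 1) ^ k * (2 ^ m - 1) ^ k) :=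
          Nat.mul_le_mul h2 (ncard_boxRestrictions_le m k)
      _ < _ := by gcongr
  exact_mod_cast h3

/-! ### Greedy splitters -/

/-- The smallest place below `n` where `S` attains its minimum below `n` (zero if `n = 0`). -/
def argminBelow (S : ℕ → ℕ) : ℕ → ℕ
  | 0 => 0
  | n + 1 => if S n < S (argminBelow S n) then n else argminBelow S n

theorem argminBelow_lt (S : ℕ → ℕ) {n : ℕ} (hn : 0 < n) : argminBelow S n < n := by
  obtain ⟨n, rfl⟩ : ∃ r, n = r + 1 := ⟨n - 1, by omega⟩
  clear hn
  induction n with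
  | zero => simp [argminBelow]
  | succ n ih =>
    rw [argminBelow]
    split_ifs <;> omega

theorem argminBelow_le (S : ℕ → ℕ) {n j : ℕ} (hj : j < n) : S (argminBelow S n) ≤ S j := by
  induction n with
  | zero => omega
  | succ n ih =>
    rw [argminBelow]
    rcases Nat.lt_succ_iff_lt_or_eq.1 hj with h | rfl
    · have := ih h
      split_ifs <;> omega
    · split_ifs <;> omega

theorem argminBelow_congr {S S' : ℕ → ℕ} {n : ℕ} (h : ∀ j < n, S j = S' j) :
    argminBelow S n = argminBelow S' n := by
  induction n with
  | zero => rfl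
  | succ n ih =>
    have ih' := ih fun j hj => h j (by omega)
    have hlt : argminBelow S' n < n + 1 := by
      rcases Nat.eq_zero_or_pos n with rfl | hn
      · simp [argminBelow]
      · exact (argminBelow_lt S' hn).trans (by omega)
    rw [argminBelow, argminBelow, ih', h n (by omega), h _ hlt]

/-- The number of rows `u < t` of the table `F` (with rows of length `D`, written one after the
other) in which the columns `x` and `y` have the same entry. -/
def collisions (D : ℕ) (F : ℕ → ℕ) (t x y : ℕ) : ℕ :=
  ((Finset.range t).filter fun u => F (u * D + x) = F (u * D + y)).card

/-- The weight of the columns `y < x` with entry `j` in row `t`, the weight of a column being `2` to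
the number of its collisions with column `x` in the previous rows. -/
def colorWeight (D : ℕ) (F : ℕ → ℕ) (t x j : ℕ) : ℕ :=
  ∑ y ∈ Finset.range x, if F (t * D + y) = j then 2 ^ collisions D F t x y else 0

/-- The first `i` cells of the greedy table of colours below `q` with rows of length `D`: the colour
of column `x` in row `t` has minimal weight `colorWeight`. -/
def greedyTable (D q : ℕ) : ℕ → ℕ → ℕ
  | 0 => fun _ => 0
  | i + 1 => Function.update (greedyTable D q i) i
      (argminBelow (colorWeight D (greedyTable D q i) (i / D) (i % D)) q)

/-- The cell `i` of the greedy table. -/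
def greedyColor (D q i : ℕ) : ℕ := greedyTable D q (i + 1) i

theorem greedyTable_of_lt {D q i j : ℕ} (h : j < i) :
    greedyTable D q i j = greedyColor D q j := by
  induction i with
  | zero => omega
  | succ i ih =>
    rcases Nat.lt_succ_iff_lt_or_eq.1 h with h | rfl
    · rw [greedyTable, Function.update_of_ne h.ne, ih h]
    · rfl

theorem cell_lt {D t u x y : ℕ} (hu : u < t) (hy : y < D) : u * D + y < t * D + x := by
  have : (u + 1) * D ≤ t * D := Nat.mul_le_mul_right _ hu
  rw [Nat.succ_mul] at this
  omega

theorem collisions_congr {D t x y : ℕ} {F G : ℕ → ℕ} (hx : x < D) (hy : y < D)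
    (h : ∀ i < t * D, F i = G i) : collisions D F t x y = collisions D G t x y := by
  unfold collisions
  congr 1
  refine Finset.filter_congr fun u hu => ?_
  have hu' := Finset.mem_range.1 hu
  rw [h _ (cell_lt (x := 0) hu' hx), h _ (cell_lt (x := 0) hu' hy)]

theorem colorWeight_congr {D t x : ℕ} {F G : ℕ → ℕ} (hx : x < D)
    (h : ∀ i < t * D + x, F i = G i) (j : ℕ) : colorWeight D F t x j = colorWeight D G t x j := by
  refine Finset.sum_congr rfl fun y hy => ?_
  have hy' := Finset.mem_range.1 hy
  rw [h _ (by omega), collisions_congr hx (hy'.trans hx) fun i hi => h i (by omega)]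

theorem greedyColor_eq {D q t x : ℕ} (hx : x < D) :
    greedyColor D q (t * D + x) = argminBelow (colorWeight D (greedyColor D q) t x) q := by
  have h1 : (t * D + x) / D = t := by
    rw [mul_comm, Nat.mul_add_div (by omega), Nat.div_eq_of_lt hx, add_zero]
  have h2 : (t * D + x) % D = x := by
    rw [mul_comm, Nat.mul_add_mod, Nat.mod_eq_of_lt hx]
  rw [greedyColor, greedyTable, Function.update_self, h1, h2]
  exact argminBelow_congr fun j _ => colorWeight_congr hx (fun i hi => greedyTable_of_lt hi) j

theorem greedyColor_lt {D q : ℕ} (hq : 0 < q) (i : ℕ) : greedyColor D q i < q := by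
  rw [greedyColor, greedyTable, Function.update_self]
  exact argminBelow_lt _ hq

/-- The total weight `∑_{y < x < D} 2 ^ collisions` after `t` rows. -/
def totalWeight (D : ℕ) (F : ℕ → ℕ) (t : ℕ) : ℕ :=
  ∑ x ∈ Finset.range D, ∑ y ∈ Finset.range x, 2 ^ collisions D F t x y

theorem collisions_succ (D : ℕ) (F : ℕ → ℕ) (t x y : ℕ) :
    collisions D F (t + 1) x y =
      collisions D F t x y + if F (t * D + y) = F (t * D + x) then 1 else 0 := by
  unfold collisions
  rw [Finset.range_add_one, Finset.filter_insert]
  by_cases h : F (t * D + x) = F (t * D + y)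
  · rw [if_pos h, if_pos h.symm, Finset.card_insert_of_notMem (by simp)]
  · rw [if_neg h, if_neg (Ne.symm h), add_zero]

theorem totalWeight_succ (D : ℕ) (F : ℕ → ℕ) (t : ℕ) :
    totalWeight D F (t + 1) =
      totalWeight D F t + ∑ x ∈ Finset.range D, colorWeight D F t x (F (t * D + x)) := by
  unfold totalWeight colorWeight
  rw [← Finset.sum_add_distrib]
  refine Finset.sum_congr rfl fun x _ => ?_
  rw [← Finset.sum_add_distrib]
  refine Finset.sum_congr rfl fun y _ => ?_
  rw [collisions_succ]
  split_ifs <;> ring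

/-- A row of the greedy table multiplies the total weight by at most `1 + 1 / q`, since the colour
of each column is at least as good as a random colour. -/
theorem mul_totalWeight_succ_le {D q : ℕ} (hq : 0 < q) (t : ℕ) :
    q * totalWeight D (greedyColor D q) (t + 1) ≤
      (q + 1) * totalWeight D (greedyColor D q) t := by
  rw [totalWeight_succ, add_mul, mul_add, one_mul, Nat.add_le_add_iff_left, totalWeight,
    Finset.mul_sum]
  refine Finset.sum_le_sum fun x hx => ?_
  set F := greedyColor D q
  have h1 : ∀ j ∈ Finset.range q, colorWeight D F t x (F (t * D + x)) ≤ colorWeight D F t x j := by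
    intro j hj
    simp only [F]
    rw [greedyColor_eq (Finset.mem_range.1 hx)]
    exact argminBelow_le _ (Finset.mem_range.1 hj)
  calc q * colorWeight D F t x (F (t * D + x))
      ≤ ∑ j ∈ Finset.range q, colorWeight D F t x j := by
        simpa using Finset.card_nsmul_le_sum _ _ _ h1
    _ = ∑ y ∈ Finset.range x, 2 ^ collisions D F t x y := by
        unfold colorWeight
        rw [Finset.sum_comm]
        refine Finset.sum_congr rfl fun y _ => ?_
        rw [Finset.sum_ite_eq, if_pos (Finset.mem_range.2 (greedyColor_lt hq _))]

theorem totalWeight_le {D q : ℕ} (hq : 0 < q) (t : ℕ) :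
    (totalWeight D (greedyColor D q) t : ℝ) ≤ (D : ℝ) ^ 2 * (1 + 1 / q) ^ t := by
  have hq' : (0 : ℝ) < q := by exact_mod_cast hq
  induction t with
  | zero =>
    have : totalWeight D (greedyColor D q) 0 ≤ D ^ 2 := by
      unfold totalWeight
      calc _ ≤ ∑ x ∈ Finset.range D, D := by
            refine Finset.sum_le_sum fun x hx => ?_
            simpa [collisions] using (Finset.mem_range.1 hx).le
        _ = D ^ 2 := by simp [sq]
    simpa using (by exact_mod_cast this : (totalWeight D (greedyColor D q) 0 : ℝ) ≤ (D : ℝ) ^ 2)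
  | succ t ih =>
    have h : (q : ℝ) * totalWeight D (greedyColor D q) (t + 1) ≤
        (q + 1) * totalWeight D (greedyColor D q) t := by
      exact_mod_cast mul_totalWeight_succ_le hq t
    have h2 : (totalWeight D (greedyColor D q) (t + 1) : ℝ) ≤
        (1 + 1 / q) * totalWeight D (greedyColor D q) t := by
      rw [← sub_nonneg]
      have : (1 + 1 / (q : ℝ)) * totalWeight D (greedyColor D q) t -
          totalWeight D (greedyColor D q) (t + 1) = ((q + 1) * totalWeight D (greedyColor D q) t -
          q * totalWeight D (greedyColor D q) (t + 1)) / q := by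
        field_simp
      rw [this]
      exact div_nonneg (by linarith) hq'.le
    calc _ ≤ (1 + 1 / (q : ℝ)) * totalWeight D (greedyColor D q) t := h2
      _ ≤ (1 + 1 / (q : ℝ)) * ((D : ℝ) ^ 2 * (1 + 1 / q) ^ t) := by gcongr
      _ = _ := by ring

/-- The number of rows of the greedy table which are used as a splitter. -/
def splitterSize (D q : ℕ) : ℕ := 4 * q * Nat.clog 2 D

theorem two_mul_card_pairs_le (S : Finset ℕ) :
    2 * ((S ×ˢ S).filter fun z => z.2 < z.1).card ≤ S.card ^ 2 := by
  have h1 : ((S ×ˢ S).filter fun z => z.2 < z.1).card =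
      ((S ×ˢ S).filter fun z => z.1 < z.2).card := by
    refine Finset.card_bij (fun z _ => z.swap) ?_ ?_ ?_
    · simp only [Finset.mem_filter, Finset.mem_product, Prod.fst_swap, Prod.snd_swap]; tauto
    · intro a _ b _ h; exact Prod.swap_injective h
    · intro z hz
      refine ⟨z.swap, ?_, z.swap_swap⟩
      simp only [Finset.mem_filter, Finset.mem_product, Prod.fst_swap, Prod.snd_swap] at hz ⊢
      tauto
  have h2 : Disjoint ((S ×ˢ S).filter fun z => z.2 < z.1)
      ((S ×ˢ S).filter fun z => z.1 < z.2) :=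
    Finset.disjoint_filter.2 fun z _ h => by omega
  calc _ = (((S ×ˢ S).filter fun z => z.2 < z.1) ∪
        ((S ×ˢ S).filter fun z => z.1 < z.2)).card := by
        rw [Finset.card_union_of_disjoint h2, ← h1, two_mul]
    _ ≤ (S ×ˢ S).card := Finset.card_le_card
        (Finset.union_subset (Finset.filter_subset _ _) (Finset.filter_subset _ _))
    _ = _ := by rw [Finset.card_product, sq]

/-- If no row were injective on `S`, some pair of columns in `S` would collide in a proportion
`2 / k ^ 2` of all rows, and have a larger weight than the total weight can be. -/
theorem exists_injOn_greedyColor {D k : ℕ} (hD : 2 ≤ D) (hk : 0 < k) {S : Finset ℕ}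
    (hSD : ∀ x ∈ S, x < D) (hS : S.card = k) :
    ∃ t < splitterSize D (k ^ 2),
      Set.InjOn (fun x => greedyColor D (k ^ 2) (t * D + x)) S := by
  by_contra! hno
  set q := k ^ 2 with hq
  set L := splitterSize D q with hL
  set F := greedyColor D q with hF
  have hq0 : 0 < q := by positivity
  set Z := (S ×ˢ S).filter fun z => z.2 < z.1 with hZ
  have hZq : 2 * Z.card ≤ q := by rw [hq, ← hS]; exact two_mul_card_pairs_le S
  have hcl : 0 < Nat.clog 2 D := Nat.clog_pos (by norm_num) hD
  have hL0 : 0 < L := by rw [hL, splitterSize]; positivity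
  have hpair : ∀ t ∈ Finset.range L, 1 ≤ (Z.filter fun z =>
      F (t * D + z.1) = F (t * D + z.2)).card := by
    intro t ht
    have := hno t (Finset.mem_range.1 ht)
    simp only [Set.InjOn, Finset.mem_coe] at this
    push Not at this
    obtain ⟨x, hx, y, hy, hxy, hne⟩ := this
    rw [Nat.succ_le_iff, Finset.card_pos]
    rcases lt_or_gt_of_ne hne with h | h
    · exact ⟨(y, x), by simp only [hZ, Finset.mem_filter, Finset.mem_product]
                        exact ⟨⟨⟨hy, hx⟩, h⟩, hxy.symm⟩⟩
    · exact ⟨(x, y), by simp only [hZ, Finset.mem_filter, Finset.mem_product]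
                        exact ⟨⟨⟨hx, hy⟩, h⟩, hxy⟩⟩
  have hsum : L ≤ ∑ z ∈ Z, collisions D F L z.1 z.2 := by
    calc L = ∑ t ∈ Finset.range L, 1 := by simp
      _ ≤ ∑ t ∈ Finset.range L, (Z.filter fun z => F (t * D + z.1) = F (t * D + z.2)).card :=
          Finset.sum_le_sum hpair
      _ = _ := Finset.sum_card_bipartiteAbove_eq_sum_card_bipartiteBelow
          (r := fun (t : ℕ) (z : ℕ × ℕ) => F (t * D + z.1) = F (t * D + z.2))
  have hW : ∀ z ∈ Z, 2 ^ collisions D F L z.1 z.2 ≤ totalWeight D F L := by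
    intro z hz
    simp only [hZ, Finset.mem_filter, Finset.mem_product] at hz
    unfold totalWeight
    refine le_trans ?_ (Finset.single_le_sum (f := fun x => ∑ y ∈ Finset.range x,
      2 ^ collisions D F L x y) (fun _ _ => Nat.zero_le _)
      (Finset.mem_range.2 (hSD _ hz.1.1)))
    exact Finset.single_le_sum (f := fun y => 2 ^ collisions D F L z.1 y)
      (fun _ _ => Nat.zero_le _) (Finset.mem_range.2 hz.2)
  have h2L : 2 ^ L ≤ totalWeight D F L ^ Z.card := by
    calc 2 ^ L ≤ 2 ^ ∑ z ∈ Z, collisions D F L z.1 z.2 :=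
          Nat.pow_le_pow_right (by norm_num) hsum
      _ = ∏ z ∈ Z, 2 ^ collisions D F L z.1 z.2 := (Finset.prod_pow_eq_pow_sum _ _ _).symm
      _ ≤ ∏ z ∈ Z, totalWeight D F L := Finset.prod_le_prod' hW
      _ = _ := by simp
  have hq' : (0 : ℝ) < q := by exact_mod_cast hq0
  have hexp : (1 + 1 / (q : ℝ)) ≤ Real.exp (1 / q) := by
    linarith [Real.add_one_le_exp (1 / (q : ℝ))]
  have hDc : (D : ℝ) ≤ 2 ^ Nat.clog 2 D := by exact_mod_cast Nat.le_pow_clog (by norm_num) D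
  set c := Nat.clog 2 D with hc
  -- `D ^ 2 ≤ 2 ^ (2c)`, and the `4 q c` rows contribute a factor of at most `exp (4c)`
  have hWL : (totalWeight D F L : ℝ) ≤ (2 * Real.exp 2) ^ (2 * c) := by
    calc (totalWeight D F L : ℝ) ≤ (D : ℝ) ^ 2 * (1 + 1 / q) ^ L := totalWeight_le hq0 L
      _ ≤ (2 ^ c) ^ 2 * (Real.exp (1 / q)) ^ L := by gcongr
      _ = 2 ^ (2 * c) * Real.exp (4 * c) := by
          rw [← pow_mul, mul_comm c 2, ← Real.exp_nat_mul]
          congr 2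
          rw [hL, splitterSize, ← hc]
          push_cast
          field_simp
      _ = _ := by
          rw [mul_pow, ← Real.exp_nat_mul]
          congr 2
          push_cast
          ring
  have h1le : (1 : ℝ) ≤ 2 * Real.exp 2 := by
    have := Real.add_one_le_exp (2 : ℝ); linarith
  have hfin : (16 : ℝ) ^ (q * c) ≤ (2 * Real.exp 2) ^ (q * c) := by
    calc (16 : ℝ) ^ (q * c) = 2 ^ L := by
          rw [hL, splitterSize, ← hc, show (16 : ℝ) = 2 ^ 4 by norm_num, ← pow_mul]
          congr 1; ring
      _ ≤ (totalWeight D F L : ℝ) ^ Z.card := by exact_mod_cast h2L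
      _ ≤ ((2 * Real.exp 2) ^ (2 * c)) ^ Z.card := by gcongr
      _ = (2 * Real.exp 2) ^ (2 * Z.card * c) := by rw [← pow_mul]; congr 1; ring
      _ ≤ _ := pow_le_pow_right₀ h1le (Nat.mul_le_mul_right c hZq)
  have hlt : 2 * Real.exp 2 < 16 := by
    have h := Real.exp_one_lt_d9
    have : Real.exp 2 = Real.exp 1 * Real.exp 1 := by rw [← Real.exp_add]; norm_num
    rw [this]
    nlinarith [Real.exp_pos 1]
  exact absurd hfin (not_le.2 (pow_lt_pow_left₀ hlt (by positivity) (by positivity)))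

/-- The rows of the greedy table as a set of maps. -/
def greedySplitter (D q : ℕ) (hq : 0 < q) : Finset (Fin D → Fin q) :=
  (Finset.range (splitterSize D q)).image fun t x =>
    ⟨greedyColor D q (t * D + x), greedyColor_lt hq _⟩

theorem isSplitter_greedySplitter {D k : ℕ} (hD : 2 ≤ D) (hk : 0 < k ^ 2) :
    IsSplitter k (greedySplitter D (k ^ 2) hk) := by
  intro S hS
  have hk' : 0 < k := Nat.pos_of_ne_zero (by rintro rfl; simp at hk)
  obtain ⟨t, ht, hinj⟩ := exists_injOn_greedyColor hD hk' (S := S.map Fin.valEmbedding)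
    (by simp) (by simpa using hS)
  refine ⟨_, Finset.mem_image_of_mem _ (Finset.mem_range.2 ht), fun i j => ?_⟩
  refine le_trans (Finset.card_le_one.2 fun x hx y hy => ?_) (Nat.le_add_left _ _)
  simp only [Finset.mem_filter] at hx hy
  refine Fin.ext (hinj (Finset.mem_coe.2 (Finset.mem_map_of_mem Fin.valEmbedding hx.1))
    (Finset.mem_coe.2 (Finset.mem_map_of_mem Fin.valEmbedding hy.1)) ?_)
  exact congrArg Fin.val (hx.2.trans hy.2.symm)

theorem card_greedySplitter_le {D q : ℕ} (hD : 2 ≤ D) (hq : 0 < q) :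
    ((greedySplitter D q hq).card : ℝ) ≤ 12 * q * Real.log D := by
  have h1 : (greedySplitter D q hq).card ≤ splitterSize D q :=
    Finset.card_image_le.trans_eq (by simp)
  have hD' : (2 : ℝ) ≤ D := by exact_mod_cast hD
  have hlog2 := Real.log_two_gt_d9
  have hlogD : Real.log 2 ≤ Real.log D := Real.log_le_log (by norm_num) hD'
  have h2 : (Nat.clog 2 D : ℝ) ≤ 3 * Real.log D := by
    have h3 : 2 ^ (Nat.clog 2 D - 1) < D := Nat.pow_pred_clog_lt_self (by norm_num) hD
    have hcl : 0 < Nat.clog 2 D := Nat.clog_pos (by norm_num) hD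
    obtain ⟨r, hr⟩ : ∃ r, Nat.clog 2 D = r + 1 := ⟨Nat.clog 2 D - 1, by omega⟩
    rw [hr, Nat.add_sub_cancel] at h3
    have h4 : (r : ℝ) * Real.log 2 ≤ Real.log D := by
      rw [← Real.log_pow]
      exact Real.log_le_log (by positivity) (by exact_mod_cast h3.le)
    rw [hr]
    push_cast
    have hr0 : (0 : ℝ) ≤ r := by positivity
    nlinarith
  calc ((greedySplitter D q hq).card : ℝ) ≤ (splitterSize D q : ℝ) := by exact_mod_cast h1
    _ = 4 * q * Nat.clog 2 D := by rw [splitterSize]; push_cast; ring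
    _ ≤ 4 * q * (3 * Real.log D) := by gcongr
    _ = _ := by ring

/-! ### The exhaustive search as a primitive recursive function -/

section codes

/-- The digit number `i` of `X` in base `β`. -/
def digit (β X i : ℕ) : ℕ := X / β ^ i % β

/-- The base in which pairs of a `k`-subset of the coordinates and a restriction set are coded. -/
def codeBase (m k : ℕ) : ℕ := 2 ^ m + k ^ 2

/-- The number of codes, which have `3 k` digits: `s`, `p` and the elements of the `k`-subset. -/
def numCodes (m k : ℕ) : ℕ := codeBase m k ^ (3 * k)

/-- The number of vectors in dimension `k ^ 2` over `2 ^ m - 1` values. -/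
def numVectors (m k : ℕ) : ℕ := (2 ^ m - 1) ^ k ^ 2

/-- The product of `s_i + 1` over the first `k` digits `s_i` of `R`. -/
def prodDigits (β R k : ℕ) : ℕ :=
  Nat.rec 1 (fun i acc => acc * (digit β R i + 1)) k

/-- `R` codes an increasing enumeration of a `k`-subset and an admissible index. -/
def IsCode (m k R : ℕ) : Prop :=
  (∀ i < k, (1 ≤ digit (codeBase m k) R i ∧ 1 ≤ digit (codeBase m k) R (k + i)) ∧
    (digit (codeBase m k) R i + digit (codeBase m k) R (k + i) ≤ 2 ^ m ∧
      digit (codeBase m k) R (2 * k + i) < k ^ 2) ∧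
    ∀ j < i, digit (codeBase m k) R (2 * k + j) < digit (codeBase m k) R (2 * k + i)) ∧
  (2 ^ m) ^ k < 2 ^ m * prodDigits (codeBase m k) R k

/-- The vector with code `X` satisfies the restriction with code `R`. -/
def CodeSat (m k X R : ℕ) : Prop :=
  ∀ i < k, digit (codeBase m k) R (k + i) ≤
      digit (2 ^ m - 1) X (digit (codeBase m k) R (2 * k + i)) + 1 ∧
    digit (2 ^ m - 1) X (digit (codeBase m k) R (2 * k + i)) + 2 ≤
      digit (codeBase m k) R (k + i) + digit (codeBase m k) R i

/-- `R` codes a restriction that is violated by all members of `T`. -/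
def OpenCode (m k : ℕ) (T : List ℕ) (R : ℕ) : Prop :=
  IsCode m k R ∧ ∀ X ∈ T, ¬ CodeSat m k X R

open Classical in
/-- The number of codes below `N` of restrictions which are violated by `T` and satisfied
by `X`. -/
def codeGain (m k : ℕ) (T : List ℕ) (X N : ℕ) : ℕ :=
  Nat.rec 0 (fun R acc => if OpenCode m k T R ∧ CodeSat m k X R then acc + 1 else acc) N

open Classical in
/-- The code of a vector which satisfies the largest number of the restrictions violated by `T`. -/
def bestCode (m k : ℕ) (T : List ℕ) : ℕ :=
  Nat.findGreatest (fun X => X < numVectors m k ∧ ∀ Y < numVectors m k,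
    codeGain m k T Y (numCodes m k) ≤ codeGain m k T X (numCodes m k)) (numVectors m k)

open Classical in
/-- One step of the search. -/
def searchStep (m k : ℕ) (T : List ℕ) : List ℕ :=
  if ∃ R < numCodes m k, OpenCode m k T R then T ++ [bestCode m k T] else T

/-- The codes of the vectors found by exhaustive search. The number of steps is more than
sufficient, because the list does not change any more when it solves the restriction problem. -/
def search (m k : ℕ) : List ℕ := (searchStep m k)^[numCodes m k] []

end codes

section primrec
variable {α β : Type*} [Primcodable α] [Primcodable β]

theorem primrecPred_forall_mem {f : α → List β} {P : α → β → Prop} (hf : Primrec f)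
    (hP : PrimrecPred fun z : α × β => P z.1 z.2) : PrimrecPred fun a => ∀ x ∈ f a, P a x :=
  (PrimrecRel.forall_mem_list (R := fun x a => P a x)
    (hP.comp (Primrec.pair Primrec.snd Primrec.fst))).comp hf Primrec.id

theorem primrecPred_forall_lt {f : α → ℕ} {P : α → ℕ → Prop} (hf : Primrec f)
    (hP : PrimrecPred fun z : α × ℕ => P z.1 z.2) : PrimrecPred fun a => ∀ x < f a, P a x :=
  (primrecPred_forall_mem (Primrec.list_range.comp hf) hP).of_eq fun a => by simp

theorem primrecPred_exists_lt {f : α → ℕ} {P : α → ℕ → Prop} (hf : Primrec f)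
    (hP : PrimrecPred fun z : α × ℕ => P z.1 z.2) : PrimrecPred fun a => ∃ x < f a, P a x :=
  (primrecPred_forall_lt (P := fun a x => ¬ P a x) hf hP.not).not.of_eq fun a => by simp

theorem primrec_pow {f g : α → ℕ} (hf : Primrec f) (hg : Primrec g) :
    Primrec fun a => f a ^ g a :=
  (Primrec.nat_rec' (h := fun a z => z.2 * f a) hg (Primrec.const 1)
    (Primrec.nat_mul.comp (Primrec.snd.comp Primrec.snd) (hf.comp Primrec.fst)).to₂).of_eq
    fun a => by
      induction g a with
      | zero => rfl
      | succ n ih => rw [pow_succ, ← ih]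

theorem primrec_digit {f g h : α → ℕ} (hf : Primrec f) (hg : Primrec g) (hh : Primrec h) :
    Primrec fun a => digit (f a) (g a) (h a) :=
  Primrec.nat_mod.comp (Primrec.nat_div.comp hg (primrec_pow hf hh)) hf

variable {m k R X : α → ℕ} {T : α → List ℕ}

theorem primrec_two_pow (hm : Primrec m) : Primrec fun a => 2 ^ m a :=
  primrec_pow (Primrec.const 2) hm

theorem primrec_sq (hk : Primrec k) : Primrec fun a => k a ^ 2 :=
  primrec_pow hk (Primrec.const 2)

theorem primrec_codeBase (hm : Primrec m) (hk : Primrec k) :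
    Primrec fun a => codeBase (m a) (k a) :=
  Primrec.nat_add.comp (primrec_two_pow hm) (primrec_sq hk)

theorem primrec_numCodes (hm : Primrec m) (hk : Primrec k) :
    Primrec fun a => numCodes (m a) (k a) :=
  primrec_pow (primrec_codeBase hm hk) (Primrec.nat_mul.comp (Primrec.const 3) hk)

theorem primrec_numVectors (hm : Primrec m) (hk : Primrec k) :
    Primrec fun a => numVectors (m a) (k a) :=
  primrec_pow (Primrec.nat_sub.comp (primrec_two_pow hm) (Primrec.const 1)) (primrec_sq hk)

theorem primrec_prodDigits {f g h : α → ℕ} (hf : Primrec f) (hg : Primrec g) (hh : Primrec h) :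
    Primrec fun a => prodDigits (f a) (g a) (h a) :=
  Primrec.nat_rec' (h := fun a z => z.2 * (digit (f a) (g a) z.1 + 1)) hh (Primrec.const 1)
    (Primrec.nat_mul.comp (Primrec.snd.comp Primrec.snd)
      (Primrec.succ.comp (primrec_digit (hf.comp Primrec.fst) (hg.comp Primrec.fst)
        (Primrec.fst.comp Primrec.snd)))).to₂

theorem primrecPred_isCode (hm : Primrec m) (hk : Primrec k) (hR : Primrec R) :
    PrimrecPred fun a => IsCode (m a) (k a) (R a) := by
  have hm' : Primrec fun z : α × ℕ => m z.1 := hm.comp Primrec.fst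
  have hk' : Primrec fun z : α × ℕ => k z.1 := hk.comp Primrec.fst
  have hR' : Primrec fun z : α × ℕ => R z.1 := hR.comp Primrec.fst
  have hb := primrec_codeBase hm' hk'
  have hs := primrec_digit hb hR' Primrec.snd
  have hp := primrec_digit hb hR' (Primrec.nat_add.comp hk' Primrec.snd)
  have h2k : Primrec fun z : α × ℕ => 2 * k z.1 := Primrec.nat_mul.comp (Primrec.const 2) hk'
  have he := primrec_digit hb hR' (Primrec.nat_add.comp h2k Primrec.snd)
  refine PrimrecPred.and (primrecPred_forall_lt hk (PrimrecPred.and (PrimrecPred.and ?_ ?_)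
    (PrimrecPred.and (PrimrecPred.and ?_ ?_) (primrecPred_forall_lt Primrec.snd ?_)))) ?_
  · exact Primrec.nat_le.comp (Primrec.const 1) hs
  · exact Primrec.nat_le.comp (Primrec.const 1) hp
  · exact Primrec.nat_le.comp (Primrec.nat_add.comp hs hp) (primrec_two_pow hm')
  · exact Primrec.nat_lt.comp he (primrec_sq hk')
  · exact Primrec.nat_lt.comp
      (primrec_digit (hb.comp Primrec.fst) (hR'.comp Primrec.fst)
        (Primrec.nat_add.comp (h2k.comp Primrec.fst) Primrec.snd)) (he.comp Primrec.fst)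
  · exact Primrec.nat_lt.comp (primrec_pow (primrec_two_pow hm) hk)
      (Primrec.nat_mul.comp (primrec_two_pow hm)
        (primrec_prodDigits (primrec_codeBase hm hk) hR hk))

theorem primrecPred_codeSat (hm : Primrec m) (hk : Primrec k) (hX : Primrec X)
    (hR : Primrec R) : PrimrecPred fun a => CodeSat (m a) (k a) (X a) (R a) := by
  have hm' : Primrec fun z : α × ℕ => m z.1 := hm.comp Primrec.fst
  have hk' : Primrec fun z : α × ℕ => k z.1 := hk.comp Primrec.fst
  have hR' : Primrec fun z : α × ℕ => R z.1 := hR.comp Primrec.fst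
  have hX' : Primrec fun z : α × ℕ => X z.1 := hX.comp Primrec.fst
  have hb := primrec_codeBase hm' hk'
  have hs := primrec_digit hb hR' Primrec.snd
  have hp := primrec_digit hb hR' (Primrec.nat_add.comp hk' Primrec.snd)
  have he := primrec_digit hb hR'
    (Primrec.nat_add.comp (Primrec.nat_mul.comp (Primrec.const 2) hk') Primrec.snd)
  have hx := primrec_digit
    (Primrec.nat_sub.comp (primrec_two_pow hm') (Primrec.const 1)) hX' he
  refine primrecPred_forall_lt hk (PrimrecPred.and ?_ ?_)
  · exact Primrec.nat_le.comp hp (Primrec.nat_add.comp hx (Primrec.const 1))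
  · exact Primrec.nat_le.comp (Primrec.nat_add.comp hx (Primrec.const 2))
      (Primrec.nat_add.comp hp hs)

theorem primrecPred_openCode (hm : Primrec m) (hk : Primrec k) (hT : Primrec T)
    (hR : Primrec R) : PrimrecPred fun a => OpenCode (m a) (k a) (T a) (R a) :=
  PrimrecPred.and (primrecPred_isCode hm hk hR)
    (primrecPred_forall_mem hT (primrecPred_codeSat (hm.comp Primrec.fst) (hk.comp Primrec.fst)
      Primrec.snd (hR.comp Primrec.fst)).not)

open Classical in
theorem primrec_codeGain {N : α → ℕ} (hm : Primrec m) (hk : Primrec k) (hT : Primrec T)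
    (hX : Primrec X) (hN : Primrec N) :
    Primrec fun a => codeGain (m a) (k a) (T a) (X a) (N a) := by
  refine Primrec.nat_rec' (h := fun a z => if OpenCode (m a) (k a) (T a) z.1 ∧
    CodeSat (m a) (k a) (X a) z.1 then z.2 + 1 else z.2) hN (Primrec.const 0) ?_
  have hz : Primrec fun z : α × ℕ × ℕ => z.2.1 := Primrec.fst.comp Primrec.snd
  have hz' : Primrec fun z : α × ℕ × ℕ => z.2.2 := Primrec.snd.comp Primrec.snd
  exact (Primrec.ite (PrimrecPred.and
    (primrecPred_openCode (hm.comp Primrec.fst) (hk.comp Primrec.fst) (hT.comp Primrec.fst) hz)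
    (primrecPred_codeSat (hm.comp Primrec.fst) (hk.comp Primrec.fst) (hX.comp Primrec.fst) hz))
    (Primrec.succ.comp hz') hz').to₂

open Classical in
theorem primrec_bestCode (hm : Primrec m) (hk : Primrec k) (hT : Primrec T) :
    Primrec fun a => bestCode (m a) (k a) (T a) := by
  have hm' : Primrec fun z : α × ℕ => m z.1 := hm.comp Primrec.fst
  have hk' : Primrec fun z : α × ℕ => k z.1 := hk.comp Primrec.fst
  have hT' : Primrec fun z : α × ℕ => T z.1 := hT.comp Primrec.fst
  have hN := primrec_numVectors hm' hk'
  have hC := primrec_numCodes hm' hk'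
  refine Primrec.nat_findGreatest (p := fun a X => X < numVectors (m a) (k a) ∧
    ∀ Y < numVectors (m a) (k a), codeGain (m a) (k a) (T a) Y (numCodes (m a) (k a)) ≤
      codeGain (m a) (k a) (T a) X (numCodes (m a) (k a))) (primrec_numVectors hm hk)
    (PrimrecPred.and (Primrec.nat_lt.comp Primrec.snd hN) (primrecPred_forall_lt hN ?_))
  exact Primrec.nat_le.comp
    (primrec_codeGain (hm'.comp Primrec.fst) (hk'.comp Primrec.fst) (hT'.comp Primrec.fst)
      Primrec.snd (hC.comp Primrec.fst))
    (primrec_codeGain (hm'.comp Primrec.fst) (hk'.comp Primrec.fst) (hT'.comp Primrec.fst)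
      (Primrec.snd.comp Primrec.fst) (hC.comp Primrec.fst))

open Classical in
theorem primrec_searchStep (hm : Primrec m) (hk : Primrec k) (hT : Primrec T) :
    Primrec fun a => searchStep (m a) (k a) (T a) := by
  refine Primrec.ite (primrecPred_exists_lt (primrec_numCodes hm hk)
    (primrecPred_openCode (hm.comp Primrec.fst) (hk.comp Primrec.fst) (hT.comp Primrec.fst)
      Primrec.snd)) ?_ hT
  exact Primrec.list_concat.comp hT (primrec_bestCode hm hk hT)

theorem primrec_search (hm : Primrec m) (hk : Primrec k) :
    Primrec fun a => search (m a) (k a) :=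
  Primrec.nat_iterate (primrec_numCodes hm hk) (Primrec.const [])
    (primrec_searchStep (hm.comp Primrec.fst) (hk.comp Primrec.fst) Primrec.snd).to₂

end primrec

/-! ### Correctness of the search -/

theorem digit_lt {β : ℕ} (hβ : 0 < β) (X i : ℕ) : digit β X i < β := Nat.mod_lt _ hβ

theorem exists_digit_eq (β N : ℕ) (f : ℕ → ℕ) (hf : ∀ i < N, f i < β) :
    ∃ X < β ^ N, ∀ i < N, digit β X i = f i := by
  let g : Fin N → Fin β := fun i => ⟨f i, hf i i.2⟩
  refine ⟨finFunctionFinEquiv g, (finFunctionFinEquiv g).2, fun i hi => ?_⟩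
  have := congrArg Fin.val (congrFun (finFunctionFinEquiv.symm_apply_apply g) ⟨i, hi⟩)
  rw [finFunctionFinEquiv_symm_apply_val] at this
  exact this

theorem eq_of_digit_eq {β N X Y : ℕ} (hX : X < β ^ N) (hY : Y < β ^ N)
    (h : ∀ i < N, digit β X i = digit β Y i) : X = Y := by
  have : finFunctionFinEquiv.symm (⟨X, hX⟩ : Fin (β ^ N)) =
      finFunctionFinEquiv.symm (⟨Y, hY⟩ : Fin (β ^ N)) := by
    funext i
    apply Fin.ext
    simpa [digit, finFunctionFinEquiv_symm_apply_val] using h i i.2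
  simpa using finFunctionFinEquiv.symm.injective this

/-- The vector with code `X`. -/
def decodeVector {m : ℕ} (hb : 0 < 2 ^ m - 1) (n X : ℕ) : Fin n → Fin (2 ^ m - 1) :=
  fun j => ⟨digit (2 ^ m - 1) X j, digit_lt hb _ _⟩

theorem exists_decodeVector_eq {m : ℕ} (hb : 0 < 2 ^ m - 1) {n : ℕ} (x : Fin n → Fin (2 ^ m - 1)) :
    ∃ X < (2 ^ m - 1) ^ n, decodeVector hb n X = x := by
  obtain ⟨X, hX, h⟩ := exists_digit_eq (2 ^ m - 1) n
    (fun i => if h : i < n then x ⟨i, h⟩ else 0) fun i hi => by simp [hi]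
  refine ⟨X, hX, funext fun i => Fin.ext ?_⟩
  simp [decodeVector, h i i.2]

theorem prodDigits_eq (β R k : ℕ) : prodDigits β R k = ∏ i : Fin k, (digit β R i + 1) := by
  induction k with
  | zero => simp [prodDigits]
  | succ k ih =>
    rw [Fin.prod_univ_castSucc]
    simp only [Fin.val_castSucc, Fin.val_last]
    rw [← ih]
    rfl

/-- The coordinates selected by a code. -/
def IsCode.embedding {m k R : ℕ} (h : IsCode m k R) : Fin k ↪o Fin (k ^ 2) :=
  OrderEmbedding.ofStrictMono
    (fun i => ⟨digit (codeBase m k) R (2 * k + i), (h.1 i i.2).2.1.2⟩)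
    fun i j hij => (h.1 j j.2).2.2 i hij

/-- The restriction set of a code. -/
def codeSet (m k R : ℕ) : Set (Fin k → Fin (2 ^ m - 1)) :=
  coreVectors m (fun i => digit (codeBase m k) R i) fun i => digit (codeBase m k) R (k + i)

theorem IsCode.admissible {m k R : ℕ} (h : IsCode m k R) :
    AdmissibleIndex m (fun i : Fin k => digit (codeBase m k) R i)
      fun i => digit (codeBase m k) R (k + i) :=
  ⟨fun i => ⟨(h.1 i i.2).1.1, (h.1 i i.2).1.2, (h.1 i i.2).2.1.1⟩,
    by rw [← prodDigits_eq]; exact h.2⟩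

theorem IsCode.codeSat_iff {m k R : ℕ} (h : IsCode m k R) (hb : 0 < 2 ^ m - 1) (X : ℕ) :
    CodeSat m k X R ↔ (fun i => decodeVector hb (k ^ 2) X (h.embedding i)) ∈ codeSet m k R := by
  constructor
  · exact fun hX i => hX i i.2
  · exact fun hX i hi => hX ⟨i, hi⟩

open Classical in
/-- Codes are in bijection with the pairs of a `k`-subset and a restriction set. -/
theorem ncard_eq_card_codes {m k : ℕ}
    (Φ : (Fin k ↪o Fin (k ^ 2)) × Set (Fin k → Fin (2 ^ m - 1)) → Prop) (φ : ℕ → Prop)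
    (h : ∀ R (hR : IsCode m k R), φ R ↔ Φ (hR.embedding, codeSet m k R)) :
    ((Finset.range (numCodes m k)).filter fun R => IsCode m k R ∧ φ R).card =
      {q | q.2 ∈ boxRestrictions m k ∧ Φ q}.ncard := by
  rw [← Set.ncard_coe_finset]
  have hmem : ∀ R, R ∈ (((Finset.range (numCodes m k)).filter fun R => IsCode m k R ∧ φ R :
      Finset ℕ) : Set ℕ) ↔ R < numCodes m k ∧ IsCode m k R ∧ φ R := fun R => by simp
  refine Set.ncard_congr (fun R hR => (((hmem R).1 hR).2.1.embedding, codeSet m k R)) ?_ ?_ ?_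
  · intro R hR
    obtain ⟨-, hR1, hR2⟩ := (hmem R).1 hR
    exact ⟨mem_boxRestrictions.2 ⟨_, _, hR1.admissible, rfl⟩, (h R hR1).1 hR2⟩
  · intro R R' hR hR' he
    obtain ⟨hlt, hR1, -⟩ := (hmem R).1 hR
    obtain ⟨hlt', hR1', -⟩ := (hmem R').1 hR'
    obtain ⟨he1, he2⟩ := Prod.ext_iff.1 he
    obtain ⟨hs, hp⟩ := hR1.admissible.coreVectors_injective hR1'.admissible he2
    refine eq_of_digit_eq hlt hlt' fun i hi => ?_
    rcases lt_or_ge i k with h1 | h1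
    · exact congrFun hs ⟨i, h1⟩
    rcases lt_or_ge i (2 * k) with h2 | h2
    · have := congrFun hp ⟨i - k, by omega⟩
      simpa [show k + (i - k) = i by omega] using this
    · have := congrArg Fin.val (DFunLike.congr_fun he1 ⟨i - 2 * k, by omega⟩)
      change digit _ R (2 * k + (i - 2 * k)) = digit _ R' (2 * k + (i - 2 * k)) at this
      rwa [show 2 * k + (i - 2 * k) = i by omega] at this
  · rintro ⟨e, C⟩ ⟨hC, hΦ⟩
    obtain ⟨s, p, hsp, rfl⟩ := mem_boxRestrictions.1 hC
    let f : ℕ → ℕ := fun i =>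
      if h : i < k then s ⟨i, h⟩ else if h : i - k < k then p ⟨i - k, h⟩
        else if h : i - 2 * k < k then e ⟨i - 2 * k, h⟩ else 0
    have hf : ∀ i < 3 * k, f i < codeBase m k := by
      intro i hi
      have hM : 0 < 2 ^ m := by positivity
      simp only [f, codeBase]
      split_ifs with h1 h2 h3
      · have := hsp.1 ⟨i, h1⟩; omega
      · have := hsp.1 ⟨i - k, h2⟩; omega
      · have := (e ⟨i - 2 * k, h3⟩).isLt; omega
      · omega
    obtain ⟨R, hR, hdig⟩ := exists_digit_eq (codeBase m k) (3 * k) f hf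
    have hds : ∀ i : Fin k, digit (codeBase m k) R i = s i := fun i => by
      rw [hdig _ (by omega)]; simp [f]
    have hdp : ∀ i : Fin k, digit (codeBase m k) R (k + i) = p i := fun i => by
      rw [hdig _ (by omega)]; simp [f]
    have hde : ∀ i : Fin k, digit (codeBase m k) R (2 * k + i) = e i := fun i => by
      rw [hdig _ (by omega)]
      simp only [f]
      rw [dif_neg (by omega), dif_neg (by omega), dif_pos (by omega)]
      simp
    have hcode : IsCode m k R := by
      refine ⟨fun i hi => ?_, ?_⟩
      · have h1 := hds ⟨i, hi⟩
        have h2 := hdp ⟨i, hi⟩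
        have h3 := hde ⟨i, hi⟩
        simp only at h1 h2 h3
        rw [h1, h2, h3]
        have := hsp.1 ⟨i, hi⟩
        refine ⟨⟨this.1, this.2.1⟩, ⟨this.2.2, (e ⟨i, hi⟩).isLt⟩, fun j hj => ?_⟩
        have h4 := hde ⟨j, by omega⟩
        simp only at h4
        rw [h4]
        exact e.strictMono (show (⟨j, by omega⟩ : Fin k) < ⟨i, hi⟩ from hj)
      · rw [prodDigits_eq]
        simp only [hds]
        exact hsp.2
    have hset : codeSet m k R = coreVectors m s p := by
      unfold codeSet
      simp only [hds, hdp]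
    have hemb : hcode.embedding = e := by
      ext i
      exact hde i
    exact ⟨R, (hmem R).2 ⟨hR, hcode, (h R hcode).2 (by rw [hset, hemb]; exact hΦ)⟩,
      Prod.ext hemb hset⟩

open Classical in
theorem codeGain_eq_card (m k : ℕ) (T : List ℕ) (X N : ℕ) :
    codeGain m k T X N =
      ((Finset.range N).filter fun R => OpenCode m k T R ∧ CodeSat m k X R).card := by
  induction N with
  | zero => rfl
  | succ N ih =>
    rw [Finset.range_add_one, Finset.filter_insert]
    have : codeGain m k T X (N + 1) = if OpenCode m k T N ∧ CodeSat m k X N then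
      codeGain m k T X N + 1 else codeGain m k T X N := rfl
    rw [this, ih]
    split_ifs with h
    · rw [Finset.card_insert_of_notMem (by simp)]
    · rfl

section correct
variable {m k : ℕ} (hb : 0 < 2 ^ m - 1)

theorem gain_decodeVector (T : List ℕ) (X : ℕ) :
    gain (boxRestrictions m k) (T.map (decodeVector hb (k ^ 2))) (decodeVector hb (k ^ 2) X) =
      codeGain m k T X (numCodes m k) := by
  classical
  rw [codeGain_eq_card]
  have := ncard_eq_card_codes (m := m) (k := k)
    (fun q => (∀ y ∈ T.map (decodeVector hb (k ^ 2)), (fun i => y (q.1 i)) ∉ q.2) ∧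
      (fun i => decodeVector hb (k ^ 2) X (q.1 i)) ∈ q.2)
    (fun R => (∀ X ∈ T, ¬ CodeSat m k X R) ∧ CodeSat m k X R)
    (fun R hR => by simp [hR.codeSat_iff hb])
  rw [gain, ← this]
  congr 1
  ext R
  simp only [Finset.mem_filter, OpenCode, and_assoc]

open Classical in
theorem ncard_outstanding_decodeVector (T : List ℕ) :
    (outstanding (boxRestrictions m k) (T.map (decodeVector hb (k ^ 2)))).ncard =
      ((Finset.range (numCodes m k)).filter fun R => OpenCode m k T R).card := by
  have := ncard_eq_card_codes (m := m) (k := k)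
    (fun q => ∀ y ∈ T.map (decodeVector hb (k ^ 2)), (fun i => y (q.1 i)) ∉ q.2)
    (fun R => ∀ X ∈ T, ¬ CodeSat m k X R) (fun R hR => by simp [hR.codeSat_iff hb])
  rw [outstanding, ← this]
  congr 1
  ext R
  simp only [Finset.mem_filter]
  rfl

theorem exists_openCode_iff (T : List ℕ) :
    (∃ R < numCodes m k, OpenCode m k T R) ↔
      (outstanding (boxRestrictions m k) (T.map (decodeVector hb (k ^ 2)))).Nonempty := by
  classical
  rw [← Set.ncard_pos (Set.toFinite _), ncard_outstanding_decodeVector, Finset.card_pos]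
  simp [Finset.Nonempty]

/-- The code found in each step is optimal among all vectors. -/
theorem gain_le_gain_bestCode (T : List ℕ) (x : Fin (k ^ 2) → Fin (2 ^ m - 1)) :
    gain (boxRestrictions m k) (T.map (decodeVector hb (k ^ 2))) x ≤
      gain (boxRestrictions m k) (T.map (decodeVector hb (k ^ 2)))
        (decodeVector hb (k ^ 2) (bestCode m k T)) := by
  classical
  obtain ⟨X, hX, rfl⟩ := exists_decodeVector_eq hb x
  rw [gain_decodeVector, gain_decodeVector]
  obtain ⟨Z, hZ, hmax⟩ := Finset.exists_max_image (Finset.range (numVectors m k))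
    (fun X => codeGain m k T X (numCodes m k)) ⟨X, Finset.mem_range.2 hX⟩
  have hZ' := Finset.mem_range.1 hZ
  exact (Nat.findGreatest_spec (P := fun X => X < numVectors m k ∧ ∀ Y < numVectors m k,
    codeGain m k T Y (numCodes m k) ≤ codeGain m k T X (numCodes m k)) hZ'.le
    ⟨hZ', fun Y hY => hmax Y (Finset.mem_range.2 hY)⟩).2 X hX

theorem FoundBySearch.append {b k n : ℕ} {𝒞 : Set (Set (Fin k → Fin b))}
    {Ω : Finset (Fin n → Fin b)} {T : List (Fin n → Fin b)} (h : FoundBySearch 𝒞 Ω T)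
    {x : Fin n → Fin b} (hx : x ∈ Ω) (hmax : ∀ y ∈ Ω, gain 𝒞 T y ≤ gain 𝒞 T x) :
    FoundBySearch 𝒞 Ω (T ++ [x]) := by
  intro i hi
  rw [List.length_append, List.length_singleton] at hi
  rcases Nat.lt_succ_iff_lt_or_eq.1 hi with h' | rfl
  · have := h i h'
    rw [List.getElem_append_left h', List.take_append_of_le_length h'.le]
    exact this
  · simpa using ⟨hx, hmax⟩

/-- The list of vectors after `j` steps of the search. -/
def searchVectors (k j : ℕ) : List (Fin (k ^ 2) → Fin (2 ^ m - 1)) :=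
  ((searchStep m k)^[j] []).map (decodeVector hb (k ^ 2))

theorem searchVectors_succ_of_nonempty {j : ℕ}
    (h : (outstanding (boxRestrictions m k) (searchVectors hb k j)).Nonempty) :
    searchVectors hb k (j + 1) = searchVectors hb k j ++
      [decodeVector hb (k ^ 2) (bestCode m k ((searchStep m k)^[j] []))] := by
  have h' := (exists_openCode_iff hb _).2 h
  rw [searchVectors, Function.iterate_succ_apply', searchStep, if_pos h', List.map_append]
  rfl

theorem searchVectors_succ_of_not_nonempty {j : ℕ}
    (h : ¬ (outstanding (boxRestrictions m k) (searchVectors hb k j)).Nonempty) :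
    searchVectors hb k (j + 1) = searchVectors hb k j := by
  have h' := mt (exists_openCode_iff hb _).1 h
  rw [searchVectors, Function.iterate_succ_apply', searchStep, if_neg h']
  rfl

/-- The list consists of best choices, and it grows only while restrictions are outstanding. -/
theorem foundBySearch_searchVectors (j : ℕ) :
    FoundBySearch (boxRestrictions m k) Finset.univ (searchVectors hb k j) ∧
      ∀ i < (searchVectors hb k j).length,
        (outstanding (boxRestrictions m k) ((searchVectors hb k j).take i)).Nonempty := by
  induction j with
  | zero =>
    constructor <;> intro i hi <;> simp [searchVectors] at hi
  | succ j ih =>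
    by_cases h : (outstanding (boxRestrictions m k) (searchVectors hb k j)).Nonempty
    · rw [searchVectors_succ_of_nonempty hb h]
      refine ⟨ih.1.append (Finset.mem_univ _) fun y _ => gain_le_gain_bestCode hb _ y,
        fun i hi => ?_⟩
      rw [List.length_append, List.length_singleton] at hi
      rw [List.take_append_of_le_length (by omega)]
      rcases Nat.lt_succ_iff_lt_or_eq.1 hi with h' | rfl
      · exact ih.2 i h'
      · rwa [List.take_length]
    · rw [searchVectors_succ_of_not_nonempty hb h]
      exact ih

/-- Each step of the search satisfies at least one outstanding restriction, by averaging over all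
vectors. -/
theorem ncard_outstanding_searchVectors (hm : 1 ≤ m) (j : ℕ) :
    outstanding (boxRestrictions m k) (searchVectors hb k j) = ∅ ∨
      (outstanding (boxRestrictions m k) (searchVectors hb k j)).ncard + j ≤ numCodes m k := by
  classical
  induction j with
  | zero =>
    right
    rw [searchVectors, ncard_outstanding_decodeVector, add_zero]
    exact (Finset.card_filter_le _ _).trans_eq (by simp)
  | succ j ih =>
    by_cases h : (outstanding (boxRestrictions m k) (searchVectors hb k j)).Nonempty
    · right
      have h1 := ih.resolve_left h.ne_empty
      have hpos := (Set.ncard_pos (Set.toFinite _)).2 h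
      have hgain := (isKWiseIndependent_univ (k := k) hb).minCard_mul_ncard_le
        (boxRestrictions m k) (searchVectors hb k j) fun y _ => gain_le_gain_bestCode hb _ y
      have hpos' := Nat.mul_pos (minCard_boxRestrictions hm k).1 hpos
      have hg := Nat.pos_of_mul_pos_right (hpos'.trans_le hgain)
      rw [searchVectors_succ_of_nonempty hb h]
      have := outstanding_append (boxRestrictions m k) (searchVectors hb k j)
        (decodeVector hb (k ^ 2) (bestCode m k ((searchStep m k)^[j] [])))
      change 0 < gain _ (searchVectors hb k j) _ at hg
      omega
    · left
      rw [searchVectors_succ_of_not_nonempty hb h]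
      exact Set.not_nonempty_iff_eq_empty.1 h

theorem solvesRestrictions_search (hm : 1 ≤ m) :
    SolvesRestrictions (boxRestrictions m k)
      {τ | τ ∈ (search m k).map (decodeVector hb (k ^ 2))} := by
  rw [solvesRestrictions_iff_outstanding]
  rcases ncard_outstanding_searchVectors hb (k := k) hm (numCodes m k) with h | h
  · exact h
  · exact (Set.ncard_eq_zero (Set.toFinite _)).1 (show _ = 0 by
      change (outstanding _ (searchVectors hb k (numCodes m k))).ncard = 0
      omega)

end correct

/-! ### The preparatory part of the program -/

namespace MachineProgram

/-- Natural number variable `1` becomes the exponent `m` and real variable `1` becomes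
`2 ^ (-m)`. -/
def findScale : MachineProgram :=
  seq (setReal 1 .one)
    (loop (.realLt (.var 0) (.var 1))
      (seq (setReal 1 (.half (.var 1))) (setNat 1 (.add (.var 1) (.const 1)))))

theorem findScale_spec {σ : MachineState} {m : ℕ} (h0 : σ.natVar 1 = 0)
    (h1 : 1 / 2 ^ m ≤ σ.realVar 0) (h2 : σ.realVar 0 < 2 / 2 ^ m) :
    RunsIn findScale σ (m * 20 + 20) fun σ' => σ'.natVar 1 = m ∧ σ'.realVar 1 = 1 / 2 ^ m := by
  apply RunsIn.mono
  · apply RunsIn.seq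
    apply RunsIn.setReal
    intro _
    apply RunsIn.loop (fun j τ => τ.natVar 1 = j ∧ τ.realVar 1 = 1 / 2 ^ j) m
    · simp [h0, RealExp.eval]
    · rintro j τ hf ⟨-, hj⟩
      have hε : τ.realVar 0 = σ.realVar 0 := by
        rw [hf.realVar 0 (by simp [WritesRealVar])]; simp
      simp only [MachineTest.Holds, RealExp.eval, hj, hε]
      constructor
      · intro h
        by_contra! hmj
        have : (1 : ℝ) / 2 ^ j ≤ 1 / 2 ^ m := by gcongr; norm_num
        linarith
      · intro h
        have : (2 : ℝ) / 2 ^ m ≤ 1 / 2 ^ j := by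
          rw [div_le_div_iff₀ (by positivity) (by positivity), one_mul, ← pow_succ']
          exact pow_le_pow_right₀ (by norm_num) h
        linarith
    · rintro j - τ hf ⟨hj1, hj2⟩
      apply RunsIn.seq
      apply RunsIn.setReal
      intro _
      apply RunsIn.setNat
      simp [RealExp.eval, NatExp.eval, hj1, hj2, pow_succ]
      ring
  · simp [RealExp.cost, NatExp.cost, MachineTest.cost]
    omega

/-- Natural number variable `2` becomes `⌊2 / ε⌋`, by adding up copies of `ε`. -/
def findFloor : MachineProgram :=
  seq (setReal 2 (.var 0))
    (seq (loop (.realLt (.var 2) (.add .one .one))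
      (seq (setReal 2 (.add (.var 2) (.var 0))) (setNat 2 (.add (.var 2) (.const 1)))))
      (ite (.realLt (.add .one .one) (.var 2)) skip (setNat 2 (.add (.var 2) (.const 1)))))

theorem findFloor_spec {σ : MachineState} {ε : ℝ} (h0 : σ.natVar 2 = 0)
    (hε : σ.realVar 0 = ε) (hpos : 0 < ε) :
    RunsIn findFloor σ ((⌈2 / ε⌉₊ - 1) * 20 + 30) fun σ' => σ'.natVar 2 = ⌊2 / ε⌋₊ := by
  have hc : 0 < ⌈2 / ε⌉₊ := Nat.ceil_pos.2 (by positivity)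
  apply RunsIn.mono
  · apply RunsIn.seq
    apply RunsIn.setReal
    intro _
    apply RunsIn.seq
    apply RunsIn.imp
    · apply RunsIn.loop (fun j τ => τ.natVar 2 = j ∧ τ.realVar 2 = (j + 1 : ℕ) * ε)
        (⌈2 / ε⌉₊ - 1)
      · simp [h0, RealExp.eval, hε]
      · rintro j τ hf ⟨-, hj⟩
        simp only [MachineTest.Holds, RealExp.eval, hj]
        rw [show (1 : ℝ) + 1 = 2 by norm_num, ← lt_div_iff₀ hpos, ← Nat.lt_ceil]
        omega
      · rintro j - τ hf ⟨hj1, hj2⟩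
        have hε' : τ.realVar 0 = ε := by
          rw [hf.realVar 0 (by simp [WritesRealVar])]; simpa using hε
        apply RunsIn.seq
        apply RunsIn.setReal
        intro _
        apply RunsIn.setNat
        simp [RealExp.eval, NatExp.eval, hj1, hj2, hε']
        ring
    · rintro τ hf ⟨hτ1, hτ2⟩ _
      rw [Nat.sub_add_cancel hc] at hτ2
      apply RunsIn.ite (B := 4)
      · intro hlt
        refine RunsIn.mono (RunsIn.skip ?_) (by norm_num)
        simp only [MachineTest.Holds, RealExp.eval, hτ2] at hlt
        rw [show (1 : ℝ) + 1 = 2 by norm_num, ← div_lt_iff₀ hpos] at hlt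
        rw [hτ1, eq_comm, Nat.floor_eq_iff (by positivity)]
        have h1 : ⌈2 / ε⌉₊ - 1 < ⌈2 / ε⌉₊ := by omega
        refine ⟨(Nat.lt_ceil.1 h1).le, ?_⟩
        have h2 : ((⌈2 / ε⌉₊ - 1 : ℕ) : ℝ) + 1 = ⌈2 / ε⌉₊ := by
          exact_mod_cast Nat.sub_add_cancel hc
        rw [h2]; exact hlt
      · intro hlt
        apply RunsIn.setNat
        simp only [MachineTest.Holds, RealExp.eval, hτ2, not_lt] at hlt
        rw [show (1 : ℝ) + 1 = 2 by norm_num, ← le_div_iff₀ hpos] at hlt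
        have h3 : (⌈2 / ε⌉₊ : ℝ) = 2 / ε := le_antisymm hlt (Nat.le_ceil _)
        simp only [NatExp.eval, MachineState.setN_natVar, Function.update_self, hτ1]
        rw [Nat.sub_add_cancel hc, eq_comm, Nat.floor_eq_iff (by positivity), h3]
        exact ⟨le_rfl, by linarith⟩
  · simp [RealExp.cost, NatExp.cost, MachineTest.cost]
    omega

/-- Natural number variable `3` becomes the dimension `D`. -/
def findDim : MachineProgram :=
  ite (.natLt (.var 0) (.var 2)) (setNat 3 (.var 2)) (setNat 3 (.var 0))

theorem findDim_spec (σ : MachineState) :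
    RunsIn findDim σ 10 fun σ' => σ'.natVar 3 = max (σ.natVar 0) (σ.natVar 2) := by
  apply RunsIn.mono
  · apply RunsIn.ite (B := 2)
    · intro h
      apply RunsIn.setNat
      simp only [MachineTest.Holds, NatExp.eval] at h
      simp [NatExp.eval, h.le]
    · intro h
      apply RunsIn.setNat
      simp only [MachineTest.Holds, NatExp.eval] at h
      simp [NatExp.eval, not_lt.1 h]
  · simp [NatExp.cost, MachineTest.cost]

/-- Natural number variable `4` becomes `k`, where `p` computes `m 2 ^ m` into variable `30`. -/
def findActive (p : MachineProgram) : MachineProgram :=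
  seq p (ite (.natLt (.var 3) (.var 30)) (setNat 4 (.var 3)) (setNat 4 (.var 30)))

theorem findActive_spec {p : MachineProgram} {σ : MachineState} {B m : ℕ} (hp : WritesFrom p 30)
    (h : RunsIn p σ B fun σ' => σ'.natVar 30 = m * 2 ^ m) :
    RunsIn (findActive p) σ (B + 10) fun σ' => σ'.natVar 4 = activeBound m (σ.natVar 3) := by
  apply RunsIn.mono
  · apply RunsIn.seq
    apply RunsIn.imp h
    intro τ hf hτ _
    have h3 : τ.natVar 3 = σ.natVar 3 := hf.natVar 3 (hp.not_natVar (by norm_num))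
    apply RunsIn.ite (B := 2)
    · intro h
      apply RunsIn.setNat
      simp only [MachineTest.Holds, NatExp.eval, h3, hτ] at h
      simp [NatExp.eval, h3, activeBound, h.le]
    · intro h
      apply RunsIn.setNat
      simp only [MachineTest.Holds, NatExp.eval, h3, hτ, not_lt] at h
      simp [NatExp.eval, hτ, activeBound, h]
  · simp [NatExp.cost, MachineTest.cost]

/-- Natural number variable `6` becomes the size of the splitter, by doubling variable `7` until it
reaches `D`. -/
def findSize : MachineProgram :=
  seq (setNat 6 (.const 0)) (seq (setNat 7 (.const 1))
    (loop (.natLt (.var 7) (.var 3)) (seq (setNat 7 (.add (.var 7) (.var 7)))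
      (setNat 6 (.add (.var 6) (.add (.add (.var 5) (.var 5)) (.add (.var 5) (.var 5))))))))

theorem findSize_spec {σ : MachineState} {D q : ℕ} (h3 : σ.natVar 3 = D) (h5 : σ.natVar 5 = q) :
    RunsIn findSize σ (Nat.clog 2 D * 20 + 20) fun σ' => σ'.natVar 6 = splitterSize D q := by
  apply RunsIn.mono
  · apply RunsIn.seq
    apply RunsIn.setNat
    intro _
    apply RunsIn.seq
    apply RunsIn.setNat
    intro _
    apply RunsIn.imp
    · apply RunsIn.loop (fun j τ => τ.natVar 7 = 2 ^ j ∧ τ.natVar 6 = 4 * q * j) (Nat.clog 2 D)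
      · simp [NatExp.eval]
      · rintro j τ hf ⟨hj, -⟩
        have h3' : τ.natVar 3 = D := by
          rw [hf.natVar 3 (by simp [WritesNatVar])]; simpa using h3
        simp only [MachineTest.Holds, NatExp.eval, hj, h3']
        rw [Nat.lt_clog_iff_pow_lt (by norm_num)]
      · rintro j - τ hf ⟨hj, hj'⟩
        have h5' : τ.natVar 5 = q := by
          rw [hf.natVar 5 (by simp [WritesNatVar])]; simpa using h5
        apply RunsIn.seq
        apply RunsIn.setNat
        intro _
        apply RunsIn.setNat
        simp [NatExp.eval, hj, hj', h5', pow_succ]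
        constructor <;> ring
    · rintro τ - ⟨-, h⟩
      exact h
  · simp [NatExp.cost, MachineTest.cost]
    omega

/-! ### The splitter program -/

/-- The colour of column `x` (variable `12`) in row `t`, where the variables `11` and `13` hold
`t D` and `x D`. The array `0` is the table of colours, cell `x D + y` of the array `1` holds the
weight of the pair `y < x` minus one, so that the initial value zero is right, and the array `2`
the weights of the colours. -/
def splitterCell : MachineProgram :=
  seq (forLoop 14 5 (putNat 2 (.var 14) (.const 0))) <|
  seq (forLoop 14 12 (putNat 2 (.get 0 (.add (.var 11) (.var 14)))
    (.add (.get 2 (.get 0 (.add (.var 11) (.var 14))))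
      (.add (.get 1 (.add (.var 13) (.var 14))) (.const 1))))) <|
  seq (setNat 15 (.const 0)) <|
  seq (forLoop 14 5 (ite (.natLt (.get 2 (.var 14)) (.get 2 (.var 15)))
    (setNat 15 (.var 14)) skip)) <|
  seq (putNat 0 (.add (.var 11) (.var 12)) (.var 15)) <|
  seq (forLoop 14 12 (ite (.natLt (.get 0 (.add (.var 11) (.var 14))) (.var 15)) skip
    (ite (.natLt (.var 15) (.get 0 (.add (.var 11) (.var 14)))) skip
      (putNat 1 (.add (.var 13) (.var 14)) (.add (.get 1 (.add (.var 13) (.var 14)))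
        (.add (.get 1 (.add (.var 13) (.var 14))) (.const 1))))))) <|
  setNat 13 (.add (.var 13) (.var 3))

theorem greedyTable_succ {D q t x : ℕ} (hx : x < D) :
    greedyTable D q (t * D + x + 1) = Function.update (greedyTable D q (t * D + x)) (t * D + x)
      (argminBelow (colorWeight D (greedyColor D q) t x) q) := by
  rw [← greedyColor_eq hx, greedyColor, greedyTable, Function.update_self]

theorem splitterCell_spec {σ : MachineState} {D q t x : ℕ} (hq : 0 < q) (hx : x < D)
    (h3 : σ.natVar 3 = D) (h5 : σ.natVar 5 = q) (h11 : σ.natVar 11 = t * D)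
    (h12 : σ.natVar 12 = x) (h13 : σ.natVar 13 = x * D)
    (ha : σ.natArr 0 = greedyTable D q (t * D + x))
    (hw : ∀ y < x, σ.natArr 1 (x * D + y) + 1 = 2 ^ collisions D (greedyColor D q) t x y) :
    RunsIn splitterCell σ (100 * q + 100 * D) fun σ' =>
      σ'.natVar 13 = (x + 1) * D ∧ σ'.natArr 0 = greedyTable D q (t * D + x + 1) ∧
      (∀ y < x, σ'.natArr 1 (x * D + y) + 1 =
        2 ^ collisions D (greedyColor D q) (t + 1) x y) ∧
      ∀ i, (i < x * D ∨ x * D + x ≤ i) → σ'.natArr 1 i = σ.natArr 1 i := by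
  set F := greedyColor D q with hF
  have hcell : ∀ y < x, greedyTable D q (t * D + x) (t * D + y) = F (t * D + y) := fun y hy =>
    greedyTable_of_lt (by omega)
  apply RunsIn.mono
  · apply RunsIn.seq
    apply RunsIn.imp
    · apply RunsIn.forLoop (fun j τ => ∀ i < j, τ.natArr 2 i = 0) h5
      · simp [WritesNatVar]
      · simp [WritesNatVar]
      · norm_num
      · simp
      · intro j hj τ hf hτj hI
        apply RunsIn.putNat
        intro i hi
        simp only [NatExp.eval, hτj, MachineState.setN_natArr, MachineState.putN_natArr,
          Function.update_self]
        rcases Nat.lt_succ_iff_lt_or_eq.1 hi with h | rfl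
        · rw [Function.update_of_ne h.ne, hI i h]
        · simp
    intro σ₁ hf₁ hz _
    have e₁ : ∀ y, y ≠ 14 → σ₁.natVar y = σ.natVar y := fun y hy =>
      hf₁.natVar y (by simp [forLoop, WritesNatVar, hy])
    have a₁ : ∀ y, y ≠ 2 → σ₁.natArr y = σ.natArr y := fun y hy =>
      hf₁.natArr y (by simp [forLoop, WritesNatArr, hy])
    apply RunsIn.seq
    apply RunsIn.imp
    · apply RunsIn.forLoop (fun j τ => ∀ i < q, τ.natArr 2 i = ∑ y ∈ Finset.range j,
        if F (t * D + y) = i then 2 ^ collisions D F t x y else 0)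
        ((e₁ 12 (by norm_num)).trans h12)
      · simp [WritesNatVar]
      · simp [WritesNatVar]
      · norm_num
      · simpa using hz
      · intro y hy τ hf hτy hI
        apply RunsIn.putNat
        intro i hi
        have e0 : τ.natArr 0 = greedyTable D q (t * D + x) := by
          rw [hf.natArr 0 (by simp [forLoop, WritesNatArr]), a₁ 0 (by norm_num), ha]
        have e1 : τ.natArr 1 = σ.natArr 1 := by
          rw [hf.natArr 1 (by simp [forLoop, WritesNatArr]), a₁ 1 (by norm_num)]
        have e11 : τ.natVar 11 = t * D := by
          rw [hf.natVar 11 (by simp [forLoop, WritesNatVar]), e₁ 11 (by norm_num), h11]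
        have e13 : τ.natVar 13 = x * D := by
          rw [hf.natVar 13 (by simp [forLoop, WritesNatVar]), e₁ 13 (by norm_num), h13]
        simp only [NatExp.eval, hτy, e11, e13, e0, e1, hcell y hy, hw y hy,
          MachineState.setN_natArr, MachineState.putN_natArr, Function.update_self]
        rw [Finset.sum_range_succ]
        by_cases hi' : F (t * D + y) = i
        · rw [if_pos hi', hi', Function.update_self, hI i hi]
        · rw [if_neg hi', Function.update_of_ne (Ne.symm hi'), hI i hi, add_zero]
    intro σ₂ hf₂ hS _
    have e₂ : ∀ y, y ≠ 14 → σ₂.natVar y = σ.natVar y := fun y hy => by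
      rw [hf₂.natVar y (by simp [forLoop, WritesNatVar, hy]), e₁ y hy]
    have a₂ : ∀ y, y ≠ 2 → σ₂.natArr y = σ.natArr y := fun y hy => by
      rw [hf₂.natArr y (by simp [forLoop, WritesNatArr, hy]), a₁ y hy]
    have hS' : ∀ i < q, σ₂.natArr 2 i = colorWeight D F t x i := hS
    apply RunsIn.seq
    apply RunsIn.setNat
    intro _
    apply RunsIn.seq
    apply RunsIn.imp
    · apply RunsIn.forLoop (fun j τ => τ.natVar 15 = argminBelow (colorWeight D F t x) j)
        (N := q) (by simp [e₂ 5, h5])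
      · simp [WritesNatVar]
      · simp [WritesNatVar]
      · norm_num
      · simp [NatExp.eval, argminBelow]
      · intro j hj τ hf hτj hI
        have e2 : τ.natArr 2 = σ₂.natArr 2 := by
          rw [hf.natArr 2 (by simp [forLoop, WritesNatArr])]; simp
        have hlt : argminBelow (colorWeight D F t x) j < q := by
          rcases Nat.eq_zero_or_pos j with rfl | h
          · simpa [argminBelow] using hq
          · exact (argminBelow_lt _ h).trans hj
        apply RunsIn.ite (B := 2)
        · intro h
          apply RunsIn.setNat
          simp only [MachineTest.Holds, NatExp.eval, hτj, hI, e2, hS' _ hj, hS' _ hlt] at h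
          simp [NatExp.eval, hτj, argminBelow, h]
        · intro h
          refine RunsIn.mono (RunsIn.skip ?_) (by norm_num)
          simp only [MachineTest.Holds, NatExp.eval, hτj, hI, e2, hS' _ hj, hS' _ hlt] at h
          simp [hI, argminBelow, h]
    intro σ₃ hf₃ hbest _
    have e₃ : ∀ y, y ≠ 14 → y ≠ 15 → σ₃.natVar y = σ.natVar y := fun y hy hy' => by
      rw [hf₃.natVar y (by simp [forLoop, WritesNatVar, hy, hy'])]
      simp [hy', e₂ y hy]
    have a₃ : ∀ y, y ≠ 2 → σ₃.natArr y = σ.natArr y := fun y hy => by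
      rw [hf₃.natArr y (by simp [forLoop, WritesNatArr])]
      simp [a₂ y hy]
    rw [← greedyColor_eq hx, ← hF] at hbest
    apply RunsIn.seq
    apply RunsIn.putNat
    intro _
    simp only [NatExp.eval, e₃ 11 (by norm_num) (by norm_num),
      e₃ 12 (by norm_num) (by norm_num), h11, h12, hbest]
    have htab : Function.update (σ₃.natArr 0) (t * D + x) (F (t * D + x)) =
        greedyTable D q (t * D + x + 1) := by
      rw [greedyTable_succ hx, a₃ 0 (by norm_num), ha, ← greedyColor_eq hx]
    apply RunsIn.seq
    apply RunsIn.imp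
    · apply RunsIn.forLoop (fun j τ => (∀ y < j, τ.natArr 1 (x * D + y) + 1 =
          2 ^ collisions D F (t + 1) x y) ∧
          ∀ i, (i < x * D ∨ x * D + j ≤ i) → τ.natArr 1 i = σ.natArr 1 i) (N := x)
        (by simp [e₃ 12, h12])
      · simp [WritesNatVar]
      · simp [WritesNatVar]
      · norm_num
      · simp [a₃ 1]
      · rintro y hy τ hf hτy ⟨hI1, hI2⟩
        have e0 : τ.natArr 0 = greedyTable D q (t * D + x + 1) := by
          rw [hf.natArr 0 (by simp [forLoop, WritesNatArr]), ← htab]; simp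
        have e15 : τ.natVar 15 = F (t * D + x) := by
          rw [hf.natVar 15 (by simp [forLoop, WritesNatVar]), ← hbest]; simp
        have e11 : τ.natVar 11 = t * D := by
          rw [hf.natVar 11 (by simp [forLoop, WritesNatVar])]; simp [e₃ 11, h11]
        have e13 : τ.natVar 13 = x * D := by
          rw [hf.natVar 13 (by simp [forLoop, WritesNatVar])]; simp [e₃ 13, h13]
        have hcell' : greedyTable D q (t * D + x + 1) (t * D + y) = F (t * D + y) :=
          greedyTable_of_lt (by omega)
        have hold : τ.natArr 1 (x * D + y) + 1 = 2 ^ collisions D F t x y := by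
          rw [hI2 _ (Or.inr le_rfl), hw y hy]
        -- the cases in which the columns `x` and `y` do not collide
        have hne : F (t * D + y) ≠ F (t * D + x) →
            (∀ z < y + 1, τ.natArr 1 (x * D + z) + 1 = 2 ^ collisions D F (t + 1) x z) ∧
            ∀ i, (i < x * D ∨ x * D + (y + 1) ≤ i) → τ.natArr 1 i = σ.natArr 1 i := by
          intro h
          refine ⟨fun z hz => ?_, fun i hi => hI2 i (by omega)⟩
          rcases Nat.lt_succ_iff_lt_or_eq.1 hz with hz | rfl
          · exact hI1 z hz
          · rw [hold, collisions_succ, if_neg h, add_zero]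
        apply RunsIn.ite (B := 23)
        · intro h
          simp only [MachineTest.Holds, NatExp.eval, hτy, e0, e11, e15, hcell'] at h
          exact RunsIn.mono (RunsIn.skip (by simpa using hne h.ne)) (by norm_num)
        · intro h
          simp only [MachineTest.Holds, NatExp.eval, hτy, e0, e11, e15, hcell'] at h
          apply RunsIn.mono
          · apply RunsIn.ite (B := 15)
            · intro h'
              simp only [MachineTest.Holds, NatExp.eval, hτy, e0, e11, e15, hcell'] at h'
              exact RunsIn.mono (RunsIn.skip (by simpa using hne h'.ne')) (by norm_num)
            · intro h'
              simp only [MachineTest.Holds, NatExp.eval, hτy, e0, e11, e15, hcell'] at h'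
              have heq : F (t * D + y) = F (t * D + x) := by omega
              refine RunsIn.mono (RunsIn.putNat ?_) (by simp [NatExp.cost])
              simp only [NatExp.eval, hτy, e13, MachineState.setN_natArr,
                MachineState.putN_natArr, Function.update_self]
              refine ⟨fun z hz => ?_, fun i hi => ?_⟩
              · rcases Nat.lt_succ_iff_lt_or_eq.1 hz with hz | rfl
                · rw [Function.update_of_ne (by omega), hI1 z hz]
                · rw [Function.update_self, collisions_succ, if_pos heq, pow_succ, ← hold]
                  ring
              · rw [Function.update_of_ne (by omega)]
                exact hI2 i (by omega)
          · simp [MachineTest.cost, NatExp.cost]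
    rintro σ₄ hf₄ ⟨hw1, hw2⟩ _
    apply RunsIn.setNat
    have e13 : σ₄.natVar 13 = x * D := by
      rw [hf₄.natVar 13 (by simp [forLoop, WritesNatVar])]; simp [e₃ 13, h13]
    have e3 : σ₄.natVar 3 = D := by
      rw [hf₄.natVar 3 (by simp [forLoop, WritesNatVar])]; simp [e₃ 3, h3]
    have e0 : σ₄.natArr 0 = greedyTable D q (t * D + x + 1) := by
      rw [hf₄.natArr 0 (by simp [forLoop, WritesNatArr]), ← htab]; simp
    refine ⟨?_, e0, hw1, hw2⟩
    simp [NatExp.eval, e13, e3]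
    ring
  · simp only [NatExp.cost, MachineTest.cost]
    omega

/-- The table of colours is written into the array `0`. -/
def buildSplitter : MachineProgram :=
  seq (setNat 11 (.const 0)) <|
  forLoop 10 6 <|
    seq (setNat 13 (.const 0)) <|
    seq (forLoop 12 3 splitterCell)
    (setNat 11 (.add (.var 11) (.var 3)))

theorem buildSplitter_spec {σ : MachineState} {D q L : ℕ} (hq : 0 < q)
    (h3 : σ.natVar 3 = D) (h5 : σ.natVar 5 = q) (h6 : σ.natVar 6 = L)
    (ha : σ.natArr 0 = fun _ => 0) (hw : σ.natArr 1 = fun _ => 0) :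
    RunsIn buildSplitter σ (L * (D * (100 * q + 100 * D + 7) + 20) + 10) fun σ' =>
      σ'.natArr 0 = greedyTable D q (L * D) := by
  apply RunsIn.mono
  · apply RunsIn.seq
    apply RunsIn.setNat
    intro _
    apply RunsIn.imp
    · apply RunsIn.forLoop (fun t τ => τ.natVar 11 = t * D ∧
        τ.natArr 0 = greedyTable D q (t * D) ∧
        ∀ x < D, ∀ y < x, τ.natArr 1 (x * D + y) + 1 =
          2 ^ collisions D (greedyColor D q) t x y) (N := L) (by simpa using h6)
      · simp [forLoop, splitterCell, WritesNatVar]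
      · simp [forLoop, splitterCell, WritesNatVar]
      · norm_num
      · simp [NatExp.eval, ha, hw, greedyTable, collisions]
      · rintro t ht τ hf hτt ⟨hI11, hI0, hI1⟩
        have e3 : τ.natVar 3 = D := by
          rw [hf.natVar 3 (by simp [forLoop, splitterCell, WritesNatVar])]; simpa using h3
        have e5 : τ.natVar 5 = q := by
          rw [hf.natVar 5 (by simp [forLoop, splitterCell, WritesNatVar])]; simpa using h5
        apply RunsIn.seq
        apply RunsIn.setNat
        intro _
        apply RunsIn.seq
        apply RunsIn.imp
        · apply RunsIn.forLoop (fun x τ' => τ'.natVar 13 = x * D ∧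
            τ'.natArr 0 = greedyTable D q (t * D + x) ∧
            ∀ x' < D, ∀ y < x', τ'.natArr 1 (x' * D + y) + 1 =
              2 ^ collisions D (greedyColor D q) (if x' < x then t + 1 else t) x' y)
            (N := D) (by simpa using e3)
          · simp [forLoop, splitterCell, WritesNatVar]
          · simp [forLoop, splitterCell, WritesNatVar]
          · norm_num
          · simpa [NatExp.eval, hI0] using hI1
          · rintro x hx τ' hf' hτx ⟨hJ13, hJ0, hJ1⟩
            apply RunsIn.imp
            · apply splitterCell_spec hq hx
              · rw [hf'.natVar 3 (by simp [forLoop, splitterCell, WritesNatVar])]; simpa using e3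
              · rw [hf'.natVar 5 (by simp [forLoop, splitterCell, WritesNatVar])]; simpa using e5
              · rw [hf'.natVar 11 (by simp [forLoop, splitterCell, WritesNatVar])]
                simpa using hI11
              · exact hτx
              · exact hJ13
              · exact hJ0
              · intro y hy
                simpa using hJ1 x hx y hy
            rintro τ'' - ⟨hK13, hK0, hK1, hK2⟩
            refine ⟨by simpa using hK13, by simpa [add_assoc] using hK0, fun x' hx' y hy => ?_⟩
            simp only [MachineState.setN_natArr]
            rcases lt_trichotomy x' x with h | rfl | h
            · have := hJ1 x' hx' y hy
              rw [if_pos h] at this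
              rw [if_pos (by omega), ← this, hK2 _ (Or.inl ?_)]
              exact cell_lt (x := 0) h (hy.trans hx')
            · rw [if_pos (by omega), hK1 y hy]
            · have := hJ1 x' hx' y hy
              rw [if_neg (by omega)] at this
              rw [if_neg (by omega), ← this, hK2 _ (Or.inr ?_)]
              exact (cell_lt (x := y) h hx).le
        rintro τ' hf' ⟨-, hJ0, hJ1⟩ _
        apply RunsIn.setNat
        have e11 : τ'.natVar 11 = t * D := by
          rw [hf'.natVar 11 (by simp [forLoop, splitterCell, WritesNatVar])]; simpa using hI11
        have e3' : τ'.natVar 3 = D := by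
          rw [hf'.natVar 3 (by simp [forLoop, splitterCell, WritesNatVar])]; simpa using e3
        refine ⟨?_, ?_, fun x hx y hy => ?_⟩
        · simp [NatExp.eval, e11, e3']; ring
        · simp only [MachineState.setN_natArr, hJ0]; congr 1; ring
        · have := hJ1 x hx y hy
          rw [if_pos hx] at this
          exact this
    rintro τ - ⟨-, h, -⟩
    exact h
  · simp only [NatExp.cost]
    have : D * (100 * q + 100 * D + 7) + 5 + (1 + 1 + 1 + 1) + (1 + 1) + 7 ≤
      D * (100 * q + 100 * D + 7) + 20 := by omega
    have := Nat.mul_le_mul_left L this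
    ring_nf at this ⊢
    omega

end MachineProgram

/-! ### The output program -/

/-- The value in coordinate `c` of the vector number `i` found by the search. -/
def searchValue (m k i c : ℕ) : ℕ := digit (2 ^ m - 1) ((search m k).getD i 0) c

theorem primrec_searchValue :
    Primrec fun z : ℕ × ℕ × ℕ × ℕ => searchValue z.1 z.2.1 z.2.2.1 z.2.2.2 := by
  have h1 : Primrec fun z : ℕ × ℕ × ℕ × ℕ => z.1 := Primrec.fst
  have h2 : Primrec fun z : ℕ × ℕ × ℕ × ℕ => z.2.1 := Primrec.fst.comp Primrec.snd
  have h3 : Primrec fun z : ℕ × ℕ × ℕ × ℕ => z.2.2.1 :=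
    Primrec.fst.comp (Primrec.snd.comp Primrec.snd)
  have h4 : Primrec fun z : ℕ × ℕ × ℕ × ℕ => z.2.2.2 :=
    Primrec.snd.comp (Primrec.snd.comp Primrec.snd)
  exact primrec_digit (Primrec.nat_sub.comp (primrec_two_pow h1) (Primrec.const 1))
    ((Primrec.list_getD 0).comp (primrec_search h1 h2) h3) h4

/-- The entry `idx` of the output array. The rows have length `d` and are numbered by pairs
of a vector found by the search and one of the `L` rows of the splitter table. -/
def outputEntry (m k D L d idx : ℕ) : ℝ :=
  ((searchValue m k (idx / d / L) (greedyColor D (k ^ 2) (idx / d % L * D + idx % d)) : ℕ) + 1) /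
    2 ^ m

theorem outputEntry_eq {m k D L d i t j : ℕ} (ht : t < L) (hj : j < d) :
    outputEntry m k D L d ((i * L + t) * d + j) =
      ((searchValue m k i (greedyColor D (k ^ 2) (t * D + j)) : ℕ) + 1) / 2 ^ m := by
  have h1 : ((i * L + t) * d + j) / d = i * L + t := by
    rw [mul_comm, Nat.mul_add_div (by omega), Nat.div_eq_of_lt hj, add_zero]
  have h2 : ((i * L + t) * d + j) % d = j := by
    rw [mul_comm, Nat.mul_add_mod, Nat.mod_eq_of_lt hj]
  have h3 : (i * L + t) / L = i := by
    rw [mul_comm, Nat.mul_add_div (by omega), Nat.div_eq_of_lt ht, add_zero]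
  have h4 : (i * L + t) % L = t := by
    rw [mul_comm, Nat.mul_add_mod, Nat.mod_eq_of_lt ht]
  rw [outputEntry, h1, h2, h3, h4]

namespace MachineProgram

/-- Append the coordinate `j` (variable `16`) of the current row to the output; `p` computes the
entry of the current vector at place `14` into variable `30`. -/
def writeCoord (p : MachineProgram) : MachineProgram :=
  seq (setNat 14 (.get 0 (.add (.var 11) (.var 16)))) <|
  seq p <|
  seq (setReal 2 (.var 1)) <|
  seq (forLoop 15 30 (setReal 2 (.add (.var 2) (.var 1)))) <|
  seq (putReal 0 (.var 9) (.var 2)) <|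
  setNat 9 (.add (.var 9) (.const 1))

theorem writeCoord_spec {p : MachineProgram} {σ : MachineState} {B b m c v n : ℕ}
    (hp : WritesFrom p 30) (hx : σ.realVar 1 = 1 / 2 ^ m)
    (hc : σ.natArr 0 (σ.natVar 11 + σ.natVar 16) = c) (h9 : σ.natVar 9 = n)
    (hv : RunsIn p (σ.setN 14 c) B fun σ' => σ'.natVar 30 = v) (hvb : v ≤ b) :
    RunsIn (writeCoord p) σ (B + b * 20 + 40) fun σ' => σ'.natVar 9 = n + 1 ∧
      σ'.realArr 0 = Function.update (σ.realArr 0) n (((v : ℕ) + 1) / 2 ^ m) := by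
  apply RunsIn.mono
  · apply RunsIn.seq
    apply RunsIn.setNat
    intro _
    simp only [NatExp.eval, hc]
    apply RunsIn.seq
    apply RunsIn.imp hv
    intro τ hτ hv _
    have e1 : τ.realVar 1 = 1 / 2 ^ m := by rw [hτ.realVar 1 (hp.realVar 1)]; simpa using hx
    have e9 : τ.natVar 9 = n := by
      rw [hτ.natVar 9 (hp.not_natVar (by norm_num))]; simpa using h9
    have e0 : τ.realArr 0 = σ.realArr 0 := by rw [hτ.realArr 0 (hp.realArr 0)]; simp
    apply RunsIn.seq
    apply RunsIn.setReal
    intro _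
    apply RunsIn.seq
    apply RunsIn.imp
    · apply RunsIn.forLoop (fun j τ' => τ'.realVar 2 = ((j : ℕ) + 1) / 2 ^ m) (N := v)
        (by simpa using hv)
      · simp [WritesNatVar]
      · simp [WritesNatVar]
      · norm_num
      · simp [RealExp.eval, e1]
      · intro j hj τ' hτ' _ hI
        apply RunsIn.setReal
        have e1' : τ'.realVar 1 = 1 / 2 ^ m := by
          rw [hτ'.realVar 1 (by simp [forLoop, WritesRealVar])]; simpa using e1
        simp [RealExp.eval, hI, e1']
        ring
    intro τ' hτ' hv' _
    have e9' : τ'.natVar 9 = n := by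
      rw [hτ'.natVar 9 (by simp [forLoop, WritesNatVar])]; simpa using e9
    have e0' : τ'.realArr 0 = σ.realArr 0 := by
      rw [hτ'.realArr 0 (by simp [forLoop, WritesRealArr])]; simpa using e0
    apply RunsIn.seq
    apply RunsIn.putReal
    intro _
    apply RunsIn.setNat
    simp [NatExp.eval, RealExp.eval, e9', e0', hv']
  · simp only [NatExp.cost, RealExp.cost]
    omega

/-- Write all rows of the output, and their number into variable `0`. -/
def writeOutput (p : MachineProgram) : MachineProgram :=
  seq (setNat 9 (.const 0)) <|
  seq (setNat 17 (.const 0)) <|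
  seq (forLoop 10 8
    (seq (setNat 11 (.const 0))
    (forLoop 12 6
      (seq (forLoop 16 0 (writeCoord p)) <|
      seq (setNat 11 (.add (.var 11) (.var 3)))
      (setNat 17 (.add (.var 17) (.const 1))))))) <|
  setNat 0 (.var 17)

theorem writeOutput_spec {p : MachineProgram} {σ : MachineState} {B m k D L d N : ℕ}
    (hp : WritesFrom p 30) (hb : 0 < 2 ^ m - 1) (hk : 0 < k ^ 2) (hdD : d ≤ D)
    (hx : σ.realVar 1 = 1 / 2 ^ m) (h0 : σ.natVar 0 = d) (h1 : σ.natVar 1 = m)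
    (h3 : σ.natVar 3 = D) (h4 : σ.natVar 4 = k) (h6 : σ.natVar 6 = L) (h8 : σ.natVar 8 = N)
    (ha : σ.natArr 0 = greedyTable D (k ^ 2) (L * D))
    (hrun : ∀ τ : MachineState, ∀ i < N, ∀ c < k ^ 2, τ.natVar 1 = m → τ.natVar 4 = k →
      τ.natVar 10 = i → τ.natVar 14 = c →
      RunsIn p τ B fun τ' => τ'.natVar 30 = searchValue m k i c) :
    RunsIn (writeOutput p) σ (N * (L * (d * (B + 2 ^ m * 20 + 50) + 30) + 30) + 30) fun σ' =>
      σ'.natVar 0 = N * L ∧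
      ∀ i < N * L * d, σ'.realArr 0 i = outputEntry m k D L d i := by
  have hpn : ∀ x < 30, ¬ p.WritesNatVar x := fun x hx => hp.not_natVar hx
  apply RunsIn.mono
  · apply RunsIn.seq
    apply RunsIn.setNat
    intro _
    apply RunsIn.seq
    apply RunsIn.setNat
    intro _
    apply RunsIn.seq
    apply RunsIn.imp
    · apply RunsIn.forLoop (fun i τ => τ.natVar 9 = i * L * d ∧ τ.natVar 17 = i * L ∧
        ∀ r < i * L * d, τ.realArr 0 r = outputEntry m k D L d r) (N := N) (by simpa using h8)
      · simp [forLoop, writeCoord, WritesNatVar, hpn]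
      · simp [forLoop, writeCoord, WritesNatVar, hpn]
      · norm_num
      · simp [NatExp.eval]
      · rintro i hi τ hτ hτi ⟨hI9, hI17, hIr⟩
        have f0 : τ.natVar 0 = d := by
          rw [hτ.natVar 0 (by simp [forLoop, writeCoord, WritesNatVar, hpn])]; simpa using h0
        have f1 : τ.natVar 1 = m := by
          rw [hτ.natVar 1 (by simp [forLoop, writeCoord, WritesNatVar, hpn])]; simpa using h1
        have f3 : τ.natVar 3 = D := by
          rw [hτ.natVar 3 (by simp [forLoop, writeCoord, WritesNatVar, hpn])]; simpa using h3
        have f4 : τ.natVar 4 = k := by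
          rw [hτ.natVar 4 (by simp [forLoop, writeCoord, WritesNatVar, hpn])]; simpa using h4
        have f6 : τ.natVar 6 = L := by
          rw [hτ.natVar 6 (by simp [forLoop, writeCoord, WritesNatVar, hpn])]; simpa using h6
        have fx : τ.realVar 1 = 1 / 2 ^ m := by
          rw [hτ.realVar 1 (by simp [forLoop, writeCoord, WritesRealVar, hp.realVar])]
          simpa using hx
        have fa : τ.natArr 0 = greedyTable D (k ^ 2) (L * D) := by
          rw [hτ.natArr 0 (by simp [forLoop, writeCoord, WritesNatArr, hp.natArr])]
          simpa using ha
        apply RunsIn.seq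
        apply RunsIn.setNat
        intro _
        apply RunsIn.imp
        · apply RunsIn.forLoop (fun t τ => τ.natVar 9 = (i * L + t) * d ∧
            τ.natVar 17 = i * L + t ∧ τ.natVar 11 = t * D ∧
            ∀ r < (i * L + t) * d, τ.realArr 0 r = outputEntry m k D L d r) (N := L)
            (by simpa using f6)
          · simp [forLoop, writeCoord, WritesNatVar, hpn]
          · simp [forLoop, writeCoord, WritesNatVar, hpn]
          · norm_num
          · simpa [NatExp.eval, hI9, hI17] using hIr
          · rintro t ht ρ hρ hρt ⟨hJ9, hJ17, hJ11, hJr⟩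
            have g0 : ρ.natVar 0 = d := by
              rw [hρ.natVar 0 (by simp [forLoop, writeCoord, WritesNatVar, hpn])]; simpa using f0
            have g1 : ρ.natVar 1 = m := by
              rw [hρ.natVar 1 (by simp [forLoop, writeCoord, WritesNatVar, hpn])]; simpa using f1
            have g3 : ρ.natVar 3 = D := by
              rw [hρ.natVar 3 (by simp [forLoop, writeCoord, WritesNatVar, hpn])]; simpa using f3
            have g4 : ρ.natVar 4 = k := by
              rw [hρ.natVar 4 (by simp [forLoop, writeCoord, WritesNatVar, hpn])]; simpa using f4
            have g10 : ρ.natVar 10 = i := by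
              rw [hρ.natVar 10 (by simp [forLoop, writeCoord, WritesNatVar, hpn])]
              simpa using hτi
            have gx : ρ.realVar 1 = 1 / 2 ^ m := by
              rw [hρ.realVar 1 (by simp [forLoop, writeCoord, WritesRealVar, hp.realVar])]
              simpa using fx
            have ga : ρ.natArr 0 = greedyTable D (k ^ 2) (L * D) := by
              rw [hρ.natArr 0 (by simp [forLoop, writeCoord, WritesNatArr, hp.natArr])]
              simpa using fa
            apply RunsIn.seq
            apply RunsIn.imp
            · apply RunsIn.forLoop (fun j τ => τ.natVar 9 = (i * L + t) * d + j ∧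
                ∀ r < (i * L + t) * d + j, τ.realArr 0 r = outputEntry m k D L d r) (N := d) g0
              · simp [writeCoord, forLoop, WritesNatVar, hpn]
              · simp [writeCoord, forLoop, WritesNatVar, hpn]
              · norm_num
              · simpa [NatExp.eval, hJ9] using hJr
              · rintro j hj π hπ hπj ⟨hK9, hKr⟩
                have k1 : π.natVar 1 = m := by
                  rw [hπ.natVar 1 (by simp [forLoop, writeCoord, WritesNatVar, hpn]), g1]
                have k4 : π.natVar 4 = k := by
                  rw [hπ.natVar 4 (by simp [forLoop, writeCoord, WritesNatVar, hpn]), g4]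
                have k10 : π.natVar 10 = i := by
                  rw [hπ.natVar 10 (by simp [forLoop, writeCoord, WritesNatVar, hpn]), g10]
                have k11 : π.natVar 11 = t * D := by
                  rw [hπ.natVar 11 (by simp [forLoop, writeCoord, WritesNatVar, hpn]), hJ11]
                have kx : π.realVar 1 = 1 / 2 ^ m := by
                  rw [hπ.realVar 1 (by simp [forLoop, writeCoord, WritesRealVar, hp.realVar]), gx]
                have ka : π.natArr 0 = greedyTable D (k ^ 2) (L * D) := by
                  rw [hπ.natArr 0 (by simp [forLoop, writeCoord, WritesNatArr, hp.natArr]), ga]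
                have hcell : π.natArr 0 (π.natVar 11 + π.natVar 16) =
                    greedyColor D (k ^ 2) (t * D + j) := by
                  rw [ka, k11, hπj]
                  exact greedyTable_of_lt (cell_lt (x := 0) ht (hj.trans_le hdD))
                apply RunsIn.imp
                · exact writeCoord_spec (b := 2 ^ m) (c := greedyColor D (k ^ 2) (t * D + j))
                    (v := searchValue m k i (greedyColor D (k ^ 2) (t * D + j))) hp kx hcell hK9
                    (hrun _ i hi _ (greedyColor_lt hk _) (by simpa using k1) (by simpa using k4)
                      (by simpa using k10) (by simp))
                    ((digit_lt hb _ _).le.trans (Nat.sub_le _ _))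
                rintro π' - ⟨hL9, hLr⟩
                refine ⟨by simpa [add_assoc] using hL9, fun r hr => ?_⟩
                simp only [MachineState.setN_realArr, hLr]
                rcases Nat.lt_or_eq_of_le (show r ≤ (i * L + t) * d + j by omega) with h | rfl
                · rw [Function.update_of_ne h.ne, hKr r h]
                · rw [Function.update_self, outputEntry_eq ht hj]
            rintro π hπ ⟨hK9, hKr⟩ _
            have k11 : π.natVar 11 = t * D := by
              rw [hπ.natVar 11 (by simp [forLoop, writeCoord, WritesNatVar, hpn]), hJ11]
            have k3 : π.natVar 3 = D := by
              rw [hπ.natVar 3 (by simp [forLoop, writeCoord, WritesNatVar, hpn]), g3]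
            have k17 : π.natVar 17 = i * L + t := by
              rw [hπ.natVar 17 (by simp [forLoop, writeCoord, WritesNatVar, hpn]), hJ17]
            have hd' : (i * L + t) * d + d = (i * L + (t + 1)) * d := by ring
            rw [hd'] at hK9 hKr
            apply RunsIn.seq
            apply RunsIn.setNat
            intro _
            apply RunsIn.setNat
            refine ⟨?_, ?_, ?_, ?_⟩
            · simpa using hK9
            · simp [NatExp.eval, k17, add_assoc]
            · simp [NatExp.eval, k11, k3]; ring
            · simpa using hKr
        rintro ρ - ⟨hJ9, hJ17, -, hJr⟩
        have hd' : i * L + L = (i + 1) * L := by ring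
        rw [hd'] at hJ9 hJ17 hJr
        exact ⟨by simpa using hJ9, by simpa using hJ17, by simpa using hJr⟩
    rintro τ - ⟨-, h17, hr⟩ _
    apply RunsIn.setNat
    exact ⟨by simpa [NatExp.eval] using h17, hr⟩
  · simp only [NatExp.cost]
    have h1 : d * (B + 2 ^ m * 20 + 40 + 7) ≤ d * (B + 2 ^ m * 20 + 50) :=
      Nat.mul_le_mul_left d (by omega)
    have h2 := Nat.mul_le_mul_left L (show d * (B + 2 ^ m * 20 + 40 + 7) + 5 +
      (1 + 1 + 1 + 1 + (1 + 1 + 1 + 1)) + 7 ≤ d * (B + 2 ^ m * 20 + 50) + 30 by omega)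
    have h3 := Nat.mul_le_mul_left N (show 1 + 1 + (L * (d * (B + 2 ^ m * 20 + 40 + 7) + 5 +
      (1 + 1 + 1 + 1 + (1 + 1 + 1 + 1)) + 7) + 5) + 7 ≤
      L * (d * (B + 2 ^ m * 20 + 50) + 30) + 30 by omega)
    omega

/-! ### The complete program -/

/-- The complete program, from programs which compute `m 2 ^ m`, `k ^ 2`, the number of vectors
found by the search and their entries. Natural number variables `0` to `6` hold `d`, `m`,
`⌊2 / ε⌋`, `D`, `k`, `k ^ 2` and the size of the splitter, variable `8` the number of vectors, and
real variable `1` holds `2 ^ (-m)`. The given programs leave all of this alone, as they write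
to variables from `30` on only. -/
def mainProgram (pK pQ pN pV : MachineProgram) : MachineProgram :=
  seq findScale <| seq findFloor <| seq findDim <| seq (findActive pK) <|
  seq pQ <| seq (setNat 5 (.var 30)) <| seq findSize <| seq buildSplitter <|
  seq pN <| seq (setNat 8 (.var 30)) <| writeOutput pV

/-- The bounds `BK`, `BQ`, `BN`, `BV` for the given programs depend on `m` and `k` but not on `d`,
so the remaining factors show the running time to be polynomial in `d`. -/
theorem mainProgram_spec {pK pQ pN pV : MachineProgram} {BK BQ BN : ℕ} {BV : ℕ}
    {ε : ℝ} {d m D k : ℕ}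
    (hK : WritesFrom pK 30) (hQ : WritesFrom pQ 30) (hN : WritesFrom pN 30)
    (hV : WritesFrom pV 30) (hε : 0 < ε) (h1 : 1 / 2 ^ m ≤ ε) (h2 : ε < 2 / 2 ^ m)
    (hb : 0 < 2 ^ m - 1) (hD : D = workDim ε d) (hk : k = activeBound m D) (hk0 : 0 < k ^ 2)
    (rK : ∀ τ : MachineState, τ.natVar 1 = m → RunsIn pK τ BK fun τ' => τ'.natVar 30 = m * 2 ^ m)
    (rQ : ∀ τ : MachineState, τ.natVar 4 = k → RunsIn pQ τ BQ fun τ' => τ'.natVar 30 = k ^ 2)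
    (rN : ∀ τ : MachineState, τ.natVar 1 = m → τ.natVar 4 = k →
      RunsIn pN τ BN fun τ' => τ'.natVar 30 = (search m k).length)
    (rV : ∀ τ : MachineState, ∀ i < (search m k).length, ∀ c < k ^ 2, τ.natVar 1 = m →
      τ.natVar 4 = k → τ.natVar 10 = i → τ.natVar 14 = c →
      RunsIn pV τ BV fun τ' => τ'.natVar 30 = searchValue m k i c) :
    RunsIn (mainProgram pK pQ pN pV) (MachineState.input ε d)
      ((m * 20 + ⌈2 / ε⌉₊ * 20 + BK + BQ + BN + 200) + Nat.clog 2 D * 20 +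
        splitterSize D (k ^ 2) * (D * (100 * k ^ 2 + 100 * D + 7) + 20) +
        (search m k).length * (splitterSize D (k ^ 2) * (d * (BV + 2 ^ m * 20 + 50) + 30) + 30))
      fun σ' => σ'.natVar 0 = (search m k).length * splitterSize D (k ^ 2) ∧
        ∀ i < (search m k).length * splitterSize D (k ^ 2) * d,
          σ'.realArr 0 i = outputEntry m k D (splitterSize D (k ^ 2)) d i := by
  have hKn : ∀ x < 30, ¬ pK.WritesNatVar x := fun x hx => hK.not_natVar hx
  have hQn : ∀ x < 30, ¬ pQ.WritesNatVar x := fun x hx => hQ.not_natVar hx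
  have hNn : ∀ x < 30, ¬ pN.WritesNatVar x := fun x hx => hN.not_natVar hx
  apply RunsIn.mono
  · apply RunsIn.seq
    apply RunsIn.imp
    · apply findScale_spec (m := m) <;> simp [MachineState.input]
      · simpa using h1
      · exact h2
    rintro σ₁ hf₁ ⟨a1, ax⟩ _
    have a0 : σ₁.natVar 0 = d := by
      rw [hf₁.natVar 0 (by simp [findScale, WritesNatVar])]; simp [MachineState.input]
    have aε : σ₁.realVar 0 = ε := by
      rw [hf₁.realVar 0 (by simp [findScale, WritesRealVar])]; simp [MachineState.input]
    have aa : ∀ r, σ₁.natArr r = fun _ => 0 := fun r => by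
      rw [hf₁.natArr r (by simp [findScale, WritesNatArr])]; simp [MachineState.input]
    apply RunsIn.seq
    apply RunsIn.imp
    · apply findFloor_spec _ aε hε
      rw [hf₁.natVar 2 (by simp [findScale, WritesNatVar])]; simp [MachineState.input]
    rintro σ₂ hf₂ b2 _
    have b0 : σ₂.natVar 0 = d := by
      rw [hf₂.natVar 0 (by simp [findFloor, WritesNatVar]), a0]
    have b1 : σ₂.natVar 1 = m := by
      rw [hf₂.natVar 1 (by simp [findFloor, WritesNatVar]), a1]
    have bx : σ₂.realVar 1 = 1 / 2 ^ m := by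
      rw [hf₂.realVar 1 (by simp [findFloor, WritesRealVar]), ax]
    have ba : ∀ r, σ₂.natArr r = fun _ => 0 := fun r => by
      rw [hf₂.natArr r (by simp [findFloor, WritesNatArr]), aa]
    apply RunsIn.seq
    apply RunsIn.imp (findDim_spec σ₂)
    rintro σ₃ hf₃ c3 _
    rw [b0, b2] at c3
    replace c3 : σ₃.natVar 3 = D := c3.trans hD.symm
    have c0 : σ₃.natVar 0 = d := by
      rw [hf₃.natVar 0 (by simp [findDim, WritesNatVar]), b0]
    have c1 : σ₃.natVar 1 = m := by
      rw [hf₃.natVar 1 (by simp [findDim, WritesNatVar]), b1]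
    have cx : σ₃.realVar 1 = 1 / 2 ^ m := by
      rw [hf₃.realVar 1 (by simp [findDim, WritesRealVar]), bx]
    have ca : ∀ r, σ₃.natArr r = fun _ => 0 := fun r => by
      rw [hf₃.natArr r (by simp [findDim, WritesNatArr]), ba]
    apply RunsIn.seq
    apply RunsIn.imp (findActive_spec hK (rK σ₃ c1))
    rintro σ₄ hf₄ d4 _
    rw [c3, ← hk] at d4
    have d0 : σ₄.natVar 0 = d := by
      rw [hf₄.natVar 0 (by simp [findActive, WritesNatVar, hKn]), c0]
    have d1 : σ₄.natVar 1 = m := by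
      rw [hf₄.natVar 1 (by simp [findActive, WritesNatVar, hKn]), c1]
    have d3 : σ₄.natVar 3 = D := by
      rw [hf₄.natVar 3 (by simp [findActive, WritesNatVar, hKn]), c3]
    have dx : σ₄.realVar 1 = 1 / 2 ^ m := by
      rw [hf₄.realVar 1 (by simp [findActive, WritesRealVar, hK.realVar]), cx]
    have da : ∀ r, σ₄.natArr r = fun _ => 0 := fun r => by
      rw [hf₄.natArr r (by simp [findActive, WritesNatArr, hK.natArr]), ca]
    apply RunsIn.seq
    apply RunsIn.imp (rQ σ₄ d4)
    rintro σ₅ hf₅ e30 _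
    have e : ∀ x < 30, σ₅.natVar x = σ₄.natVar x := fun x hx => hf₅.natVar x (hQn x hx)
    have ex : σ₅.realVar 1 = 1 / 2 ^ m := by rw [hf₅.realVar 1 (hQ.realVar 1), dx]
    have ea : ∀ r, σ₅.natArr r = fun _ => 0 := fun r => by rw [hf₅.natArr r (hQ.natArr r), da]
    apply RunsIn.seq
    apply RunsIn.setNat
    intro _
    simp only [NatExp.eval, e30]
    apply RunsIn.seq
    apply RunsIn.imp
    · apply findSize_spec (D := D) (q := k ^ 2)
      · simp [e 3, d3]
      · simp
    rintro σ₆ hf₆ f6 _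
    have f : ∀ x, x ≠ 5 → x ≠ 6 → x ≠ 7 → x < 30 → σ₆.natVar x = σ₄.natVar x :=
      fun x h5 h6 h7 h30 => by
        rw [hf₆.natVar x (by simp [findSize, WritesNatVar, h6, h7])]
        simp [h5, e x h30]
    have f5 : σ₆.natVar 5 = k ^ 2 := by
      rw [hf₆.natVar 5 (by simp [findSize, WritesNatVar])]; simp
    have fx : σ₆.realVar 1 = 1 / 2 ^ m := by
      rw [hf₆.realVar 1 (by simp [findSize, WritesRealVar])]; simpa using ex
    have fa : ∀ r, σ₆.natArr r = fun _ => 0 := fun r => by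
      rw [hf₆.natArr r (by simp [findSize, WritesNatArr])]; simpa using ea r
    apply RunsIn.seq
    apply RunsIn.imp (buildSplitter_spec hk0 ((f 3 (by norm_num) (by norm_num) (by norm_num)
      (by norm_num)).trans d3) f5 f6 (fa 0) (fa 1))
    rintro σ₇ hf₇ g0 _
    have g : ∀ x, x < 5 → σ₇.natVar x = σ₄.natVar x := fun x h => by
      rw [hf₇.natVar x (by
        interval_cases x <;> simp [buildSplitter, splitterCell, forLoop, WritesNatVar]),
        f x (by omega) (by omega) (by omega) (by omega)]
    have g6 : σ₇.natVar 6 = splitterSize D (k ^ 2) := by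
      rw [hf₇.natVar 6 (by simp [buildSplitter, splitterCell, forLoop, WritesNatVar]), f6]
    have gx : σ₇.realVar 1 = 1 / 2 ^ m := by
      rw [hf₇.realVar 1 (by simp [buildSplitter, splitterCell, forLoop, WritesRealVar]), fx]
    apply RunsIn.seq
    apply RunsIn.imp (rN σ₇ ((g 1 (by norm_num)).trans d1) ((g 4 (by norm_num)).trans d4))
    rintro σ₈ hf₈ h30 _
    have h : ∀ x < 30, σ₈.natVar x = σ₇.natVar x := fun x hx => hf₈.natVar x (hNn x hx)
    apply RunsIn.seq
    apply RunsIn.setNat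
    intro _
    simp only [NatExp.eval, h30]
    apply writeOutput_spec (B := BV) (D := D) hV hb hk0 (hD ▸ le_workDim ε d)
    · simpa [hf₈.realVar 1 (hN.realVar 1)] using gx
    · simp [h 0, g 0, d0]
    · simp [h 1, g 1, d1]
    · simp [h 3, g 3, d3]
    · simp [h 4, g 4, d4]
    · simp [h 6, g6]
    · simp
    · simpa [hf₈.natArr 0 (hN.natArr 0)] using g0
    · exact rV
  · simp only [NatExp.cost]
    omega

end MachineProgram

/-! ### Cardinality of the point set -/

theorem exists_scale {ε : ℝ} (h0 : 0 < ε) (h4 : ε ≤ 1 / 4) :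
    ∃ m : ℕ, 1 ≤ m ∧ 1 / 2 ^ m ≤ ε ∧ ε < 2 / 2 ^ m := by
  classical
  have hex : ∃ m : ℕ, 1 / 2 ^ m ≤ ε := by
    obtain ⟨m, hm⟩ := exists_pow_lt_of_lt_one h0 (show (1 / 2 : ℝ) < 1 by norm_num)
    exact ⟨m, by simpa using hm.le⟩
  have hm := Nat.find_spec hex
  have hmin : ∀ j < Nat.find hex, ε < 1 / 2 ^ j := fun j hj => not_le.1 (Nat.find_min hex hj)
  generalize Nat.find hex = m at hm hmin
  have h2 : 1 ≤ m := by
    by_contra! h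
    interval_cases m
    norm_num at hm
    linarith
  obtain ⟨j, rfl⟩ := Nat.exists_eq_add_of_le' h2
  refine ⟨j + 1, h2, hm, (hmin j (by omega)).trans_eq ?_⟩
  rw [pow_succ]
  field_simp

/-- The number of vectors found by the search is bounded in terms of `m` only, because a
restriction set is at most `4 ^ m` times smaller than the set of all patterns. -/
theorem searchBound_le {m k : ℕ} (hm : 1 ≤ m) (hk : 0 < k) (hkm : k ≤ m * 2 ^ m) :
    ((⌈((2 ^ m - 1 : ℕ) : ℝ) ^ k / (minCard (boxRestrictions m k) : ℝ) *
      Real.log (((k ^ 2 : ℕ) : ℝ) ^ k * 2 ^ (2 * m * k))⌉₊ : ℕ) : ℝ) ≤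
      7 * m ^ 2 * (2 ^ m) ^ 3 := by
  obtain ⟨hc, hle⟩ := minCard_boxRestrictions hm k
  have hm' : (1 : ℝ) ≤ m := by exact_mod_cast hm
  have hk' : (1 : ℝ) ≤ k := by exact_mod_cast hk
  have hq : (1 : ℝ) ≤ 2 ^ m := one_le_pow₀ (by norm_num)
  have hkm' : (k : ℝ) ≤ m * 2 ^ m := by exact_mod_cast hkm
  have hratio : ((2 ^ m - 1 : ℕ) : ℝ) ^ k / (minCard (boxRestrictions m k) : ℝ) ≤ (2 ^ m) ^ 2 := by
    rw [div_le_iff₀ (by exact_mod_cast hc)]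
    exact_mod_cast hle
  have hlogk : Real.log k ≤ 2 * m * Real.log 2 := by
    have h1 : (k : ℝ) ≤ 2 ^ (2 * m) := by
      have h2 : (m : ℝ) ≤ 2 ^ m := by exact_mod_cast m.lt_two_pow_self.le
      calc (k : ℝ) ≤ m * 2 ^ m := hkm'
        _ ≤ 2 ^ m * 2 ^ m := by gcongr
        _ = 2 ^ (2 * m) := by ring
    calc Real.log k ≤ Real.log (2 ^ (2 * m)) := Real.log_le_log (by positivity) h1
      _ = 2 * m * Real.log 2 := by rw [Real.log_pow]; push_cast; ring
  have hlog : Real.log (((k ^ 2 : ℕ) : ℝ) ^ k * 2 ^ (2 * m * k)) ≤ 6 * m ^ 2 * 2 ^ m := by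
    have h2 : Real.log 2 ≤ 1 := by linarith [Real.log_two_lt_d9]
    have h2' : 0 ≤ Real.log 2 := Real.log_nonneg (by norm_num)
    rw [Real.log_mul (by positivity) (by positivity), Real.log_pow, Real.log_pow, Nat.cast_pow,
      Real.log_pow]
    push_cast
    calc (k : ℝ) * (2 * Real.log k) + 2 * m * k * Real.log 2
        ≤ k * (2 * (2 * m * Real.log 2)) + 2 * m * k * Real.log 2 := by gcongr
      _ = 6 * m * k * Real.log 2 := by ring
      _ ≤ 6 * m * (m * 2 ^ m) * 1 := by gcongr
      _ = 6 * m ^ 2 * 2 ^ m := by ring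
  have hlog0 : 0 ≤ Real.log (((k ^ 2 : ℕ) : ℝ) ^ k * 2 ^ (2 * m * k)) := by
    apply Real.log_nonneg
    push_cast
    exact one_le_mul_of_one_le_of_one_le (one_le_pow₀ (one_le_pow₀ hk'))
      (one_le_pow₀ (by norm_num))
  refine (Nat.ceil_lt_add_one (by positivity)).le.trans ?_
  have h1 : (1 : ℝ) ≤ m ^ 2 * (2 ^ m) ^ 3 :=
    one_le_mul_of_one_le_of_one_le (one_le_pow₀ hm') (one_le_pow₀ hq)
  have h2 := mul_le_mul hratio hlog hlog0 (by positivity)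
  calc _ ≤ ((2 : ℝ) ^ m) ^ 2 * (6 * m ^ 2 * 2 ^ m) + m ^ 2 * (2 ^ m) ^ 3 := add_le_add h2 h1
    _ = 7 * m ^ 2 * (2 ^ m) ^ 3 := by ring

theorem scale_mul_two_pow_le {ε : ℝ} {m : ℕ} (h0 : 0 < ε) (h2 : ε < 2 / 2 ^ m) :
    (m : ℝ) * 2 ^ m ≤ 2 * ((1 + Real.logb 2 ε⁻¹) / ε) := by
  have hp : (0 : ℝ) < 2 ^ m := by positivity
  have h3 : (2 : ℝ) ^ m ≤ 2 * ε⁻¹ := by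
    rw [← div_eq_mul_inv, le_div_iff₀ h0, mul_comm]
    exact ((lt_div_iff₀ hp).1 h2).le
  have h4 : (m : ℝ) ≤ 1 + Real.logb 2 ε⁻¹ := by
    have := Real.logb_le_logb_of_le (b := 2) (by norm_num) hp h3
    rwa [Real.logb_mul (by norm_num) (by positivity), Real.logb_self_eq_one (by norm_num),
      Real.logb_pow, Real.logb_self_eq_one (by norm_num), mul_one] at this
  calc (m : ℝ) * 2 ^ m ≤ (1 + Real.logb 2 ε⁻¹) * (2 * ε⁻¹) := by
        gcongr
        exact m.cast_nonneg.trans h4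
    _ = _ := by ring

theorem workDim_le_max {ε : ℝ} (h0 : 0 < ε) (d : ℕ) :
    (workDim ε d : ℝ) ≤ max (d : ℝ) (2 / ε) := by
  rw [workDim, Nat.cast_max]
  exact max_le_max le_rfl (Nat.floor_le (by positivity))

/-- The size of the search result times the size of the splitter. The constant is `7 * 12 * 2 ^ 6`,
where `2 ^ 6` comes from `m 2 ^ m ≤ 2 (1 + log₂ (1 / ε)) / ε`. -/
theorem card_bound {ε : ℝ} {d m k : ℕ} (h0 : 0 < ε) (h2 : ε < 2 / 2 ^ m) (hm : 1 ≤ m)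
    (hd : 2 ≤ d) (hkm : k ≤ m * 2 ^ m) :
    7 * (m : ℝ) ^ 2 * (2 ^ m) ^ 3 * (12 * (k ^ 2 : ℕ) * Real.log (workDim ε d)) ≤
      5376 * ((1 + Real.logb 2 ε⁻¹) / ε) ^ 6 * Real.log (max (d : ℝ) (2 / ε)) := by
  have hD : (2 : ℝ) ≤ workDim ε d := by exact_mod_cast hd.trans (le_workDim ε d)
  have hlog : Real.log (workDim ε d) ≤ Real.log (max (d : ℝ) (2 / ε)) :=
    Real.log_le_log (by linarith) (workDim_le_max h0 d)
  have hlog0 : 0 ≤ Real.log (workDim ε d) := Real.log_nonneg (by linarith)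
  have hm' : (1 : ℝ) ≤ m := by exact_mod_cast hm
  have hq : (1 : ℝ) ≤ 2 ^ m := one_le_pow₀ (by norm_num)
  have hk : ((k ^ 2 : ℕ) : ℝ) ≤ (m * 2 ^ m) ^ 2 := by exact_mod_cast Nat.pow_le_pow_left hkm 2
  calc 7 * (m : ℝ) ^ 2 * (2 ^ m) ^ 3 * (12 * (k ^ 2 : ℕ) * Real.log (workDim ε d))
      ≤ 7 * (m : ℝ) ^ 2 * (2 ^ m) ^ 3 * (12 * (m * 2 ^ m) ^ 2 *
          Real.log (max (d : ℝ) (2 / ε))) := by gcongr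
    _ = 84 * (m ^ 4 * (2 ^ m) ^ 5) * Real.log (max (d : ℝ) (2 / ε)) := by ring
    _ ≤ 84 * (m ^ 6 * (2 ^ m) ^ 6) * Real.log (max (d : ℝ) (2 / ε)) := by
        have := hlog0.trans hlog
        gcongr <;> first | assumption | norm_num
    _ = 84 * (m * 2 ^ m) ^ 6 * Real.log (max (d : ℝ) (2 / ε)) := by ring
    _ ≤ 84 * (2 * ((1 + Real.logb 2 ε⁻¹) / ε)) ^ 6 * Real.log (max (d : ℝ) (2 / ε)) := by
        have h5 := pow_le_pow_left₀ (by positivity) (scale_mul_two_pow_le h0 h2) 6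
        exact mul_le_mul_of_nonneg_right (by linarith) (hlog0.trans hlog)
    _ = _ := by ring

/-! ### Running time -/

theorem clog_two_le (D : ℕ) : Nat.clog 2 D ≤ D :=
  Nat.clog_le_of_le_pow D.lt_two_pow_self.le

/-- The running time is cubic in the dimension when the quantities that depend on `m` and
`k` only are regarded as constants. -/
theorem time_le_mul_pow {X N V q d D : ℕ} (hd : d ≤ D) (hD : 1 ≤ D) :
    X + Nat.clog 2 D * 20 + splitterSize D q * (D * (100 * q + 100 * D + 7) + 20) +
        N * (splitterSize D q * (d * V + 30) + 30) ≤
      (X + 20 + 4 * q * (100 * q + 127) + N * (4 * q * (V + 30) + 30)) * D ^ 3 := by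
  have h1 : 1 ≤ D ^ 3 := Nat.one_le_pow _ _ hD
  have h2 : 1 ≤ D ^ 2 := Nat.one_le_pow _ _ hD
  have h3 : D ≤ D ^ 2 := Nat.le_self_pow (by norm_num) D
  have h4 : D ≤ D ^ 3 := Nat.le_self_pow (by norm_num) D
  have h5 : D ^ 2 ≤ D ^ 3 := Nat.pow_le_pow_right hD (by norm_num)
  have hs : splitterSize D q ≤ 4 * q * D := Nat.mul_le_mul_left _ (clog_two_le D)
  have e1 : Nat.clog 2 D * 20 ≤ 20 * D ^ 3 := by have := clog_two_le D; omega
  have e2 : D * (100 * q + 100 * D + 7) + 20 ≤ (100 * q + 127) * D ^ 2 := by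
    have := Nat.mul_le_mul_left (100 * q) h3
    calc _ = 100 * q * D + 100 * D ^ 2 + 7 * D + 20 := by ring
      _ ≤ 100 * q * D ^ 2 + 100 * D ^ 2 + 7 * D ^ 2 + 20 * D ^ 2 := by omega
      _ = _ := by ring
  have e3 : d * V + 30 ≤ (V + 30) * D := by
    have := Nat.mul_le_mul_right V hd
    calc _ ≤ D * V + 30 * D := by omega
      _ = _ := by ring
  have e4 : splitterSize D q * (D * (100 * q + 100 * D + 7) + 20) ≤
      4 * q * (100 * q + 127) * D ^ 3 :=
    (Nat.mul_le_mul hs e2).trans_eq (by ring)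
  have e5 : splitterSize D q * (d * V + 30) + 30 ≤ (4 * q * (V + 30) + 30) * D ^ 3 := by
    have h6 : splitterSize D q * (d * V + 30) ≤ 4 * q * (V + 30) * D ^ 2 :=
      (Nat.mul_le_mul hs e3).trans_eq (by ring)
    have h7 := Nat.mul_le_mul_left (4 * q * (V + 30)) h5
    calc _ ≤ 4 * q * (V + 30) * D ^ 3 + 30 * D ^ 3 := by omega
      _ = _ := by ring
  have e6 := Nat.mul_le_mul_left N e5
  have e7 := Nat.mul_le_mul_left X h1
  calc _ ≤ X * D ^ 3 + 20 * D ^ 3 + 4 * q * (100 * q + 127) * D ^ 3 +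
        N * ((4 * q * (V + 30) + 30) * D ^ 3) := by omega
    _ = _ := by ring

theorem workDim_le_mul {ε : ℝ} {d : ℕ} (h0 : 0 < ε) (hd : 1 ≤ d) :
    (workDim ε d : ℝ) ≤ (2 / ε + 1) * d := by
  have hd' : (1 : ℝ) ≤ d := by exact_mod_cast hd
  have h : 0 < 2 / ε := by positivity
  refine (workDim_le_max h0 d).trans (max_le ?_ ?_) <;> nlinarith

theorem cubic_bound {t g S W d : ℕ} {x : ℝ} (ht : t ≤ g * W ^ 3) (hg : g ≤ S)
    (hW : (W : ℝ) ≤ x * d) : (t : ℝ) ≤ S * x ^ 3 * (d : ℝ) ^ 3 :=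
  calc (t : ℝ) ≤ S * (W : ℝ) ^ 3 := by
        exact_mod_cast ht.trans (Nat.mul_le_mul_right _ hg)
    _ ≤ S * (x * d) ^ 3 := by gcongr
    _ = _ := by ring

/-! ### The output as a composed point set -/

/-- The points composed of the vectors found by the search and the rows of the greedy splitter. -/
def composedPoints {m : ℕ} (hb : 0 < 2 ^ m - 1) (k d D : ℕ) (hd : d ≤ D) (hk : 0 < k ^ 2) :
    Finset (Fin d → ℝ) :=
  open Classical in
  (((search m k).map (decodeVector hb (k ^ 2))).toFinset ×ˢ greedySplitter D (k ^ 2) hk).image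
    fun z j => gridPoint m (fun i => z.1 (z.2 i)) (Fin.castLE hd j)

section composedPoints
variable {m k d D : ℕ} (hb : 0 < 2 ^ m - 1) (hd : d ≤ D) (hk : 0 < k ^ 2)

theorem coe_composedPoints : (composedPoints hb k d D hd hk : Set (Fin d → ℝ)) =
    {y | ∃ τ ∈ (search m k).map (decodeVector hb (k ^ 2)), ∃ a ∈ greedySplitter D (k ^ 2) hk,
      y = fun j => gridPoint m (fun i => τ (a i)) (Fin.castLE hd j)} := by
  ext y
  simp only [composedPoints, Finset.coe_image, Set.mem_image, Finset.mem_coe, Finset.mem_product,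
    List.mem_toFinset, Prod.exists, Set.mem_ofPred_eq]
  constructor
  · rintro ⟨τ, a, ⟨hτ, ha⟩, rfl⟩
    exact ⟨τ, hτ, a, ha, rfl⟩
  · rintro ⟨τ, hτ, a, ha, rfl⟩
    exact ⟨τ, a, ⟨hτ, ha⟩, rfl⟩

theorem card_composedPoints_le :
    (composedPoints hb k d D hd hk).card ≤
      (search m k).length * (greedySplitter D (k ^ 2) hk).card := by
  classical
  refine Finset.card_image_le.trans ?_
  rw [Finset.card_product]
  exact Nat.mul_le_mul_right _ ((List.toFinset_card_le _).trans_eq (by simp))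

theorem composedPoints_subset_unitCube :
    ∀ x ∈ composedPoints hb k d D hd hk, ∀ j, x j ∈ Set.Icc (0 : ℝ) 1 := by
  intro x hx j
  rw [← Finset.mem_coe, coe_composedPoints] at hx
  obtain ⟨τ, -, a, -, rfl⟩ := hx
  have h2 : ((τ (a (Fin.castLE hd j)) : ℕ) : ℝ) + 1 ≤ 2 ^ m := by
    have := (τ (a (Fin.castLE hd j))).2
    exact_mod_cast (by omega : ((τ (a (Fin.castLE hd j)) : ℕ)) + 1 ≤ 2 ^ m)
  exact ⟨by unfold gridPoint; positivity, (div_le_one (by positivity)).2 h2⟩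

theorem outputs_composedPoints {σ : MachineState}
    (h0 : σ.natVar 0 = (search m k).length * splitterSize D (k ^ 2))
    (hσ : ∀ i < (search m k).length * splitterSize D (k ^ 2) * d,
      σ.realArr 0 i = outputEntry m k D (splitterSize D (k ^ 2)) d i) :
    σ.Outputs (composedPoints hb k d D hd hk) := by
  have hrow : ∀ i (hi : i < (search m k).length), ∀ t < splitterSize D (k ^ 2), ∀ j : Fin d,
      σ.realArr 0 ((i * splitterSize D (k ^ 2) + t) * d + j) =
        gridPoint m (fun x : Fin D => decodeVector hb (k ^ 2) (search m k)[i]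
          ⟨greedyColor D (k ^ 2) (t * D + x), greedyColor_lt hk _⟩) (Fin.castLE hd j) := by
    intro i hi t ht j
    rw [hσ _ (cell_lt (x := 0) (cell_lt (x := 0) hi ht) j.2), outputEntry_eq ht j.2, searchValue,
      List.getD_eq_getElem _ _ hi]
    rfl
  rw [MachineState.Outputs, coe_composedPoints]
  ext y
  simp only [List.mem_map, greedySplitter, Finset.mem_image, Finset.mem_range, Set.mem_ofPred_eq,
    Set.mem_range]
  constructor
  · rintro ⟨-, ⟨X, hX, rfl⟩, -, ⟨t, ht, rfl⟩, rfl⟩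
    obtain ⟨i, hi, rfl⟩ := List.mem_iff_getElem.1 hX
    exact ⟨⟨i * splitterSize D (k ^ 2) + t, by rw [h0]; exact cell_lt (x := 0) hi ht⟩,
      funext fun j => hrow i hi t ht j⟩
  · rintro ⟨⟨r, hr⟩, rfl⟩
    rw [h0] at hr
    have hL : 0 < splitterSize D (k ^ 2) := by
      refine Nat.pos_of_ne_zero fun h => ?_
      simp [h] at hr
    have hi : r / splitterSize D (k ^ 2) < (search m k).length := Nat.div_lt_of_lt_mul (by
      rwa [mul_comm])
    refine ⟨_, ⟨_, List.getElem_mem hi, rfl⟩, _, ⟨_, Nat.mod_lt r hL, rfl⟩, funext fun j => ?_⟩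
    rw [← hrow _ hi _ (Nat.mod_lt r hL) j, Nat.div_add_mod']

end composedPoints

theorem length_search_le {m k : ℕ} (hb : 0 < 2 ^ m - 1) (hm : 1 ≤ m) (hk : 0 < k) :
    ((search m k).map (decodeVector hb (k ^ 2))).length ≤
      ⌈((2 ^ m - 1 : ℕ) : ℝ) ^ k / (minCard (boxRestrictions m k) : ℝ) *
        Real.log (((k ^ 2 : ℕ) : ℝ) ^ k * 2 ^ (2 * m * k))⌉₊ :=
  length_le_of_foundBySearch (isKWiseIndependent_univ hb)
    (foundBySearch_searchVectors hb (numCodes m k)).1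
    (foundBySearch_searchVectors hb (numCodes m k)).2 hb
    (minCard_boxRestrictions hm k).1 (ncard_outstanding_lt hk (by positivity))

end

/-- One fixed program and absolute constants `C` and `c` serve all `ε` and `d`; only the factor `K`
in the running time depends on `ε`. -/
theorem theorem4p4 :
    ∃ (prog : MachineProgram) (C : ℝ) (c : ℕ),
      ∀ ε : ℝ, 0 < ε → ε ≤ 1 / 4 →
        ∃ K : ℝ, ∀ d : ℕ, 2 ≤ d →
          ∃ (t : ℕ) (σ : MachineState) (P : Finset (Fin d → ℝ)) (m : ℕ),
            prog.Runs (MachineState.input ε d) t σ ∧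
            σ.Outputs P ∧
            (1 / 2 ^ m ≤ ε ∧ ε < 2 / 2 ^ m) ∧
            IsComposedPointSet C ε d m P ∧
            (∀ x ∈ P, ∀ j, x j ∈ Set.Icc (0 : ℝ) 1) ∧
            dispersion (P : Set (Fin d → ℝ)) ≤ ENNReal.ofReal ε ∧
            (P.card : ℝ) ≤ C * ((1 + Real.logb 2 ε⁻¹) / ε) ^ 6 *
              Real.log (max (d : ℝ) (2 / ε)) ∧
            (t : ℝ) ≤ K * (d : ℝ) ^ c := by
  obtain ⟨BK, pK, hK, rK⟩ := MachineProgram.exists_program₁ (f := fun m => m * 2 ^ m) (a := 1)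
    (o := 30) (Primrec.nat_mul.comp Primrec.id (primrec_two_pow Primrec.id)) (by norm_num)
  obtain ⟨BQ, pQ, hQ, rQ⟩ := MachineProgram.exists_program₁ (f := fun k => k ^ 2) (a := 4)
    (o := 30) (primrec_sq Primrec.id) (by norm_num)
  obtain ⟨BN, pN, hN, rN⟩ := MachineProgram.exists_program₂ (a := 1) (b := 4) (o := 30)
    (f := fun m k => (search m k).length)
    (Primrec.list_length.comp (primrec_search Primrec.fst Primrec.snd)) (by norm_num) (by norm_num)
  obtain ⟨BV, pV, hV, rV⟩ := MachineProgram.exists_program₄ (a := 1) (b := 4) (c := 10) (d := 14)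
    (o := 30) primrec_searchValue (by norm_num) (by norm_num) (by norm_num) (by norm_num)
  refine ⟨.mainProgram pK pQ pN pV, 5376, 3, fun ε h0 h4 => ?_⟩
  obtain ⟨m, hm, h1, h2⟩ := exists_scale h0 h4
  have hb : 0 < 2 ^ m - 1 := by
    have := Nat.pow_le_pow_right (n := 2) (by norm_num) hm
    omega
  -- The constant for one value of `k`; there are only finitely many values for a given `ε`.
  let V : ℕ → ℕ := fun k =>
    (∑ i ∈ Finset.range (search m k).length, ∑ c ∈ Finset.range (k ^ 2), BV m k i c) +
      2 ^ m * 20 + 50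
  let G : ℕ → ℕ := fun k =>
    (m * 20 + ⌈2 / ε⌉₊ * 20 + BK m + BQ k + BN m k + 200) + 20 + 4 * k ^ 2 * (100 * k ^ 2 + 127) +
      (search m k).length * (4 * k ^ 2 * (V k + 30) + 30)
  refine ⟨(∑ k ∈ Finset.range (m * 2 ^ m + 1), G k : ℕ) * (2 / ε + 1) ^ 3, fun d hd => ?_⟩
  have hdD := le_workDim ε d
  have hD2 : 2 ≤ workDim ε d := hd.trans hdD
  obtain ⟨k, hk⟩ : ∃ k, k = activeBound m (workDim ε d) := ⟨_, rfl⟩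
  have hkm : k ≤ m * 2 ^ m := hk ▸ min_le_left _ _
  have hk0 : 0 < k := by
    rw [hk]
    exact lt_min (by positivity) (by omega)
  have hk2 : 0 < k ^ 2 := by positivity
  obtain ⟨t, σ, ht, hrun, hσ0, hσ⟩ := MachineProgram.mainProgram_spec (BK := BK m) (BQ := BQ k)
    (BN := BN m k)
    (BV := ∑ i ∈ Finset.range (search m k).length, ∑ c ∈ Finset.range (k ^ 2), BV m k i c)
    hK hQ hN hV h0 h1 h2 hb rfl hk hk2
    (fun τ e1 => by simpa only [e1] using rK τ) (fun τ e4 => by simpa only [e4] using rQ τ)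
    (fun τ e1 e4 => by simpa only [e1, e4] using rN τ)
    (fun τ i hi c hc e1 e4 e10 e14 => by
      have h := rV τ
      rw [e1, e4, e10, e14] at h
      refine h.mono ?_
      refine le_trans ?_ (Finset.single_le_sum
        (f := fun i => ∑ c ∈ Finset.range (k ^ 2), BV m k i c) (fun _ _ => Nat.zero_le _)
        (Finset.mem_range.2 hi))
      exact Finset.single_le_sum (f := fun c => BV m k i c) (fun _ _ => Nat.zero_le _)
        (Finset.mem_range.2 hc))
  have hsplit := isSplitter_greedySplitter (D := workDim ε d) hD2 hk2
  have hsolve := solvesRestrictions_search hb (k := k) hm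
  have hA := card_greedySplitter_le hD2 hk2
  have hT := length_search_le hb hm hk0
  refine ⟨t, σ, composedPoints hb k d (workDim ε d) hdD hk2, m, hrun,
    outputs_composedPoints hb hdD hk2 hσ0 hσ, ⟨h1, h2⟩, ?_,
    composedPoints_subset_unitCube hb hdD hk2, ?_, ?_, ?_⟩
  · unfold IsComposedPointSet
    dsimp only
    rw [← hk]
    refine ⟨greedySplitter (workDim ε d) (k ^ 2) hk2, Finset.univ,
      (search m k).map (decodeVector hb (k ^ 2)), hsplit, hA.trans ?_, isKWiseIndependent_univ hb,
      (foundBySearch_searchVectors hb (numCodes m k)).1, hsolve, hT,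
      coe_composedPoints hb hdD hk2⟩
    have hk1 : (1 : ℝ) ≤ (k : ℝ) ^ 2 := one_le_pow₀ (by exact_mod_cast hk0)
    have hlog : 0 ≤ Real.log (workDim ε d) := Real.log_natCast_nonneg _
    have hk2 : (k : ℝ) ^ 2 ≤ (k : ℝ) ^ 4 :=
      pow_le_pow_right₀ (by exact_mod_cast hk0) (by norm_num)
    push_cast
    gcongr
    norm_num
  · rw [coe_composedPoints]
    exact dispersion_le hdD hk (Nat.le_self_pow (by norm_num) k) hsplit hsolve h1
  · refine le_trans ?_ (card_bound h0 h2 hm hd hkm)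
    have h := card_composedPoints_le hb (d := d) hdD hk2
    rw [List.length_map] at hT
    calc ((composedPoints hb k d (workDim ε d) hdD hk2).card : ℝ)
        ≤ (search m k).length * (greedySplitter (workDim ε d) (k ^ 2) hk2).card := by
          exact_mod_cast h
      _ ≤ _ := mul_le_mul ((Nat.cast_le.2 hT).trans (searchBound_le hm hk0 hkm)) hA
          (by positivity) (by positivity)
  · have hGk : G k ≤ ∑ k ∈ Finset.range (m * 2 ^ m + 1), G k :=
      Finset.single_le_sum (fun _ _ => Nat.zero_le _) (Finset.mem_range.2 (by omega))
    have htD : t ≤ G k * workDim ε d ^ 3 := ht.trans (time_le_mul_pow hdD (by omega))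
    exact cubic_bound htD hGk (workDim_le_mul h0 (by omega))
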